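/- **Setting.** Let $n\ge 3$ be odd, $x_l=l/n$, and let $y_l=S(x_l)+\sigma_l\xi_l$, $1\le l\le n$, be observed, where $\xi_1,\dots,\xi_n$ are i.i.d. with $\mathbf E\xi_1=0$, $\mathbf E\xi_1^2=1$, $\mathbf E\xi_1^4=\xi^*<\infty$, and $\sigma_1,\dots,\sigma_n$ (which may depend on $S$) are nonnegative random variables such that $(\sigma_l)_l$ is independent of $(\xi_l)_l$ and $\sigma_l^2\le\sigma_*$ a.s. for a constant $\sigma_*\ge 1$. Put $\bar\xi=\sqrt{\xi^*-1}$ and $\bar\sigma=2(\bar\xi+\sqrt2)\sigma_*$. For $r>0$ let $W_r^1$ be the set of $1$-periodic functions $S:\mathbb R\to\mathbb R$ that are absolutely continuous on $[0,1]$ with $S'\in L^2[0,1]$ and $\int_0^1S^2+\int_0^1(S')^2\le r$ (for instance, differentiable ones with these properties). Let $\phi_1=1$, $\phi_j(x)=\sqrt2\cos(2\pi[j/2]x)$ for even $j\geq 2$, $\phi_j(x)=\sqrt2\sin(2\pi[j/2]x)$ for odd $j\ge3$; $\|f\|_n^2=\frac1n\sum_{l=1}^n f(x_l)^2$, and $\hat\theta_{j,n}=\frac1n\sum_{l=1}^n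 y_l\phi_j(x_l)$. Let $1\le m_n\le n$ be integers with $m_n/\sqrt n\to0$ and $m_n^2/\sqrt n\to\infty$, and let $\hat\varsigma_n=\sum_{j=m_n+1}^n\hat\theta_{j,n}^2$. Let $\Lambda\subset[0,1]^n$ be finite and nonempty with $\nu$ elements. For $\lambda\in\Lambda$ and $0<\rho<1/3$ let $\hat S_\lambda=\sum_{j=1}^n\lambda(j)\hat\theta_{j,n}\phi_j$, $$J_n(\lambda)=\sum_{j=1}^n\lambda(j)^2\hat\theta_{j,n}^2-2\sum_{j=1}^n\lambda(j)\Big(\hat\theta_{j,n}^2-\frac{\hat\varsigma_n}{n}\Big)+\rho\,\frac{\hat\varsigma_n}{n}\sum_{j=1}^n\lambda(j)^2 ,$$ let $\hat\lambda$ be a (measurable) minimizer of $J_n$ over $\Lambda$, and $\hat S_*=\hat S_{\hat\lambda}$. Define $$\varrho_n=\max_{\lambda\in\Lambda}\sum_{j=1}^n\lambda(j),\qquad \bar\varrho_{i,n}=\max_{\lambda\in\Lambda}\sup_{0\le x\le1}\Big|\sum_{j=1}^n\lambda(j)^i(\phi_j(x)^2-1)\Big|\quad(i=1,2),$$ $$\kappa(\rho)=\frac{6\rho-2\rho^2}{1-3\rho},\qquad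 \kappa_*(\rho)=\frac{4(1-\rho^2)}{1-3\rho},\qquad \Upsilon_n^*(\rho)=\frac{16\nu}{\rho}+4\bar\varrho_{1,n}\Big(1+\nu\frac{\bar\xi}{\sqrt n}\Big)+4\nu\varrho_n\frac{\bar\xi}{\sqrt n},$$ $$\Psi_n(\rho)=\frac{\rho(1-\rho)\Upsilon_n^*(\rho)+2\nu+2\rho^2(1-\rho)\bar\varrho_{2,n}}{\rho(1-3\rho)}\,\sigma_*,\qquad \varsigma_n^*(r)=\frac{4r\sqrt n}{m_n^2}+\frac{4\sqrt{r\sigma_*}}{m_n}+\frac{(2+m_n)\sigma_*}{\sqrt n},$$ $$\mathcal D_n(\rho,r)=\Psi_n(\rho)+\kappa_*(\rho)\big(\bar\sigma+\varsigma_n^*(r)\big)\frac{\varrho_n}{\sqrt n}.$$ **Theorem 3.2.** Let $r>0$. (a) For every odd $n\ge3$, every finite nonempty $\Lambda\subset[0,1]^n$, every $S\in W_r^1$ and every $0<\rho<1/3$, all the risks below are finite and $$\mathbf E\|\hat S_*-S\|_n^2\le(1+\kappa(\rho))\min_{\lambda\in\Lambda}\mathbf E\|\hat S_\lambda-S\|_n^2+\frac1n\mathcal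 D_n(\rho,r).$$ (b) Let integers $k_*=k_*(n)\ge1$ and reals $0<\varepsilon=\varepsilon(n)\le1$ satisfy $k_*\to\infty$, $k_*/\ln n\to0$, $\varepsilon\to0$, and $n^{\delta}\varepsilon\to\infty$ for every $\delta>0$. For each $n$ let $\Lambda=\{\lambda_\alpha:\alpha=(\beta,t),\ \beta\in\{1,\dots,k_*\},\ t\in\{\varepsilon,2\varepsilon,\dots,\lceil1/\varepsilon^2\rceil\varepsilon\}\}$, where $$\lambda_\alpha(j)=\mathbf 1_{\{1\le j\le j_0\}}+\big(1-(j/\omega_\alpha)^\beta\big)\mathbf 1_{\{j_0<j\le\omega_\alpha\}},\quad \omega_\alpha=(A_\beta tn)^{1/(2\beta+1)},\quad A_\beta=\frac{(\beta+1)(2\beta+1)}{\pi^{2\beta}\beta},\quad j_0=\lfloor\omega_\alpha/\ln n\rfloor .$$ Then, with $r$, $\sigma_*$ and $\xi^*$ fixed, for all $\delta>0$ and $0<\rho<1/3$, $\ \mathcal D_n(\rho,r)/n^\delta\to0$ as $n\to\infty$. -/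

import Mathlib

open MeasureTheory ProbabilityTheory Filter Topology

namespace HeteroRegression

noncomputable section

/-! Vectors indexed by `1, …, n` are functions on `Fin n`; the element `l : Fin n` stands for the
index `l + 1`. -/

/-- The trigonometric basis: `φ₁ = 1`, `φ_j(x) = √2 cos(2π[j/2]x)` for even `j ≥ 2` and
`φ_j(x) = √2 sin(2π[j/2]x)` for odd `j ≥ 3`. -/
def trigBasis (j : ℕ) (x : ℝ) : ℝ :=
  if j ≤ 1 then 1
  else if Even j then √2 * Real.cos (2 * Real.pi * ((j / 2 : ℕ) : ℝ) * x)
  else √2 * Real.sin (2 * Real.pi * ((j / 2 : ℕ) : ℝ) * x)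

/-- The function `φ_j² - 1`. -/
def trigBasisBar (j : ℕ) (x : ℝ) : ℝ := trigBasis j x ^ 2 - 1

/-- The design points `x_l = l / n`, `1 ≤ l ≤ n`. -/
def design (n : ℕ) (l : Fin n) : ℝ := (((l : ℕ) + 1 : ℕ) : ℝ) / n

/-- The squared empirical norm `‖f‖_n² = n⁻¹ ∑_l f(x_l)²`. -/
def empNormSq (n : ℕ) (f : ℝ → ℝ) : ℝ := (1 / (n : ℝ)) * ∑ l : Fin n, f (design n l) ^ 2

/-- The `j`-th discrete Fourier coefficient `(v, φ_j)_n = n⁻¹ ∑_l v_l φ_j(x_l)`, `1 ≤ j ≤ n`. -/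
def empFourier (n : ℕ) (v : Fin n → ℝ) (j : Fin n) : ℝ :=
  (1 / (n : ℝ)) * ∑ l : Fin n, v l * trigBasis ((j : ℕ) + 1) (design n l)

/-- The weighted least squares estimator `Ŝ_λ(x) = ∑_j λ(j) θ̂_{j,n} φ_j(x)` from the data `Y`. -/
def wlsEstimator (n : ℕ) (Y : Fin n → ℝ) (lam : Fin n → ℝ) (x : ℝ) : ℝ :=
  ∑ j : Fin n, lam j * empFourier n Y j * trigBasis ((j : ℕ) + 1) x

/-- The variance estimator `ς̂_n = ∑_{j = m + 1}^n θ̂_{j,n}²`. -/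
def varianceEstimator (n m : ℕ) (Y : Fin n → ℝ) : ℝ :=
  ∑ j ∈ Finset.univ.filter (fun j : Fin n => m < (j : ℕ) + 1), empFourier n Y j ^ 2

/-- The penalized cost function
`J_n(λ) = ∑ λ(j)² θ̂_j² - 2 ∑ λ(j) (θ̂_j² - ς̂_n / n) + ρ |λ|² ς̂_n / n`. -/
def cost (n m : ℕ) (ρ : ℝ) (Y : Fin n → ℝ) (lam : Fin n → ℝ) : ℝ :=
  ∑ j : Fin n, lam j ^ 2 * empFourier n Y j ^ 2
    - 2 * ∑ j : Fin n, lam j * (empFourier n Y j ^ 2 - (1 / (n : ℝ)) * varianceEstimator n m Y)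
    + ρ * ((∑ j : Fin n, lam j ^ 2) * varianceEstimator n m Y / n)

/-- `ϱ_n = max_{λ ∈ Λ} ∑_j λ(j)` (`Λ` finite and nonempty). -/
def rhoSum (n : ℕ) (Lam : Finset (Fin n → ℝ)) : ℝ := ⨆ lam : Lam, ∑ j : Fin n, lam.1 j

/-- `ϱ̄_{i,n} = max_{λ ∈ Λ} sup_{0 ≤ x ≤ 1} |∑_j λ(j)^i (φ_j(x)² - 1)|`. -/
def rhoBar (n i : ℕ) (Lam : Finset (Fin n → ℝ)) : ℝ :=
  ⨆ lam : Lam, ⨆ x : Set.Icc (0 : ℝ) 1,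
    |∑ j : Fin n, lam.1 j ^ i * trigBasisBar ((j : ℕ) + 1) x|

/-- `Υ_n^*(ρ)`, where `ξs` is the fourth moment of the noise, `ξ̄ = √(ξs - 1)` and `ν = |Λ|`. -/
def upsilonStar (n : ℕ) (ξs ρ : ℝ) (Lam : Finset (Fin n → ℝ)) : ℝ :=
  16 * (Lam.card : ℝ) / ρ
    + 4 * rhoBar n 1 Lam * (1 + (Lam.card : ℝ) * (√(ξs - 1) / √(n : ℝ)))
    + 4 * (Lam.card : ℝ) * rhoSum n Lam * (√(ξs - 1) / √(n : ℝ))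

/-- `Ψ_n(ρ)`, where `σs` is the bound on the squared volatilities. -/
def psi (n : ℕ) (σs ξs ρ : ℝ) (Lam : Finset (Fin n → ℝ)) : ℝ :=
  (ρ * (1 - ρ) * upsilonStar n ξs ρ Lam + 2 * (Lam.card : ℝ) + 2 * ρ ^ 2 * (1 - ρ) * rhoBar n 2 Lam)
    / (ρ * (1 - 3 * ρ)) * σs

/-- `κ(ρ) = (6ρ - 2ρ²) / (1 - 3ρ)`. -/
def kappa (ρ : ℝ) : ℝ := (6 * ρ - 2 * ρ ^ 2) / (1 - 3 * ρ)

/-- `κ_*(ρ) = 4 (1 - ρ²) / (1 - 3ρ)`. -/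
def kappaStar (ρ : ℝ) : ℝ := 4 * ((1 - ρ ^ 2) / (1 - 3 * ρ))

/-- `σ̄ = 2 (ξ̄ + √2) σ_*`. -/
def sigmaBar (σs ξs : ℝ) : ℝ := 2 * (√(ξs - 1) + √2) * σs

/-- `ς_n^*(r) = 4 r √n / m² + 4 √(r σ_*) / m + (2 + m) σ_* / √n`. -/
def varsigmaStar (n m : ℕ) (r σs : ℝ) : ℝ :=
  4 * r * √(n : ℝ) / (m : ℝ) ^ 2 + 4 * √(r * σs) * (1 / (m : ℝ)) + (2 + (m : ℝ)) * σs / √(n : ℝ)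

/-- The remainder `D_n(ρ, r) = Ψ_n(ρ) + κ_*(ρ) (σ̄ + ς_n^*(r)) ϱ_n / √n`. -/
def remainder (n m : ℕ) (r σs ξs ρ : ℝ) (Lam : Finset (Fin n → ℝ)) : ℝ :=
  psi n σs ξs ρ Lam
    + kappaStar ρ * (sigmaBar σs ξs + varsigmaStar n m r σs) * (rhoSum n Lam / √(n : ℝ))

/-- The periodic Sobolev ball `W_r^1`: `S` is `1`-periodic, absolutely continuous with a derivative
`g ∈ L²[0, 1]` (that is, `S` is the integral of `g` on a period), and `‖S‖² + ‖g‖² ≤ r`. -/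
def MemSobolevBall (r : ℝ) (S : ℝ → ℝ) : Prop :=
  Function.Periodic S 1 ∧
  ∃ g : ℝ → ℝ, MemLp g 2 (volume.restrict (Set.Icc (0 : ℝ) 1)) ∧
    (∀ x ∈ Set.Icc (0 : ℝ) 1, S x = S 0 + ∫ t in (0 : ℝ)..x, g t) ∧
    (∫ t in (0 : ℝ)..1, S t ^ 2) + (∫ t in (0 : ℝ)..1, g t ^ 2) ≤ r

/-- Differentiable periodic functions with square integrable derivative and
`‖S‖² + ‖S'‖² ≤ r` belong to the ball. -/
theorem memSobolevBall_of_differentiable {r : ℝ} {S : ℝ → ℝ} (hp : Function.Periodic S 1)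
    (hd : Differentiable ℝ S) (h2 : MemLp (deriv S) 2 (volume.restrict (Set.Icc (0 : ℝ) 1)))
    (hr : (∫ t in (0 : ℝ)..1, S t ^ 2) + (∫ t in (0 : ℝ)..1, deriv S t ^ 2) ≤ r) :
    MemSobolevBall r S := by
  refine ⟨hp, deriv S, h2, fun x hx => ?_, hr⟩
  have hi : IntegrableOn (deriv S) (Set.Icc (0 : ℝ) 1) := h2.integrable (by norm_num)
  have hx' : IntervalIntegrable (deriv S) volume 0 x := by
    rw [intervalIntegrable_iff_integrableOn_Icc_of_le hx.1]
    exact hi.mono_set (Set.Icc_subset_Icc_right hx.2)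
  have := intervalIntegral.integral_eq_sub_of_hasDerivAt
    (fun y _ => (hd y).hasDerivAt) hx'
  linarith

/-- The assumptions on the noise `ξ` and the volatilities `σ` (which are random variables): the
`ξ_l` are i.i.d. with mean `0`, variance `1` and fourth moment `ξs`; the `σ_l` are nonnegative with
`σ_l² ≤ σs` almost surely, and `(σ_l)_l` is independent of `(ξ_l)_l`. -/
structure NoiseModel {Ω : Type*} [MeasurableSpace Ω] (μ : Measure Ω) (n : ℕ)
    (ξ σ : Fin n → Ω → ℝ) (ξs σs : ℝ) : Prop where
  measurable_noise : ∀ l, Measurable (ξ l)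
  measurable_vol : ∀ l, Measurable (σ l)
  indep : iIndepFun ξ μ
  identDistrib : ∀ i j, IdentDistrib (ξ i) (ξ j) μ μ
  mean : ∀ l, ∫ ω, ξ l ω ∂μ = 0
  second_moment : ∀ l, ∫ ω, ξ l ω ^ 2 ∂μ = 1
  integrable_fourth : ∀ l, Integrable (fun ω => ξ l ω ^ 4) μ
  fourth_moment : ∀ l, ∫ ω, ξ l ω ^ 4 ∂μ = ξs
  vol_nonneg : ∀ l, ∀ᵐ ω ∂μ, 0 ≤ σ l ω
  vol_bound : ∀ l, ∀ᵐ ω ∂μ, σ l ω ^ 2 ≤ σs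
  indep_vol_noise : IndepFun (fun ω l => σ l ω) (fun ω l => ξ l ω) μ

/-- The observations `y_l = S(x_l) + σ_l ξ_l`. -/
def observation {Ω : Type*} (n : ℕ) (S : ℝ → ℝ) (ξ σ : Fin n → Ω → ℝ) (ω : Ω) (l : Fin n) : ℝ :=
  S (design n l) + σ l ω * ξ l ω

/-- The empirical squared error `‖Ŝ_λ - S‖_n²` of the estimator with weights `lam` on data `Y`. -/
def lossOf (n : ℕ) (S : ℝ → ℝ) (Y : Fin n → ℝ) (lam : Fin n → ℝ) : ℝ :=
  empNormSq n (fun x => wlsEstimator n Y lam x - S x)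

/-- `lamHat` is a (measurable) version of `λ̂ = argmin_{λ ∈ Λ} J_n(λ)` on the data `Y`, with ties
broken in an arbitrary way. -/
def IsArgmin {Ω : Type*} [MeasurableSpace Ω] (n m : ℕ) (ρ : ℝ) (Lam : Finset (Fin n → ℝ))
    (Y : Ω → Fin n → ℝ) (lamHat : Ω → Fin n → ℝ) : Prop :=
  Measurable lamHat ∧
    ∀ ω, lamHat ω ∈ Lam ∧ ∀ lam ∈ Lam, cost n m ρ (Y ω) (lamHat ω) ≤ cost n m ρ (Y ω) lam

/-- `A_β = (β + 1)(2β + 1) / (π^{2β} β)`. -/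
def pinskerConst (β : ℕ) : ℝ :=
  (((β : ℝ) + 1) * (2 * (β : ℝ) + 1)) / (Real.pi ^ (2 * β) * (β : ℝ))

/-- `ω_α = (A_β t n)^{1 / (2β + 1)}` for `α = (β, t)`. -/
def pinskerOmega (n β : ℕ) (t : ℝ) : ℝ :=
  (pinskerConst β * t * (n : ℝ)) ^ (1 / (2 * (β : ℝ) + 1))

/-- The weights `λ_α(j) = 1_{1 ≤ j ≤ j₀} + (1 - (j / ω_α)^β) 1_{j₀ < j ≤ ω_α}`, where
`j₀ = ⌊ω_α / ln n⌋`. -/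
def pinskerWeight (n β : ℕ) (t : ℝ) (j : Fin n) : ℝ :=
  if (j : ℕ) + 1 ≤ ⌊pinskerOmega n β t / Real.log n⌋₊ then 1
  else if (((j : ℕ) + 1 : ℕ) : ℝ) ≤ pinskerOmega n β t then
    1 - ((((j : ℕ) + 1 : ℕ) : ℝ) / pinskerOmega n β t) ^ β
  else 0

/-- The family `{λ_α : α ∈ {1, …, k} × {ε, 2ε, …, ⌈1/ε²⌉ε}}` of Pinsker-type weights. -/
def pinskerFamily (n k : ℕ) (ε : ℝ) : Finset (Fin n → ℝ) :=
  (Finset.Icc 1 k ×ˢ Finset.Icc 1 ⌈1 / ε ^ 2⌉₊).image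
    (fun a => pinskerWeight n a.1 ((a.2 : ℝ) * ε))

end

end HeteroRegression

open HeteroRegression

namespace HeteroRegression

/-! For odd `n` the trigonometric basis is orthonormal and complete for the empirical inner product.
With θ the coefficients of `S` and e those of the noise, the loss is therefore exactly ∑ (λ(θ + e) -
θ)² (`lossOf_eq`), and it differs from the cost by a term free of λ and by errors (`coefLoss_eq`).

Comparing the selected λ with a fixed λ₀ leaves three errors. The linear one, 2∑ (λ - λ₀)θe, is
split by Young's inequality into ρ∑ ((λ - λ₀)θ)², which the two losses reabsorb
(`sum_sq_signal_sub_le`), and a normalized square of mean at most σ_*/n. The quadratic one, ∑ λ(e² -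
v) with v the average variance of a coefficient, splits into a bias due to unequal volatilities
(controlled by ϱ̄), a diagonal part in ξ² - 1 and an off-diagonal part (`sum_mul_sq_noiseCoef`).
Young's inequality bounds the off-diagonal part by ρv∑ λ² plus a small remainder, and the penalty
exists to cancel this term; at λ₀ it is paid for by the risk (`penalty_le`). The third error comes
from estimating v by ς̂/n (`integral_abs_meanVol_sub_le`), where the Sobolev condition bounds the
tail of θ (`sum_sq_empFourier_tail_le`).

As the selected λ depends on the data, its error terms are replaced by sums over Λ, whence the
factor ν. The resulting majorant contains only λ₀, so by independence it can be integrated over ξ at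
frozen volatilities and then over σ (`NoiseModel.lintegral_lossMajorant_le`).

For (b), φ² - 1 cancels between the cosine and sine of one frequency, so ϱ̄ ≤ 1 for nonincreasing
weights. Moreover ω_α ≤ (2n/ε)^{1/3}, so ϱ_n/√n stays bounded. The remainder is then O(1 + ν), with
ν at most 2k_*/ε², which grows slower than every power of n. -/

/-! ### Discrete orthogonality and completeness of the basis. -/

theorem sin_pi_mul_div_ne_zero {n : ℕ} (hn : 0 < n) {k : ℤ} (hk : ¬ (n : ℤ) ∣ k) :
    Real.sin (Real.pi * k / n) ≠ 0 := by
  intro h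
  obtain ⟨m, hm⟩ := Real.sin_eq_zero_iff.1 h
  apply hk
  have hn' : (n : ℝ) ≠ 0 := by positivity
  refine ⟨m, ?_⟩
  have : (k : ℝ) = n * m := by
    field_simp at hm
    linarith
  exact_mod_cast this

theorem sum_fin_sub (F : ℕ → ℝ) (n : ℕ) :
    ∑ l : Fin n, (F ((l : ℕ) + 1) - F (l : ℕ)) = F n - F 0 := by
  rw [Fin.sum_univ_eq_sum_range (fun i => F (i + 1) - F i) n, Finset.sum_range_sub]

/-- The sum of `cos (2πkx)` over the design points. -/
theorem sum_cos_design {n : ℕ} (hn : 0 < n) (k : ℤ) :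
    ∑ l : Fin n, Real.cos (2 * Real.pi * k * design n l) = if (n : ℤ) ∣ k then (n : ℝ) else 0 := by
  have hn' : (n : ℝ) ≠ 0 := by positivity
  split_ifs with hk
  · obtain ⟨m, rfl⟩ := hk
    have : ∀ l : Fin n, Real.cos (2 * Real.pi * ((n * m : ℤ) : ℝ) * design n l) = 1 := by
      intro l
      have : 2 * Real.pi * ((n * m : ℤ) : ℝ) * design n l
          = ((m * ((l : ℕ) + 1 : ℕ) : ℤ) : ℝ) * (2 * Real.pi) := by
        unfold design; push_cast; field_simp
      rw [this, Real.cos_int_mul_two_pi]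
    rw [Finset.sum_congr rfl fun l _ => this l]
    simp
  · have h := sin_pi_mul_div_ne_zero hn hk
    apply mul_left_cancel₀ (mul_ne_zero two_ne_zero h)
    rw [mul_zero, Finset.mul_sum]
    -- Dirichlet-kernel trick: multiplied by 2 sin(πk/n), each cosine becomes a difference of sines
    -- at half-integer points. The sum telescopes, and its end points differ by k full periods.
    have h2 : ∀ l : Fin n, 2 * Real.sin (Real.pi * k / n) * Real.cos (2 * Real.pi * k * design n l)
        = (fun i : ℕ => Real.sin (Real.pi * k * (2 * (i : ℝ) + 1) / n)) ((l : ℕ) + 1)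
          - (fun i : ℕ => Real.sin (Real.pi * k * (2 * (i : ℝ) + 1) / n)) (l : ℕ) := by
      intro l
      have e1 : Real.pi * k * (2 * (((l : ℕ) + 1 : ℕ) : ℝ) + 1) / n
          = 2 * Real.pi * k * design n l + Real.pi * k / n := by
        unfold design; push_cast; field_simp
      have e2 : Real.pi * k * (2 * ((l : ℕ) : ℝ) + 1) / n
          = 2 * Real.pi * k * design n l - Real.pi * k / n := by
        unfold design; push_cast; field_simp; ring
      simp only [e1, e2]
      rw [Real.sin_add, Real.sin_sub]; ring
    rw [Finset.sum_congr rfl (fun l _ => h2 l),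
      sum_fin_sub (fun i : ℕ => Real.sin (Real.pi * k * (2 * (i : ℝ) + 1) / n))]
    have : Real.pi * k * (2 * (n : ℝ) + 1) / n
        = Real.pi * k * (2 * ((0 : ℕ) : ℝ) + 1) / n + k * (2 * Real.pi) := by
      push_cast; field_simp; ring
    rw [this, Real.sin_add_int_mul_two_pi, sub_self]

/-- The sum of `sin (2πkx)` over the design points vanishes. -/
theorem sum_sin_design {n : ℕ} (hn : 0 < n) (k : ℤ) :
    ∑ l : Fin n, Real.sin (2 * Real.pi * k * design n l) = 0 := by
  have hn' : (n : ℝ) ≠ 0 := by positivity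
  by_cases hk : (n : ℤ) ∣ k
  · obtain ⟨m, rfl⟩ := hk
    have : ∀ l : Fin n, Real.sin (2 * Real.pi * ((n * m : ℤ) : ℝ) * design n l) = 0 := by
      intro l
      have : 2 * Real.pi * ((n * m : ℤ) : ℝ) * design n l
          = ((2 * (m * ((l : ℕ) + 1 : ℕ)) : ℤ) : ℝ) * Real.pi := by
        unfold design; push_cast; field_simp
      rw [this, Real.sin_int_mul_pi]
    rw [Finset.sum_congr rfl fun l _ => this l]
    simp
  · have h := sin_pi_mul_div_ne_zero hn hk
    apply mul_left_cancel₀ (mul_ne_zero (neg_ne_zero.2 two_ne_zero) h)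
    rw [mul_zero, Finset.mul_sum]
    have h2 : ∀ l : Fin n, -2 * Real.sin (Real.pi * k / n) * Real.sin (2 * Real.pi * k * design n l)
        = (fun i : ℕ => Real.cos (Real.pi * k * (2 * (i : ℝ) + 1) / n)) ((l : ℕ) + 1)
          - (fun i : ℕ => Real.cos (Real.pi * k * (2 * (i : ℝ) + 1) / n)) (l : ℕ) := by
      intro l
      have e1 : Real.pi * k * (2 * (((l : ℕ) + 1 : ℕ) : ℝ) + 1) / n
          = 2 * Real.pi * k * design n l + Real.pi * k / n := by
        unfold design; push_cast; field_simp
      have e2 : Real.pi * k * (2 * ((l : ℕ) : ℝ) + 1) / n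
          = 2 * Real.pi * k * design n l - Real.pi * k / n := by
        unfold design; push_cast; field_simp; ring
      simp only [e1, e2]
      rw [Real.cos_add, Real.cos_sub]; ring
    rw [Finset.sum_congr rfl (fun l _ => h2 l),
      sum_fin_sub (fun i : ℕ => Real.cos (Real.pi * k * (2 * (i : ℝ) + 1) / n))]
    have : Real.pi * k * (2 * (n : ℝ) + 1) / n
        = Real.pi * k * (2 * ((0 : ℕ) : ℝ) + 1) / n + k * (2 * Real.pi) := by
      push_cast; field_simp; ring
    rw [this, Real.cos_add_int_mul_two_pi, sub_self]

theorem trigBasis_one (x : ℝ) : trigBasis 1 x = 1 := by simp [trigBasis]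

theorem trigBasis_even {k : ℕ} (hk : 1 ≤ k) (x : ℝ) :
    trigBasis (2 * k) x = √2 * Real.cos (2 * Real.pi * k * x) := by
  have h1 : ¬ (2 * k ≤ 1) := by omega
  simp [trigBasis, h1]

theorem trigBasis_odd {k : ℕ} (hk : 1 ≤ k) (x : ℝ) :
    trigBasis (2 * k + 1) x = √2 * Real.sin (2 * Real.pi * k * x) := by
  have h1 : ¬ (2 * k + 1 ≤ 1) := by omega
  have h2 : ¬ Even (2 * k + 1) := by simp
  have h3 : (2 * k + 1) / 2 = k := by omega
  simp only [trigBasis, h1, h2, h3, if_false]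

theorem trigBasis_sq_le (j : ℕ) (x : ℝ) : trigBasis j x ^ 2 ≤ 2 := by
  unfold trigBasis
  split_ifs
  · norm_num
  · rw [mul_pow, Real.sq_sqrt (by norm_num)]
    nlinarith [Real.cos_sq_le_one (2 * Real.pi * ((j / 2 : ℕ) : ℝ) * x)]
  · rw [mul_pow, Real.sq_sqrt (by norm_num)]
    nlinarith [Real.sin_sq_le_one (2 * Real.pi * ((j / 2 : ℕ) : ℝ) * x)]

theorem abs_trigBasisBar_le (j : ℕ) (x : ℝ) : |trigBasisBar j x| ≤ 1 := by
  unfold trigBasisBar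
  rw [abs_le]
  constructor <;> nlinarith [trigBasis_sq_le j x, sq_nonneg (trigBasis j x)]

theorem exists_index {j : ℕ} (hj : 1 ≤ j) :
    j = 1 ∨ ∃ k, 1 ≤ k ∧ (j = 2 * k ∨ j = 2 * k + 1) := by
  by_cases h : j = 1
  · exact Or.inl h
  · exact Or.inr ⟨j / 2, by omega, by omega⟩

/-- The discrete orthogonality relations of the trigonometric basis for odd `n`. -/
theorem sum_trigBasis_mul {n : ℕ} (hn : Odd n) {i j : ℕ} (hi : 1 ≤ i) (hin : i ≤ n)
    (hj : 1 ≤ j) (hjn : j ≤ n) :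
    ∑ l : Fin n, trigBasis i (design n l) * trigBasis j (design n l)
      = if i = j then (n : ℝ) else 0 := by
  have hn0 : 0 < n := hn.pos
  have h2 : √2 * √2 = (2 : ℝ) := Real.mul_self_sqrt (by norm_num)
  have hcos : ∀ k : ℕ, 1 ≤ k → k < n →
      ∑ l : Fin n, Real.cos (2 * Real.pi * k * design n l) = 0 := by
    intro k hk hkn
    have := sum_cos_design hn0 (k : ℤ)
    rw [if_neg (by rw [Int.natCast_dvd_natCast]; exact Nat.not_dvd_of_pos_of_lt hk hkn)] at this
    simpa using this
  have hsin : ∀ k : ℕ, ∑ l : Fin n, Real.sin (2 * Real.pi * k * design n l) = 0 := by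
    intro k
    simpa using sum_sin_design hn0 (k : ℤ)
  have hdiff : ∀ k k' : ℕ, k < n → k' < n →
      ∑ l : Fin n, Real.cos (2 * Real.pi * k * design n l - 2 * Real.pi * k' * design n l)
        = if k = k' then (n : ℝ) else 0 := by
    intro k k' hk hk'
    have := sum_cos_design hn0 ((k : ℤ) - k')
    have e : ((n : ℤ) ∣ (k : ℤ) - k') ↔ k = k' := by
      constructor
      · intro h
        have := Int.eq_zero_of_abs_lt_dvd h (by rw [abs_lt]; constructor <;> omega)
        omega
      · rintro rfl; simp
    simp only [e] at this
    rw [← this]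
    refine Finset.sum_congr rfl fun l _ => ?_
    push_cast; congr 1; ring
  have hsum : ∀ k k' : ℕ, 1 ≤ k → k + k' < n →
      ∑ l : Fin n, Real.cos (2 * Real.pi * k * design n l + 2 * Real.pi * k' * design n l) = 0 := by
    intro k k' hk hk'
    rw [← hcos (k + k') (by omega) hk']
    refine Finset.sum_congr rfl fun l _ => ?_
    push_cast; congr 1; ring
  have hsind : ∀ k k' : ℕ,
      ∑ l : Fin n, Real.sin (2 * Real.pi * k * design n l - 2 * Real.pi * k' * design n l) = 0 := by
    intro k k'
    rw [← sum_sin_design hn0 ((k : ℤ) - k')]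
    refine Finset.sum_congr rfl fun l _ => ?_
    push_cast; congr 1; ring
  have hsins : ∀ k k' : ℕ,
      ∑ l : Fin n, Real.sin (2 * Real.pi * k * design n l + 2 * Real.pi * k' * design n l) = 0 := by
    intro k k'
    rw [← hsin (k + k')]
    refine Finset.sum_congr rfl fun l _ => ?_
    push_cast; congr 1; ring
  -- Oddness matters here: every frequency is at most (n - 1)/2, so sums of two frequencies stay
  -- below n. For even n, the index n has frequency n/2 and the norm relation fails.
  obtain ⟨N, hN⟩ := hn
  rcases exists_index hi with rfl | ⟨k, hk, rfl | rfl⟩ <;>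
    rcases exists_index hj with rfl | ⟨k', hk', rfl | rfl⟩
  · simp [trigBasis_one]
  · rw [if_neg (by omega)]
    simp only [trigBasis_one, trigBasis_even hk', one_mul, ← Finset.mul_sum]
    rw [hcos k' hk' (by omega), mul_zero]
  · rw [if_neg (by omega)]
    simp only [trigBasis_one, trigBasis_odd hk', one_mul, ← Finset.mul_sum]
    rw [hsin k', mul_zero]
  · rw [if_neg (by omega)]
    simp only [trigBasis_one, trigBasis_even hk, mul_one, ← Finset.mul_sum]
    rw [hcos k hk (by omega), mul_zero]
  · have e : (2 * k = 2 * k') ↔ k = k' := by omega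
    simp only [e]
    rw [← hdiff k k' (by omega) (by omega), ← add_zero (∑ l : Fin n, Real.cos (_ - _)),
      ← hsum k k' hk (by omega), ← Finset.sum_add_distrib]
    refine Finset.sum_congr rfl fun l _ => ?_
    rw [trigBasis_even hk, trigBasis_even hk', Real.cos_add, Real.cos_sub]
    linear_combination Real.cos (2 * Real.pi * k * design n l) *
      Real.cos (2 * Real.pi * k' * design n l) * h2
  · rw [if_neg (by omega), ← sub_self (0 : ℝ)]
    nth_rewrite 1 [← hsins k k']
    rw [← hsind k k', ← Finset.sum_sub_distrib]
    refine Finset.sum_congr rfl fun l _ => ?_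
    rw [trigBasis_even hk, trigBasis_odd hk', Real.sin_add, Real.sin_sub]
    linear_combination Real.cos (2 * Real.pi * k * design n l) *
      Real.sin (2 * Real.pi * k' * design n l) * h2
  · rw [if_neg (by omega)]
    simp only [trigBasis_one, trigBasis_odd hk, mul_one, ← Finset.mul_sum]
    rw [hsin k, mul_zero]
  · rw [if_neg (by omega), ← add_zero (0 : ℝ)]
    nth_rewrite 1 [← hsins k k']
    rw [← hsind k k', ← Finset.sum_add_distrib]
    refine Finset.sum_congr rfl fun l _ => ?_
    rw [trigBasis_odd hk, trigBasis_even hk', Real.sin_add, Real.sin_sub]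
    linear_combination Real.sin (2 * Real.pi * k * design n l) *
      Real.cos (2 * Real.pi * k' * design n l) * h2
  · have e : (2 * k + 1 = 2 * k' + 1) ↔ k = k' := by omega
    simp only [e]
    rw [← hdiff k k' (by omega) (by omega), ← sub_zero (∑ l : Fin n, Real.cos (_ - _)),
      ← hsum k k' hk (by omega), ← Finset.sum_sub_distrib]
    refine Finset.sum_congr rfl fun l _ => ?_
    rw [trigBasis_odd hk, trigBasis_odd hk', Real.cos_add, Real.cos_sub]
    linear_combination Real.sin (2 * Real.pi * k * design n l) *
      Real.sin (2 * Real.pi * k' * design n l) * h2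

/-- The value of the `(j + 1)`-st basis function at the `(l + 1)`-st design point. -/
noncomputable def basisValue (n : ℕ) (j l : Fin n) : ℝ := trigBasis ((j : ℕ) + 1) (design n l)

theorem basisValue_sq_le (n : ℕ) (j l : Fin n) : basisValue n j l ^ 2 ≤ 2 := trigBasis_sq_le _ _

theorem sum_basisValue_mul {n : ℕ} (hn : Odd n) (i j : Fin n) :
    ∑ l, basisValue n i l * basisValue n j l = if i = j then (n : ℝ) else 0 := by
  have := sum_trigBasis_mul hn (i := (i : ℕ) + 1) (j := (j : ℕ) + 1) (by omega) (by omega)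
    (by omega) (by omega)
  simp only [add_left_inj, Fin.val_inj] at this
  exact this

/-- The dual orthogonality relations: the basis is complete on the design points. -/
theorem sum_basisValue_mul' {n : ℕ} (hn : Odd n) (l k : Fin n) :
    ∑ j, basisValue n j l * basisValue n j k = if l = k then (n : ℝ) else 0 := by
  have hn0 : (n : ℝ) ≠ 0 := by have := hn.pos; positivity
  -- Row orthogonality makes Aᵀ/n a right inverse of the square matrix A, hence also a left inverse,
  -- which is column orthogonality.
  let A : Matrix (Fin n) (Fin n) ℝ := Matrix.of fun j l => basisValue n j l
  have h1 : A * ((1 / (n : ℝ)) • A.transpose) = 1 := by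
    ext i j
    rw [Matrix.mul_smul, Matrix.smul_apply, Matrix.mul_apply]
    simp only [Matrix.transpose_apply, A,
      Matrix.of_apply, sum_basisValue_mul hn, Matrix.one_apply, smul_eq_mul]
    split_ifs <;> simp [hn0]
  have h2 := mul_eq_one_comm.1 h1
  have h3 := congrFun (congrFun h2 l) k
  rw [Matrix.smul_mul, Matrix.smul_apply, Matrix.mul_apply] at h3
  simp only [Matrix.transpose_apply, A, Matrix.of_apply, Matrix.one_apply, smul_eq_mul] at h3
  field_simp at h3
  rw [h3]; split_ifs <;> simp

theorem sum_basisValue_sq {n : ℕ} (hn : Odd n) (l : Fin n) :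
    ∑ j, basisValue n j l ^ 2 = n := by
  simpa [sq] using sum_basisValue_mul' hn l l

theorem empFourier_eq (n : ℕ) (v : Fin n → ℝ) (j : Fin n) :
    empFourier n v j = (1 / (n : ℝ)) * ∑ l, v l * basisValue n j l := rfl

theorem sum_empFourier_mul {n : ℕ} (hn : Odd n) (v : Fin n → ℝ) (l : Fin n) :
    ∑ j, empFourier n v j * basisValue n j l = v l := by
  have hn0 : (n : ℝ) ≠ 0 := by have := hn.pos; positivity
  simp only [empFourier_eq, mul_assoc, ← Finset.mul_sum, Finset.sum_mul]
  rw [Finset.sum_comm]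
  simp only [← Finset.mul_sum, sum_basisValue_mul' hn]
  simp; field_simp

/-- Parseval's identity for trigonometric sums on the design points. -/
theorem sum_sq_trigSum {n : ℕ} (hn : Odd n) (c : Fin n → ℝ) :
    ∑ l, (∑ j, c j * basisValue n j l) ^ 2 = n * ∑ j, c j ^ 2 := by
  have : ∀ l, (∑ j, c j * basisValue n j l) ^ 2
      = ∑ i, ∑ j, c i * c j * (basisValue n i l * basisValue n j l) := by
    intro l
    rw [sq, Finset.sum_mul_sum]
    refine Finset.sum_congr rfl fun i _ => Finset.sum_congr rfl fun j _ => by ring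
  simp only [this]
  rw [Finset.sum_comm]
  simp_rw [Finset.sum_comm (s := (Finset.univ : Finset (Fin n))) (t := Finset.univ)
    (f := fun l j => _ * (basisValue n _ l * basisValue n j l)), ← Finset.mul_sum,
    sum_basisValue_mul hn]
  simp [Finset.mul_sum, sq, mul_comm]

theorem sum_sq_empFourier {n : ℕ} (hn : Odd n) (v : Fin n → ℝ) :
    ∑ j, empFourier n v j ^ 2 = (1 / (n : ℝ)) * ∑ l, v l ^ 2 := by
  have hn0 : (n : ℝ) ≠ 0 := by have := hn.pos; positivity
  have := sum_sq_trigSum hn (empFourier n v)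
  simp only [sum_empFourier_mul hn] at this
  rw [this]; field_simp

/-! ### Sobolev decay of the empirical Fourier coefficients. -/

theorem trigBasis_periodic (j : ℕ) : Function.Periodic (trigBasis j) 1 := by
  intro x
  have e : 2 * Real.pi * ((j / 2 : ℕ) : ℝ) * (x + 1)
      = 2 * Real.pi * ((j / 2 : ℕ) : ℝ) * x + ((j / 2 : ℕ) : ℝ) * (2 * Real.pi) := by ring
  unfold trigBasis
  rw [e, Real.cos_add_nat_mul_two_pi, Real.sin_add_nat_mul_two_pi]

/-- The design is one full period of the grid of step 1/n, so a shift only permutes it modulo 1. The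
difference of the two sums telescopes to a value that periodicity makes zero. -/
theorem sum_design_shift {n : ℕ} (hn : 0 < n) {f : ℝ → ℝ} (hf : Function.Periodic f 1) :
    ∑ l : Fin n, f (design n l + 1 / n) = ∑ l : Fin n, f (design n l) := by
  rw [← sub_eq_zero, ← Finset.sum_sub_distrib]
  have hn' : (n : ℝ) ≠ 0 := by positivity
  have h := sum_fin_sub (fun i : ℕ => f (((i + 1 : ℕ) : ℝ) / n)) n
  have e : (((n + 1 : ℕ) : ℝ) / n) = ((0 + 1 : ℕ) : ℝ) / n + 1 := by
    push_cast; field_simp; ring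
  rw [e, hf, sub_self] at h
  rw [← h]
  refine Finset.sum_congr rfl fun l _ => ?_
  have e2 : design n l + 1 / n = (((l : ℕ) + 1 + 1 : ℕ) : ℝ) / n := by
    unfold design; push_cast; ring
  rw [e2]; rfl

/-- Groups the cosine and the sine of each frequency, on which a shift acts as a rotation. -/
theorem sum_fin_two_mul_add_one (f : ℕ → ℝ) (N : ℕ) :
    ∑ j : Fin (2 * N + 1), f ((j : ℕ) + 1)
      = f 1 + ∑ k ∈ Finset.range N, (f (2 * (k + 1)) + f (2 * (k + 1) + 1)) := by
  rw [Fin.sum_univ_eq_sum_range (fun i => f (i + 1)) (2 * N + 1)]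
  induction N with
  | zero => simp
  | succ N ih =>
    rw [show 2 * (N + 1) + 1 = 2 * N + 1 + 1 + 1 by ring, Finset.sum_range_succ,
      Finset.sum_range_succ, ih, Finset.sum_range_succ]
    rw [show 2 * N + 1 + 1 = 2 * (N + 1) by ring]
    ring

/-- Cauchy–Schwarz against the constant 1, read off from the nonnegativity of the integrated squared
deviation of g from its mean. -/
theorem sq_intervalIntegral_le {g : ℝ → ℝ} {a b : ℝ} (hab : a < b)
    (h1 : IntervalIntegrable g volume a b) (h2 : IntervalIntegrable (fun t => g t ^ 2) volume a b) :
    (∫ t in a..b, g t) ^ 2 ≤ (b - a) * ∫ t in a..b, g t ^ 2 := by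
  set I := ∫ t in a..b, g t
  have hpos : 0 < b - a := sub_pos.2 hab
  have h : 0 ≤ ∫ t in a..b, (g t - I / (b - a)) ^ 2 :=
    intervalIntegral.integral_nonneg hab.le fun t _ => sq_nonneg _
  have e : (fun t => (g t - I / (b - a)) ^ 2)
      = fun t => (g t ^ 2 - 2 * (I / (b - a)) * g t) + (I / (b - a)) ^ 2 := by
    ext t; ring
  rw [e, intervalIntegral.integral_add (h2.sub (h1.const_mul _)) (by simp),
    intervalIntegral.integral_sub h2 (h1.const_mul _), intervalIntegral.integral_const_mul,
    intervalIntegral.integral_const, smul_eq_mul] at h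
  change 0 ≤ (∫ t in a..b, g t ^ 2) - 2 * (I / (b - a)) * I + (b - a) * (I / (b - a)) ^ 2 at h
  have e2 : (∫ t in a..b, g t ^ 2) - 2 * (I / (b - a)) * I + (b - a) * (I / (b - a)) ^ 2
      = (∫ t in a..b, g t ^ 2) - I ^ 2 / (b - a) := by
    field_simp; ring
  rw [e2, sub_nonneg, div_le_iff₀ hpos] at h
  linarith

/-- Each increment integrates the derivative over an interval of length 1/n. Cauchy–Schwarz yields
the factor 1/n, and the intervals tile a period. -/
theorem sum_sq_increment_le {r : ℝ} {S : ℝ → ℝ} (hS : MemSobolevBall r S) {n : ℕ} (hn : 0 < n) :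
    ∑ l : Fin n, (S (design n l + 1 / n) - S (design n l)) ^ 2 ≤ r / n := by
  obtain ⟨hp, g, hg, hS, hr⟩ := hS
  have hn' : (0 : ℝ) < n := by positivity
  -- Passing from forward to backward differences keeps all points inside [0, 1], where the integral
  -- representation of S is available.
  have hper : Function.Periodic (fun x => (S x - S (x - 1 / n)) ^ 2) 1 := by
    intro x
    have e : x + 1 - 1 / (n : ℝ) = x - 1 / n + 1 := by ring
    simp only [e, hp x, hp (x - 1 / n)]
  have h1 := sum_design_shift hn hper
  simp only [add_sub_cancel_right] at h1
  rw [h1]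
  have hgi : IntegrableOn g (Set.Icc 0 1) := hg.integrable (by norm_num)
  have hg2 : IntegrableOn (fun t => g t ^ 2) (Set.Icc 0 1) := hg.integrable_sq
  have hI : ∀ i : ℕ, i ≤ n → (i : ℝ) / n ∈ Set.Icc (0 : ℝ) 1 := by
    intro i hi
    refine ⟨by positivity, ?_⟩
    rw [div_le_one hn']; exact_mod_cast hi
  have key : ∀ f : ℝ → ℝ, IntegrableOn f (Set.Icc 0 1) → ∀ a b, a ∈ Set.Icc (0 : ℝ) 1 →
      b ∈ Set.Icc (0 : ℝ) 1 → IntervalIntegrable f volume a b := by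
    intro f hf a b ha hb
    rw [intervalIntegrable_iff]
    refine hf.mono_set ?_
    intro x hx
    rw [Set.uIoc, Set.mem_Ioc] at hx
    exact ⟨(le_min ha.1 hb.1).trans hx.1.le, hx.2.trans (max_le ha.2 hb.2)⟩
  have hterm : ∀ l : Fin n, (S (design n l) - S (design n l - 1 / n)) ^ 2
      ≤ (1 / n) * ∫ t in (((l : ℕ) : ℝ) / n)..((((l : ℕ) + 1 : ℕ) : ℝ) / n), g t ^ 2 := by
    intro l
    have hl := l.2
    have e : design n l - 1 / n = ((l : ℕ) : ℝ) / n := by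
      unfold design; push_cast; ring
    have i1 := hI l hl.le
    have i2 := hI (l + 1) hl
    have i0 : (0 : ℝ) ∈ Set.Icc (0 : ℝ) 1 := by simp
    rw [e]
    unfold design
    rw [hS _ i1, hS _ i2, add_sub_add_left_eq_sub,
      intervalIntegral.integral_interval_sub_left (key g hgi _ _ i0 i2) (key g hgi _ _ i0 i1)]
    refine (sq_intervalIntegral_le ?_ (key g hgi _ _ i1 i2) (key _ hg2 _ _ i1 i2)).trans (le_of_eq ?_)
    · push_cast; gcongr; linarith
    · congr 1; push_cast; ring
  refine (Finset.sum_le_sum fun l _ => hterm l).trans ?_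
  rw [← Finset.mul_sum, Fin.sum_univ_eq_sum_range
    (fun l : ℕ => ∫ t in ((l : ℝ) / n)..(((l + 1 : ℕ) : ℝ) / n), g t ^ 2) n,
    intervalIntegral.sum_integral_adjacent_intervals (a := fun i : ℕ => (i : ℝ) / n)
      (fun k hk => key _ hg2 _ _ (hI k hk.le) (hI (k + 1) hk))]
  have hnn : 0 ≤ ∫ t in (0 : ℝ)..1, S t ^ 2 :=
    intervalIntegral.integral_nonneg zero_le_one fun t _ => sq_nonneg _
  simp only [Nat.cast_zero, zero_div, div_self hn'.ne']
  rw [one_div_mul_eq_div]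
  gcongr
  linarith

/-- The Fourier coefficients of the function values at the design points decay like those of
a Sobolev function: a weighted sum of squares bound. -/
theorem sum_sq_freq_mul_empFourier_le {r : ℝ} {S : ℝ → ℝ} (hS : MemSobolevBall r S) {n : ℕ}
    (hn : Odd n) :
    ∑ j : Fin n, 16 * ((((j : ℕ) + 1) / 2 : ℕ) : ℝ) ^ 2
      * empFourier n (fun l => S (design n l)) j ^ 2 ≤ r := by
  have hn0 := hn.pos
  have hn' : (0 : ℝ) < n := by positivity
  set d : Fin n → ℝ := fun l => S (design n l + 1 / n) - S (design n l) with hd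
  have hP := sum_sq_empFourier hn d
  have hle : ∑ j, empFourier n d j ^ 2 ≤ r / n ^ 2 := by
    rw [hP]
    calc (1 / (n : ℝ)) * ∑ l, d l ^ 2 ≤ (1 / (n : ℝ)) * (r / n) := by
          gcongr; exact sum_sq_increment_le hS hn0
      _ = r / n ^ 2 := by field_simp
  set a : ℕ → ℝ := fun j => (1 / (n : ℝ)) * ∑ l : Fin n, S (design n l) * trigBasis j (design n l)
    with ha
  set D : ℕ → ℝ := fun j => (1 / (n : ℝ)) * ∑ l : Fin n, d l * trigBasis j (design n l) with hD
  -- Summation by parts: by periodicity the difference operator moves from S to the basis function.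
  have hshift : ∀ j, D j = (1 / (n : ℝ)) *
      ∑ l : Fin n, S (design n l) * (trigBasis j (design n l - 1 / n) - trigBasis j (design n l)) := by
    intro j
    have hper : Function.Periodic (fun x => S x * trigBasis j (x - 1 / n)) 1 := by
      intro x
      have e : x + 1 - 1 / (n : ℝ) = x - 1 / n + 1 := by ring
      simp only [e, hS.1 x, trigBasis_periodic j (x - 1 / n)]
    have := sum_design_shift hn0 hper
    simp only [add_sub_cancel_right] at this
    simp only [hD, hd, sub_mul, mul_sub, Finset.sum_sub_distrib]
    rw [this]
  -- On the two coefficients of frequency k, the difference operator is a rotation by the angle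
  -- 2πk/n minus the identity. It scales the squared norm by 4 sin²(πk/n), which Jordan's inequality
  -- sin x ≥ 2x/π bounds below by 16k²/n².
  have hpair : ∀ k : ℕ, 1 ≤ k → 2 * k < n →
      16 * (k : ℝ) ^ 2 / n ^ 2 * (a (2 * k) ^ 2 + a (2 * k + 1) ^ 2)
        ≤ D (2 * k) ^ 2 + D (2 * k + 1) ^ 2 := by
    intro k hk hkn
    set α := 2 * Real.pi * k / n with hα
    have e : ∀ x : ℝ, 2 * Real.pi * k * (x - 1 / n) = 2 * Real.pi * k * x - α := by
      intro x; rw [hα]; ring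
    have h1 : D (2 * k) = (Real.cos α - 1) * a (2 * k) + Real.sin α * a (2 * k + 1) := by
      rw [hshift, ha]
      simp only [Finset.mul_sum]
      rw [← Finset.sum_add_distrib]
      refine Finset.sum_congr rfl fun l _ => ?_
      rw [trigBasis_even hk, trigBasis_even hk, trigBasis_odd hk, e, Real.cos_sub]
      ring
    have h2 : D (2 * k + 1) = (Real.cos α - 1) * a (2 * k + 1) - Real.sin α * a (2 * k) := by
      rw [hshift, ha]
      simp only [Finset.mul_sum]
      rw [← Finset.sum_sub_distrib]
      refine Finset.sum_congr rfl fun l _ => ?_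
      rw [trigBasis_odd hk, trigBasis_even hk, trigBasis_odd hk, e, Real.sin_sub]
      ring
    have h3 : D (2 * k) ^ 2 + D (2 * k + 1) ^ 2
        = 4 * Real.sin (Real.pi * k / n) ^ 2 * (a (2 * k) ^ 2 + a (2 * k + 1) ^ 2) := by
      have e4 : α = 2 * (Real.pi * k / n) := by rw [hα]; ring
      have h4 : Real.cos α = 1 - 2 * Real.sin (Real.pi * k / n) ^ 2 := by
        rw [e4, Real.cos_two_mul, Real.cos_sq']; ring
      have h5 := Real.sin_sq_add_cos_sq α
      rw [h1, h2]
      linear_combination (a (2 * k) ^ 2 + a (2 * k + 1) ^ 2) * (h5 - 2 * h4)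
    rw [h3]
    have h6 : 2 * (k : ℝ) / n ≤ Real.sin (Real.pi * k / n) := by
      have := Real.mul_le_sin (x := Real.pi * k / n) (by positivity) (by
        rw [div_le_div_iff₀ hn' two_pos, mul_assoc]
        have : (k : ℝ) * 2 ≤ n := by exact_mod_cast (by omega : k * 2 ≤ n)
        gcongr)
      refine le_trans (le_of_eq ?_) this
      field_simp
    gcongr
    calc 16 * (k : ℝ) ^ 2 / n ^ 2 = 4 * (2 * (k : ℝ) / n) ^ 2 := by ring
      _ ≤ _ := by gcongr
  obtain ⟨N, rfl⟩ := hn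
  have e1 : ∑ j : Fin (2 * N + 1), 16 * ((((j : ℕ) + 1) / 2 : ℕ) : ℝ) ^ 2
      * empFourier (2 * N + 1) (fun l => S (design (2 * N + 1) l)) j ^ 2
      = _ := sum_fin_two_mul_add_one (fun j => 16 * ((j / 2 : ℕ) : ℝ) ^ 2 * a j ^ 2) N
  have e2 : ∑ j : Fin (2 * N + 1), empFourier (2 * N + 1) d j ^ 2
      = _ := sum_fin_two_mul_add_one (fun j => D j ^ 2) N
  rw [e1]
  rw [e2] at hle
  have h0 : 0 ≤ D 1 ^ 2 := sq_nonneg _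
  have hcomp : ∑ k ∈ Finset.range N, (1 / (((2 * N + 1 : ℕ) : ℝ)) ^ 2) *
      (16 * ((2 * (k + 1) / 2 : ℕ) : ℝ) ^ 2 * a (2 * (k + 1)) ^ 2
        + 16 * (((2 * (k + 1) + 1) / 2 : ℕ) : ℝ) ^ 2 * a (2 * (k + 1) + 1) ^ 2)
      ≤ ∑ k ∈ Finset.range N, (D (2 * (k + 1)) ^ 2 + D (2 * (k + 1) + 1) ^ 2) := by
    refine Finset.sum_le_sum fun k hk => ?_
    have hk' := Finset.mem_range.1 hk
    refine le_trans (le_of_eq ?_) (hpair (k + 1) (by omega) (by omega))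
    rw [show 2 * (k + 1) / 2 = k + 1 by omega, show (2 * (k + 1) + 1) / 2 = k + 1 by omega]
    ring
  rw [← Finset.mul_sum] at hcomp
  have hfin := hcomp.trans ((le_add_of_nonneg_left h0).trans hle)
  rw [div_eq_mul_one_div r, mul_comm r, mul_le_mul_iff_right₀ (by positivity)] at hfin
  simpa using hfin

/-- The tail of the empirical Fourier coefficients of a function in the Sobolev ball. -/
theorem sum_sq_empFourier_tail_le {r : ℝ} {S : ℝ → ℝ} (hS : MemSobolevBall r S) {n : ℕ}
    (hn : Odd n) {m : ℕ} (hm : 1 ≤ m) :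
    ∑ j ∈ Finset.univ.filter (fun j : Fin n => m < (j : ℕ) + 1),
      empFourier n (fun l => S (design n l)) j ^ 2 ≤ r / (4 * m ^ 2) := by
  have hm' : (0 : ℝ) < m := by positivity
  rw [le_div_iff₀ (by positivity), Finset.sum_mul]
  refine le_trans ?_ (sum_sq_freq_mul_empFourier_le hS hn)
  refine le_trans (Finset.sum_le_sum (g := fun j : Fin n => 16 * ((((j : ℕ) + 1) / 2 : ℕ) : ℝ) ^ 2
      * empFourier n (fun l => S (design n l)) j ^ 2) fun j hj => ?_)
    (Finset.sum_le_sum_of_subset_of_nonneg (Finset.filter_subset _ _) fun j _ _ => by positivity)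
  have hj' := (Finset.mem_filter.1 hj).2
  -- Halving with rounding loses at most one, which the strict inequality between m and the index
  -- compensates.
  have h : (m : ℝ) ≤ 2 * ((((j : ℕ) + 1) / 2 : ℕ) : ℝ) := by
    exact_mod_cast (by omega : m ≤ 2 * (((j : ℕ) + 1) / 2))
  rw [mul_comm]
  refine mul_le_mul_of_nonneg_right ?_ (sq_nonneg _)
  calc 4 * (m : ℝ) ^ 2 ≤ 4 * (2 * ((((j : ℕ) + 1) / 2 : ℕ) : ℝ)) ^ 2 := by gcongr
    _ = _ := by ring

/-! ### Moments of linear and quadratic forms in the noise. -/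

section

variable {Ω : Type*} [MeasurableSpace Ω] {μ : Measure Ω}

/-- Nonnegativity of the variance of |Z|; it turns the second-moment bounds below into first-moment
bounds. -/
theorem integral_abs_le_of_integral_sq_le [IsProbabilityMeasure μ] {Z : Ω → ℝ} {B : ℝ}
    (hB : 0 ≤ B) (hZ : MemLp Z 2 μ) (h : ∫ ω, Z ω ^ 2 ∂μ ≤ B ^ 2) : ∫ ω, |Z ω| ∂μ ≤ B := by
  have h1 : Integrable Z μ := hZ.integrable (by norm_num)
  have h2 : Integrable (fun ω => Z ω ^ 2) μ := hZ.integrable_sq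
  set I := ∫ ω, |Z ω| ∂μ with hI
  have h3 : 0 ≤ ∫ ω, (|Z ω| - I) ^ 2 ∂μ := integral_nonneg fun ω => sq_nonneg _
  have e : (fun ω => (|Z ω| - I) ^ 2) = fun ω => (Z ω ^ 2 - 2 * I * |Z ω|) + I ^ 2 := by
    ext ω; rw [sub_sq, sq_abs]; ring
  have h4 : Integrable (fun ω => Z ω ^ 2 - 2 * I * |Z ω|) μ := h2.sub (h1.abs.const_mul _)
  rw [e, integral_add h4 (integrable_const _),
    integral_sub h2 (h1.abs.const_mul _), integral_const_mul, integral_const] at h3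
  simp only [probReal_univ, one_smul, ← hI] at h3
  exact abs_le_of_sq_le_sq' (by nlinarith) hB |>.2

/-- The second moment of a linear combination of orthogonal variables. -/
theorem integral_sq_sum_mul {n : ℕ} {z : Fin n → Ω → ℝ} {c : ℝ} (hz : ∀ l, MemLp (z l) 2 μ)
    (hc : ∀ l k, ∫ ω, z l ω * z k ω ∂μ = if l = k then c else 0) (a : Fin n → ℝ) :
    ∫ ω, (∑ l, a l * z l ω) ^ 2 ∂μ = c * ∑ l, a l ^ 2 := by
  have e : (fun ω => (∑ l, a l * z l ω) ^ 2)
      = fun ω => ∑ l, ∑ k, a l * a k * (z l ω * z k ω) := by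
    ext ω
    rw [sq, Finset.sum_mul_sum]
    refine Finset.sum_congr rfl fun i _ => Finset.sum_congr rfl fun j _ => by ring
  have hi : ∀ l k, Integrable (fun ω => a l * a k * (z l ω * z k ω)) μ := fun l k =>
    ((hz l).integrable_mul (hz k)).const_mul _
  rw [e, integral_finsetSum _ fun l _ => integrable_finsetSum _ fun k _ => hi l k]
  simp_rw [integral_finsetSum _ fun k _ => hi _ k, integral_const_mul, hc]
  simp [Finset.mul_sum, sq, mul_comm]

/-- I.i.d. centred noise with unit variance and fourth moment `ξs`. -/
structure StdNoise (μ : Measure Ω) {n : ℕ} (ξ : Fin n → Ω → ℝ) (ξs : ℝ) : Prop where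
  measurable : ∀ l, Measurable (ξ l)
  indep : iIndepFun ξ μ
  mean : ∀ l, ∫ ω, ξ l ω ∂μ = 0
  second_moment : ∀ l, ∫ ω, ξ l ω ^ 2 ∂μ = 1
  integrable_fourth : ∀ l, Integrable (fun ω => ξ l ω ^ 4) μ
  fourth_moment : ∀ l, ∫ ω, ξ l ω ^ 4 ∂μ = ξs

namespace StdNoise

variable {n : ℕ} {ξ : Fin n → Ω → ℝ} {ξs : ℝ}

theorem integrable_mul_four (h : StdNoise μ ξ ξs) (a b c d : Fin n) :
    Integrable (fun ω => ξ a ω * ξ b ω * (ξ c ω * ξ d ω)) μ := by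
  have hm := h.measurable
  refine ((((h.integrable_fourth a).add (h.integrable_fourth b)).add
    (h.integrable_fourth c)).add (h.integrable_fourth d)).mono' (by fun_prop) ?_
  refine Eventually.of_forall fun ω => ?_
  simp only [Pi.add_apply, Real.norm_eq_abs]
  rw [abs_le]
  constructor <;>
  nlinarith [sq_nonneg (ξ a ω * ξ b ω + ξ c ω * ξ d ω), sq_nonneg (ξ a ω * ξ b ω - ξ c ω * ξ d ω),
    sq_nonneg (ξ a ω ^ 2 - ξ b ω ^ 2), sq_nonneg (ξ c ω ^ 2 - ξ d ω ^ 2),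
    sq_nonneg (ξ a ω ^ 2), sq_nonneg (ξ b ω ^ 2), sq_nonneg (ξ c ω ^ 2), sq_nonneg (ξ d ω ^ 2)]

theorem memLp_sq [IsProbabilityMeasure μ] (h : StdNoise μ ξ ξs) (l : Fin n) :
    MemLp (fun ω => ξ l ω ^ 2) 2 μ := by
  have hm := h.measurable
  rw [memLp_two_iff_integrable_sq (by fun_prop)]
  have := h.integrable_fourth l
  simpa only [← pow_mul] using this

theorem memLp [IsProbabilityMeasure μ] (h : StdNoise μ ξ ξs) (l : Fin n) : MemLp (ξ l) 2 μ := by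
  have hm := h.measurable
  rw [memLp_two_iff_integrable_sq (by fun_prop)]
  exact (h.memLp_sq l).integrable (by norm_num)

theorem memLp_mul [IsProbabilityMeasure μ] (h : StdNoise μ ξ ξs) (l k : Fin n) :
    MemLp (fun ω => ξ l ω * ξ k ω) 2 μ := by
  have hm := h.measurable
  rw [memLp_two_iff_integrable_sq (by fun_prop)]
  simpa only [sq] using h.integrable_mul_four l k l k

theorem integral_mul [IsProbabilityMeasure μ] (h : StdNoise μ ξ ξs) (l k : Fin n) :
    ∫ ω, ξ l ω * ξ k ω ∂μ = if l = k then 1 else 0 := by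
  have hm := h.measurable
  split_ifs with hlk
  · subst hlk
    simpa only [sq] using h.second_moment l
  · rw [(h.indep.indepFun hlk).integral_fun_mul_eq_mul_integral (hm l).aestronglyMeasurable
      (hm k).aestronglyMeasurable, h.mean, zero_mul]

theorem integral_sq_sub_one_mul [IsProbabilityMeasure μ] (h : StdNoise μ ξ ξs) (l k : Fin n) :
    ∫ ω, (ξ l ω ^ 2 - 1) * (ξ k ω ^ 2 - 1) ∂μ = if l = k then ξs - 1 else 0 := by
  have hm := h.measurable
  have hi : ∀ l, Integrable (fun ω => ξ l ω ^ 2) μ := fun l =>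
    (h.memLp_sq l).integrable (by norm_num)
  split_ifs with hlk
  · subst hlk
    have e : (fun ω => (ξ l ω ^ 2 - 1) * (ξ l ω ^ 2 - 1))
        = fun ω => (ξ l ω ^ 4 - 2 * ξ l ω ^ 2) + 1 := by ext ω; ring
    have h4 : Integrable (fun ω => ξ l ω ^ 4 - 2 * ξ l ω ^ 2) μ :=
      (h.integrable_fourth l).sub ((hi l).const_mul _)
    rw [e, integral_add h4 (integrable_const _),
      integral_sub (h.integrable_fourth l) ((hi l).const_mul _), integral_const_mul,
      h.fourth_moment, h.second_moment]
    simp; ring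
  · have hind := (h.indep.indepFun hlk).comp (φ := fun x : ℝ => x ^ 2 - 1)
      (ψ := fun x : ℝ => x ^ 2 - 1) (by fun_prop) (by fun_prop)
    have := hind.integral_fun_mul_eq_mul_integral (by fun_prop) (by fun_prop)
    simp only [Function.comp] at this
    rw [this, integral_sub (hi l) (integrable_const _), h.second_moment]
    simp

theorem one_le_fourth_moment [IsProbabilityMeasure μ] (h : StdNoise μ ξ ξs) (l : Fin n) :
    1 ≤ ξs := by
  have h1 := h.integral_sq_sub_one_mul l l
  rw [if_pos rfl] at h1
  have : 0 ≤ ∫ ω, (ξ l ω ^ 2 - 1) * (ξ l ω ^ 2 - 1) ∂μ :=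
    integral_nonneg fun ω => mul_self_nonneg _
  linarith

/-- A product of four noise variables is centred if one index occurs only once. -/
theorem integral_mul_four_eq_zero [IsProbabilityMeasure μ] (h : StdNoise μ ξ ξs) {a b c d : Fin n}
    (hb : a ≠ b) (hc : a ≠ c) (hd : a ≠ d) :
    ∫ ω, ξ a ω * ξ b ω * (ξ c ω * ξ d ω) ∂μ = 0 := by
  have hm := h.measurable
  have hdisj : Disjoint ({a} : Finset (Fin n)) {b, c, d} := by
    simp [hb, hc, hd]
  have hind := h.indep.indepFun_finset {a} {b, c, d} hdisj hm
  have hφ : Measurable fun x : ({a} : Finset (Fin n)) → ℝ => x ⟨a, by simp⟩ :=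
    measurable_pi_apply _
  have hψ : Measurable fun x : ({b, c, d} : Finset (Fin n)) → ℝ =>
      x ⟨b, by simp⟩ * (x ⟨c, by simp⟩ * x ⟨d, by simp⟩) :=
    Measurable.fun_mul (measurable_pi_apply _)
      (Measurable.fun_mul (measurable_pi_apply _) (measurable_pi_apply _))
  have hcomp := hind.comp hφ hψ
  have := hcomp.integral_fun_mul_eq_mul_integral
    (by simp only [Function.comp_def]; fun_prop) (by simp only [Function.comp_def]; fun_prop)
  simp only [Function.comp] at this
  simp only [mul_assoc]
  rw [this, h.mean, zero_mul]

/-- Since a ≠ b and c ≠ d, only the two matchings of {a, b} with {c, d} leave no index isolated. The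
fourth moment never appears. -/
theorem integral_mul_four [IsProbabilityMeasure μ] (h : StdNoise μ ξ ξs) {a b c d : Fin n}
    (hab : a ≠ b) (hcd : c ≠ d) :
    ∫ ω, ξ a ω * ξ b ω * (ξ c ω * ξ d ω) ∂μ
      = (if a = c ∧ b = d then 1 else 0) + if a = d ∧ b = c then 1 else 0 := by
  have hm := h.measurable
  have hsq : ∫ ω, ξ a ω * ξ b ω * (ξ a ω * ξ b ω) ∂μ = 1 := by
    have hind := (h.indep.indepFun hab).comp (φ := fun x : ℝ => x ^ 2)
      (ψ := fun x : ℝ => x ^ 2) (by fun_prop) (by fun_prop)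
    have := hind.integral_fun_mul_eq_mul_integral (by fun_prop) (by fun_prop)
    simp only [Function.comp] at this
    rw [h.second_moment, h.second_moment, mul_one] at this
    rw [← this]
    congr 1; ext ω; ring
  by_cases hac : a = c
  · subst hac
    by_cases hbd : b = d
    · subst hbd
      simp [hsq, hab]
    · have := h.integral_mul_four_eq_zero (a := b) (b := a) (c := a) (d := d) hab.symm hab.symm hbd
      simp only [mul_comm (ξ b _) (ξ a _)] at this
      rw [this]; simp [hbd, hab.symm]
  · by_cases had : a = d
    · subst had
      by_cases hbc : b = c
      · subst hbc
        simp only [mul_comm (ξ b _) (ξ a _), hsq]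
        simp [hab]
      · have := h.integral_mul_four_eq_zero (a := b) (b := a) (c := c) (d := a) hab.symm hbc
          hab.symm
        simp only [mul_comm (ξ b _) (ξ a _)] at this
        rw [this]; simp [hac, hbc]
    · rw [h.integral_mul_four_eq_zero hab hac had]; simp [hac, had]

theorem integral_sq_linear [IsProbabilityMeasure μ] (h : StdNoise μ ξ ξs) (a : Fin n → ℝ) :
    ∫ ω, (∑ l, a l * ξ l ω) ^ 2 ∂μ = ∑ l, a l ^ 2 := by
  simpa using integral_sq_sum_mul h.memLp h.integral_mul a

theorem integral_linear [IsProbabilityMeasure μ] (h : StdNoise μ ξ ξs) (a : Fin n → ℝ) :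
    ∫ ω, ∑ l, a l * ξ l ω ∂μ = 0 := by
  rw [integral_finsetSum _ fun l _ => ((h.memLp l).integrable (by norm_num)).const_mul _]
  simp [integral_const_mul, h.mean]

theorem memLp_linear [IsProbabilityMeasure μ] (h : StdNoise μ ξ ξs) (a : Fin n → ℝ) :
    MemLp (fun ω => ∑ l, a l * ξ l ω) 2 μ :=
  memLp_finsetSum _ fun l _ => (h.memLp l).const_mul (a l)

theorem memLp_centredSq [IsProbabilityMeasure μ] (h : StdNoise μ ξ ξs) (a : Fin n → ℝ) :
    MemLp (fun ω => ∑ l, a l * (ξ l ω ^ 2 - 1)) 2 μ :=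
  memLp_finsetSum _ fun l _ => ((h.memLp_sq l).sub (memLp_const 1)).const_mul (a l)

theorem integral_sq_centredSq [IsProbabilityMeasure μ] (h : StdNoise μ ξ ξs) (a : Fin n → ℝ) :
    ∫ ω, (∑ l, a l * (ξ l ω ^ 2 - 1)) ^ 2 ∂μ = (ξs - 1) * ∑ l, a l ^ 2 :=
  integral_sq_sum_mul (fun l => (h.memLp_sq l).sub (memLp_const 1)) h.integral_sq_sub_one_mul a

/-- The off-diagonal part of a quadratic form. -/
theorem memLp_offDiag [IsProbabilityMeasure μ] (h : StdNoise μ ξ ξs) (a : Fin n → Fin n → ℝ) :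
    MemLp (fun ω => ∑ p ∈ (Finset.univ : Finset (Fin n)).offDiag,
      a p.1 p.2 * (ξ p.1 ω * ξ p.2 ω)) 2 μ :=
  memLp_finsetSum _ fun p _ => (h.memLp_mul p.1 p.2).const_mul _

/-- The product at a pair (l, k) correlates only with itself and with its swap. By symmetry of the
coefficients both contribute equally, whence the 2; the diagonal is then added back for free. -/
theorem integral_sq_offDiag_le [IsProbabilityMeasure μ] (h : StdNoise μ ξ ξs)
    {a : Fin n → Fin n → ℝ} (ha : ∀ l k, a l k = a k l) :
    ∫ ω, (∑ p ∈ (Finset.univ : Finset (Fin n)).offDiag, a p.1 p.2 * (ξ p.1 ω * ξ p.2 ω)) ^ 2 ∂μ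
      ≤ 2 * ∑ l, ∑ k, a l k ^ 2 := by
  set T := (Finset.univ : Finset (Fin n)).offDiag
  have e : (fun ω => (∑ p ∈ T, a p.1 p.2 * (ξ p.1 ω * ξ p.2 ω)) ^ 2)
      = fun ω => ∑ p ∈ T, ∑ q ∈ T, a p.1 p.2 * a q.1 q.2 *
        (ξ p.1 ω * ξ p.2 ω * (ξ q.1 ω * ξ q.2 ω)) := by
    ext ω
    rw [sq, Finset.sum_mul_sum]
    refine Finset.sum_congr rfl fun i _ => Finset.sum_congr rfl fun j _ => by ring
  have hi : ∀ p q : Fin n × Fin n, Integrable (fun ω => a p.1 p.2 * a q.1 q.2 *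
        (ξ p.1 ω * ξ p.2 ω * (ξ q.1 ω * ξ q.2 ω))) μ := fun p q =>
    (h.integrable_mul_four _ _ _ _).const_mul _
  rw [e, integral_finsetSum _ fun p _ => integrable_finsetSum _ fun q _ => hi p q]
  have h1 : ∀ p ∈ T, ∫ ω, ∑ q ∈ T, a p.1 p.2 * a q.1 q.2 *
        (ξ p.1 ω * ξ p.2 ω * (ξ q.1 ω * ξ q.2 ω)) ∂μ = 2 * a p.1 p.2 ^ 2 := by
    intro p hp
    rw [integral_finsetSum _ fun q _ => hi p q]
    have hp' : p.1 ≠ p.2 := by simpa [T] using hp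
    have h2 : ∀ q ∈ T, ∫ ω, a p.1 p.2 * a q.1 q.2 *
        (ξ p.1 ω * ξ p.2 ω * (ξ q.1 ω * ξ q.2 ω)) ∂μ
        = (if q = p then a p.1 p.2 * a q.1 q.2 else 0)
          + if q = p.swap then a p.1 p.2 * a q.1 q.2 else 0 := by
      intro q hq
      have hq' : q.1 ≠ q.2 := by simpa [T] using hq
      rw [integral_const_mul, h.integral_mul_four hp' hq', mul_add]
      congr 1
      · simp only [Prod.ext_iff, eq_comm (a := p.1), eq_comm (a := p.2), mul_ite, mul_one, mul_zero]
      · simp only [Prod.ext_iff, Prod.fst_swap, Prod.snd_swap, eq_comm (a := p.1),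
          eq_comm (a := p.2), mul_ite, mul_one, mul_zero, and_comm]
    have hps : p.swap ∈ T := by simpa [T] using hp'.symm
    rw [Finset.sum_congr rfl h2, Finset.sum_add_distrib, Finset.sum_ite_eq', Finset.sum_ite_eq',
      if_pos hp, if_pos hps, Prod.fst_swap, Prod.snd_swap, ha p.2 p.1]
    ring
  rw [Finset.sum_congr rfl h1, ← Finset.mul_sum]
  have h3 : ∑ p ∈ T, a p.1 p.2 ^ 2 ≤ ∑ l, ∑ k, a l k ^ 2 := by
    rw [← Finset.sum_product' (f := fun l k => a l k ^ 2), Finset.univ_product_univ]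
    exact Finset.sum_le_sum_of_subset_of_nonneg (Finset.subset_univ _) fun p _ _ => sq_nonneg _
  linarith

end StdNoise

end

/-! ### Cancellation in weighted sums of φ_j² - 1. -/

theorem trigBasisBar_one (x : ℝ) : trigBasisBar 1 x = 0 := by simp [trigBasisBar, trigBasis_one]

theorem trigBasisBar_add_succ {k : ℕ} (hk : 1 ≤ k) (x : ℝ) :
    trigBasisBar (2 * k + 1) x = - trigBasisBar (2 * k) x := by
  unfold trigBasisBar
  rw [trigBasis_even hk, trigBasis_odd hk, mul_pow, mul_pow, Real.sq_sqrt (by norm_num)]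
  linarith [Real.sin_sq_add_cos_sq (2 * Real.pi * k * x)]

/-- Within a cosine–sine pair only the drop of the weights survives, times a factor at most 1 in
modulus, and the drops telescope. Keeping the last weight in the bound leaves room for one unpaired
term. -/
theorem abs_sum_antitone_mul_trigBasisBar_odd {a : ℕ → ℝ} (ha : Antitone a) (x : ℝ) (N : ℕ) :
    |∑ j ∈ Finset.range (2 * N + 1), a j * trigBasisBar (j + 1) x| ≤ a 0 - a (2 * N) := by
  induction N with
  | zero => simp [trigBasisBar_one]
  | succ N ih =>
    rw [show 2 * (N + 1) + 1 = 2 * N + 1 + 1 + 1 by ring, Finset.sum_range_succ,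
      Finset.sum_range_succ, show 2 * N + 1 + 1 = 2 * (N + 1) by ring,
      trigBasisBar_add_succ (by omega)]
    have h1 := abs_trigBasisBar_le (2 * (N + 1)) x
    have h2 : a (2 * (N + 1)) ≤ a (2 * N + 1) := ha (by omega)
    have h3 : a (2 * N + 1) ≤ a (2 * N) := ha (by omega)
    set t := trigBasisBar (2 * (N + 1)) x
    rw [abs_le] at ih h1 ⊢
    constructor <;> nlinarith

/-- Sums of `φ_j² - 1` against a nonincreasing nonnegative weight are bounded by the first
weight, since consecutive cosine and sine terms cancel. -/
theorem abs_sum_antitone_mul_trigBasisBar {a : ℕ → ℝ} (ha : Antitone a) (h0 : ∀ j, 0 ≤ a j)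
    (x : ℝ) (n : ℕ) : |∑ j ∈ Finset.range n, a j * trigBasisBar (j + 1) x| ≤ a 0 := by
  rcases Nat.even_or_odd' n with ⟨N, rfl | rfl⟩
  · rcases N with _ | N
    · simpa using h0 0
    · have ih := abs_sum_antitone_mul_trigBasisBar_odd ha x N
      rw [show 2 * (N + 1) = 2 * N + 1 + 1 by ring, Finset.sum_range_succ]
      have h1 := abs_trigBasisBar_le (2 * N + 1 + 1) x
      have h3 : a (2 * N + 1) ≤ a (2 * N) := ha (by omega)
      have h4 := h0 (2 * N + 1)
      set t := trigBasisBar (2 * N + 1 + 1) x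
      rw [abs_le] at ih h1 ⊢
      constructor <;> nlinarith
  · exact (abs_sum_antitone_mul_trigBasisBar_odd ha x N).trans (by linarith [h0 (2 * N)])

/-! ### The pointwise oracle inequality. -/

noncomputable section

/-- Discrete Fourier coefficients of the noise `s_l x_l`. -/
def noiseCoef (n : ℕ) (s x : Fin n → ℝ) : Fin n → ℝ := empFourier n fun l => s l * x l

/-- The mean squared volatility. -/
def meanVol (n : ℕ) (s : Fin n → ℝ) : ℝ := (1 / (n : ℝ)) * ∑ l, s l ^ 2

/-- The squared error of the weighted coefficients. -/
def coefLoss {n : ℕ} (θ e lam : Fin n → ℝ) : ℝ := ∑ j, (lam j * (θ j + e j) - θ j) ^ 2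

/-- The normalized square of the inner product of the weighted signal and the noise. -/
def signalRatio {n : ℕ} (θ e y : Fin n → ℝ) : ℝ :=
  (∑ j, y j * θ j * e j) ^ 2 / ∑ j, (y j * θ j) ^ 2

/-- Up to the factor s_l s_k / n², the matrix of ∑ λ(j) e_j² as a quadratic form in the noise. -/
def kernel (n : ℕ) (lam : Fin n → ℝ) (l k : Fin n) : ℝ :=
  ∑ j, lam j * (basisValue n j l * basisValue n j k)

/-- The mean of ∑ λ(j)(e_j² - v), v = `meanVol n s / n`, for fixed volatilities and standard noise.
For odd n it vanishes when all s_l² are equal. -/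
def volBias (n : ℕ) (lam s : Fin n → ℝ) : ℝ :=
  (1 / (n : ℝ) ^ 2) * ∑ l, s l ^ 2 * ∑ j, lam j * (basisValue n j l ^ 2 - 1)

def diagPart (n : ℕ) (lam s x : Fin n → ℝ) : ℝ :=
  ∑ l, ((1 / (n : ℝ) ^ 2) * s l ^ 2 * kernel n lam l l) * (x l ^ 2 - 1)

def offDiagPart (n : ℕ) (lam s x : Fin n → ℝ) : ℝ :=
  ∑ p ∈ (Finset.univ : Finset (Fin n)).offDiag,
    ((1 / (n : ℝ) ^ 2) * (s p.1 * s p.2) * kernel n lam p.1 p.2) * (x p.1 * x p.2)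

/-- The normalized square of the off-diagonal part. -/
def offDiagRatio (n : ℕ) (lam s x : Fin n → ℝ) : ℝ :=
  offDiagPart n lam s x ^ 2 / ((∑ j, lam j ^ 2) * (meanVol n s / n))

/-- Expand the quadratic form and separate the diagonal; there x_l² = (x_l² - 1) + 1, and the
constant 1 minus the centring produces the bias. -/
theorem sum_mul_sq_noiseCoef {n : ℕ} (lam s x : Fin n → ℝ) :
    ∑ j, lam j * (noiseCoef n s x j ^ 2 - meanVol n s / n)
      = volBias n lam s + diagPart n lam s x + offDiagPart n lam s x := by
  have h1 : ∀ j, lam j * noiseCoef n s x j ^ 2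
      = ∑ l, ∑ k, (1 / (n : ℝ) ^ 2) * (s l * s k) *
        (lam j * (basisValue n j l * basisValue n j k)) * (x l * x k) := by
    intro j
    rw [noiseCoef, empFourier_eq, mul_pow, sq (∑ l, _), Finset.sum_mul_sum, Finset.mul_sum,
      Finset.mul_sum]
    refine Finset.sum_congr rfl fun l _ => ?_
    rw [Finset.mul_sum, Finset.mul_sum]
    refine Finset.sum_congr rfl fun k _ => ?_
    ring
  have h2 : ∑ j, lam j * noiseCoef n s x j ^ 2
      = ∑ l, ∑ k, ((1 / (n : ℝ) ^ 2) * (s l * s k) * kernel n lam l k) * (x l * x k) := by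
    simp only [h1, kernel, Finset.mul_sum, Finset.sum_mul]
    rw [Finset.sum_comm]
    exact Finset.sum_congr rfl fun l _ => Finset.sum_comm
  have h3 : ∑ l, ∑ k, ((1 / (n : ℝ) ^ 2) * (s l * s k) * kernel n lam l k) * (x l * x k)
      = ∑ l, ((1 / (n : ℝ) ^ 2) * (s l * s l) * kernel n lam l l) * (x l * x l)
        + offDiagPart n lam s x := by
    rw [← Finset.sum_product' (f := fun l k =>
      ((1 / (n : ℝ) ^ 2) * (s l * s k) * kernel n lam l k) * (x l * x k)),
      ← Finset.diag_union_offDiag, Finset.sum_union (Finset.disjoint_diag_offDiag _),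
      Finset.sum_diag]
    rfl
  have h4 : ∑ l, ((1 / (n : ℝ) ^ 2) * (s l * s l) * kernel n lam l l) * (x l * x l)
      = diagPart n lam s x + (1 / (n : ℝ) ^ 2) * ∑ l, s l ^ 2 * kernel n lam l l := by
    rw [diagPart, Finset.mul_sum, ← Finset.sum_add_distrib]
    exact Finset.sum_congr rfl fun l _ => by ring
  have h5 : volBias n lam s = (1 / (n : ℝ) ^ 2) * (∑ l, s l ^ 2 * kernel n lam l l)
      - ∑ j, lam j * (meanVol n s / n) := by
    have : ∀ l, ∑ j, lam j * (basisValue n j l ^ 2 - 1) = kernel n lam l l - ∑ j, lam j := by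
      intro l
      rw [kernel, ← Finset.sum_sub_distrib]
      exact Finset.sum_congr rfl fun j _ => by ring
    simp only [volBias, this]
    simp only [mul_sub, Finset.sum_sub_distrib, ← Finset.sum_mul, meanVol]
    ring
  simp only [mul_sub, Finset.sum_sub_distrib]
  rw [h2, h3, h4, h5]
  ring

theorem abs_volBias_le {n : ℕ} {lam s : Fin n → ℝ} {v R : ℝ} (hs : ∀ l, s l ^ 2 ≤ v)
    (hR : ∀ l, |∑ j, lam j * (basisValue n j l ^ 2 - 1)| ≤ R) :
    |volBias n lam s| ≤ R * v / n := by
  rcases Nat.eq_zero_or_pos n with rfl | hn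
  · simp [volBias]
  have hn' : (0 : ℝ) < n := by positivity
  rw [volBias, abs_mul, abs_of_nonneg (by positivity)]
  have : |∑ l, s l ^ 2 * ∑ j, lam j * (basisValue n j l ^ 2 - 1)| ≤ ∑ _l : Fin n, v * R := by
    refine (Finset.abs_sum_le_sum_abs _ _).trans (Finset.sum_le_sum fun l _ => ?_)
    rw [abs_mul, abs_of_nonneg (sq_nonneg _)]
    exact mul_le_mul (hs l) (hR l) (abs_nonneg _) ((sq_nonneg _).trans (hs l))
  simp only [Finset.sum_const, Finset.card_univ, Fintype.card_fin, nsmul_eq_mul] at this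
  calc _ ≤ 1 / (n : ℝ) ^ 2 * (n * (v * R)) := by gcongr
    _ = _ := by field_simp

theorem meanVol_nonneg {n : ℕ} (s : Fin n → ℝ) : 0 ≤ meanVol n s := by
  unfold meanVol; positivity

theorem meanVol_le {n : ℕ} (hn : 0 < n) {s : Fin n → ℝ} {v : ℝ} (hs : ∀ l, s l ^ 2 ≤ v) :
    meanVol n s ≤ v := by
  have hn' : (0 : ℝ) < n := by positivity
  have : ∑ l, s l ^ 2 ≤ ∑ _l : Fin n, v := Finset.sum_le_sum fun l _ => hs l
  simp only [Finset.sum_const, Finset.card_univ, Fintype.card_fin, nsmul_eq_mul] at this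
  rw [meanVol, one_div_mul_eq_div, div_le_iff₀ hn']
  linarith

/-- Young's inequality in normalized form. The second hypothesis makes it survive the convention a²
/ 0 = 0. -/
theorem two_mul_le_add_div {a B t : ℝ} (hB : 0 ≤ B) (h : B = 0 → a = 0) (ht : 0 < t) :
    2 * a ≤ t * B + a ^ 2 / B / t := by
  rcases hB.eq_or_lt with hB' | hB'
  · rw [h hB'.symm, ← hB']; simp
  · have : t * B + a ^ 2 / B / t - 2 * a = (a - t * B) ^ 2 / (t * B) := by
      field_simp; ring
    have h2 : 0 ≤ (a - t * B) ^ 2 / (t * B) := by positivity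
    linarith

theorem two_mul_sum_signal_le {n : ℕ} (θ e y : Fin n → ℝ) {t : ℝ} (ht : 0 < t) :
    2 * ∑ j, y j * θ j * e j ≤ t * ∑ j, (y j * θ j) ^ 2 + signalRatio θ e y / t := by
  refine two_mul_le_add_div (Finset.sum_nonneg fun j _ => sq_nonneg _) (fun h => ?_) ht
  rw [Finset.sum_eq_zero_iff_of_nonneg fun j _ => sq_nonneg _] at h
  refine Finset.sum_eq_zero fun j hj => ?_
  rw [pow_eq_zero_iff two_ne_zero |>.1 (h j hj), zero_mul]

theorem signalRatio_neg {n : ℕ} (θ e y : Fin n → ℝ) :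
    signalRatio θ e (fun j => - y j) = signalRatio θ e y := by
  simp only [signalRatio, neg_mul, Finset.sum_neg_distrib, neg_sq]

/-- The degenerate case of the normalization: either all weights or all volatilities vanish. -/
theorem offDiagPart_eq_zero {n : ℕ} (hn : 0 < n) {lam s : Fin n → ℝ} (x : Fin n → ℝ)
    (h : (∑ j, lam j ^ 2) * (meanVol n s / n) = 0) : offDiagPart n lam s x = 0 := by
  have hn' : (0 : ℝ) < n := by positivity
  refine Finset.sum_eq_zero fun p _ => ?_
  rcases mul_eq_zero.1 h with h | h
  · rw [Finset.sum_eq_zero_iff_of_nonneg fun j _ => sq_nonneg _] at h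
    have : kernel n lam p.1 p.2 = 0 := Finset.sum_eq_zero fun j hj => by
      rw [pow_eq_zero_iff two_ne_zero |>.1 (h j hj), zero_mul]
    rw [this]; ring
  · have h' : ∑ l, s l ^ 2 = 0 := by
      rw [meanVol] at h
      field_simp at h
      simpa using h
    rw [Finset.sum_eq_zero_iff_of_nonneg fun j _ => sq_nonneg _] at h'
    rw [pow_eq_zero_iff two_ne_zero |>.1 (h' p.1 (Finset.mem_univ _))]; ring

theorem two_mul_abs_offDiagPart_le {n : ℕ} (hn : 0 < n) (lam s x : Fin n → ℝ) {t : ℝ}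
    (ht : 0 < t) : 2 * |offDiagPart n lam s x|
      ≤ t * ((∑ j, lam j ^ 2) * (meanVol n s / n)) + offDiagRatio n lam s x / t := by
  have := two_mul_le_add_div (a := |offDiagPart n lam s x|)
    (B := (∑ j, lam j ^ 2) * (meanVol n s / n))
    (mul_nonneg (Finset.sum_nonneg fun j _ => sq_nonneg _)
      (div_nonneg (meanVol_nonneg s) (Nat.cast_nonneg n)))
    (fun h => by rw [offDiagPart_eq_zero hn x h, abs_zero]) ht
  rwa [sq_abs] at this

/-- The penalized cost in terms of the coefficients and of `c = ς̂ / n`. -/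
def coefCost {n : ℕ} (ρ c : ℝ) (θ e lam : Fin n → ℝ) : ℝ :=
  ∑ j, lam j ^ 2 * (θ j + e j) ^ 2 - 2 * ∑ j, lam j * ((θ j + e j) ^ 2 - c)
    + ρ * c * ∑ j, lam j ^ 2

/-- A termwise identity for arbitrary c and v. The signal energy ∑ θ² does not depend on the
weights, so it disappears when two weight vectors are compared. -/
theorem coefLoss_eq {n : ℕ} (ρ c v : ℝ) (θ e lam : Fin n → ℝ) :
    coefLoss θ e lam = coefCost ρ c θ e lam + 2 * ∑ j, lam j * θ j * e j
      + 2 * ∑ j, lam j * (e j ^ 2 - v) + 2 * (v - c) * ∑ j, lam j + ∑ j, θ j ^ 2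
      - ρ * c * ∑ j, lam j ^ 2 := by
  unfold coefLoss coefCost
  simp only [Finset.mul_sum, ← Finset.sum_add_distrib, ← Finset.sum_sub_distrib]
  exact Finset.sum_congr rfl fun j _ => by ring

/-- The two estimators differ by (λ - λ₀)(θ + e), whose squared norm is at most twice the sum of the
losses. Expanding it and dropping the e² term leaves a cross term, handled by Young's inequality
with (λ - λ₀)⁴ ≤ (λ - λ₀)². -/
theorem sum_sq_signal_sub_le {n : ℕ} {ρ : ℝ} (h0 : 0 < ρ) {θ e lam lam₀ : Fin n → ℝ}
    (hl : ∀ j, lam j ∈ Set.Icc (0 : ℝ) 1) (hl₀ : ∀ j, lam₀ j ∈ Set.Icc (0 : ℝ) 1) :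
    (1 - ρ) * ∑ j, ((lam j - lam₀ j) * θ j) ^ 2
      ≤ 2 * coefLoss θ e lam + 2 * coefLoss θ e lam₀
        + signalRatio θ e (fun j => (lam j - lam₀ j) ^ 2) / ρ := by
  have hy := two_mul_sum_signal_le θ e (fun j => - (lam j - lam₀ j) ^ 2) h0
  rw [signalRatio_neg] at hy
  have h2 : ∑ j, (-(lam j - lam₀ j) ^ 2 * θ j) ^ 2 ≤ ∑ j, ((lam j - lam₀ j) * θ j) ^ 2 := by
    refine Finset.sum_le_sum fun j _ => ?_
    have : (lam j - lam₀ j) ^ 2 ≤ 1 := by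
      have := hl j; have := hl₀ j
      rw [sq_le_one_iff_abs_le_one, abs_le]
      constructor <;> linarith [(hl j).1, (hl j).2, (hl₀ j).1, (hl₀ j).2]
    calc (-(lam j - lam₀ j) ^ 2 * θ j) ^ 2
        = (lam j - lam₀ j) ^ 2 * ((lam j - lam₀ j) * θ j) ^ 2 := by ring
      _ ≤ 1 * ((lam j - lam₀ j) * θ j) ^ 2 := by gcongr
      _ = _ := one_mul _
  have h3 : ∑ j, ((lam j - lam₀ j) * θ j) ^ 2
      ≤ 2 * coefLoss θ e lam + 2 * coefLoss θ e lam₀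
        + 2 * ∑ j, -(lam j - lam₀ j) ^ 2 * θ j * e j := by
    unfold coefLoss
    simp only [Finset.mul_sum, ← Finset.sum_add_distrib]
    refine Finset.sum_le_sum fun j _ => ?_
    nlinarith [sq_nonneg (lam j * (θ j + e j) - θ j + (lam₀ j * (θ j + e j) - θ j)),
      sq_nonneg ((lam j - lam₀ j) * e j)]
  have h4 := mul_le_mul_of_nonneg_left h2 h0.le
  linarith

/-- The pointwise oracle inequality for a weight vector `lam` whose penalized cost does not exceed
that of `lam₀`. -/
theorem coefLoss_oracle {n : ℕ} (hn : 0 < n) {ρ : ℝ} (h0 : 0 < ρ) (h3 : ρ < 1 / 3)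
    {θ s x lam lam₀ : Fin n → ℝ} {c b R : ℝ}
    (hl : ∀ j, lam j ∈ Set.Icc (0 : ℝ) 1) (hl₀ : ∀ j, lam₀ j ∈ Set.Icc (0 : ℝ) 1)
    (hcost : coefCost ρ c θ (noiseCoef n s x) lam ≤ coefCost ρ c θ (noiseCoef n s x) lam₀)
    (hb : |volBias n lam s| ≤ b) (hb₀ : |volBias n lam₀ s| ≤ b)
    (hR : ∑ j, lam j ≤ R) (hR₀ : ∑ j, lam₀ j ≤ R) :
    (1 - 3 * ρ) * coefLoss θ (noiseCoef n s x) lam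
      ≤ (1 + ρ) * coefLoss θ (noiseCoef n s x) lam₀
        + 2 * ρ * (1 - ρ) * ((∑ j, lam₀ j ^ 2) * (meanVol n s / n))
        + (1 - ρ) / ρ * signalRatio θ (noiseCoef n s x) (fun j => lam j - lam₀ j)
        + signalRatio θ (noiseCoef n s x) (fun j => (lam j - lam₀ j) ^ 2)
        + (1 - ρ) * (4 * b + 2 * |diagPart n lam s x| + 2 * |diagPart n lam₀ s x|
          + (offDiagRatio n lam s x + offDiagRatio n lam₀ s x) / ρ
          + (2 + ρ) * R * |meanVol n s / n - c|) := by
  set e := noiseCoef n s x with he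
  set v := meanVol n s / n with hv
  have hA := coefLoss_eq ρ c v θ e lam
  have hA₀ := coefLoss_eq ρ c v θ e lam₀
  rw [sum_mul_sq_noiseCoef] at hA hA₀
  have hM : 2 * (∑ j, lam j * θ j * e j) - 2 * (∑ j, lam₀ j * θ j * e j)
      ≤ ρ * ∑ j, ((lam j - lam₀ j) * θ j) ^ 2
        + signalRatio θ e (fun j => lam j - lam₀ j) / ρ := by
    refine le_trans (le_of_eq ?_) (two_mul_sum_signal_le θ e (fun j => lam j - lam₀ j) h0)
    rw [← mul_sub, ← Finset.sum_sub_distrib]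
    congr 1
    exact Finset.sum_congr rfl fun j _ => by ring
  have hS := sum_sq_signal_sub_le (e := e) (θ := θ) h0 hl hl₀
  have hO := two_mul_abs_offDiagPart_le hn lam s x h0
  have hO₀ := two_mul_abs_offDiagPart_le hn lam₀ s x h0
  rw [← hv] at hO hO₀
  have hsq : ∀ l : Fin n → ℝ, (∀ j, l j ∈ Set.Icc (0 : ℝ) 1) → ∑ j, l j ≤ R →
      0 ≤ ∑ j, l j ∧ 0 ≤ ∑ j, l j ^ 2 ∧ ∑ j, l j ^ 2 ≤ R := by
    intro l hl hR
    refine ⟨Finset.sum_nonneg fun j _ => (hl j).1, Finset.sum_nonneg fun j _ => sq_nonneg _,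
      le_trans (Finset.sum_le_sum fun j _ => ?_) hR⟩
    nlinarith [(hl j).1, (hl j).2]
  obtain ⟨p1, p2, p3⟩ := hsq lam hl hR
  obtain ⟨q1, q2, q3⟩ := hsq lam₀ hl₀ hR₀
  set L := ∑ j, lam j
  set L₀ := ∑ j, lam₀ j
  set K := ∑ j, lam j ^ 2
  set K₀ := ∑ j, lam₀ j ^ 2
  -- The cost of replacing the estimated c by v, both in the linear term and in the penalty.
  have hV : (v - c) * (2 * (L - L₀) + ρ * (K - K₀)) ≤ (2 + ρ) * R * |v - c| := by
    have h5 : |2 * (L - L₀) + ρ * (K - K₀)| ≤ (2 + ρ) * R := by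
      rw [abs_le]
      constructor <;> nlinarith
    calc (v - c) * (2 * (L - L₀) + ρ * (K - K₀))
        ≤ |(v - c) * (2 * (L - L₀) + ρ * (K - K₀))| := le_abs_self _
      _ = |2 * (L - L₀) + ρ * (K - K₀)| * |v - c| := by rw [abs_mul, mul_comm]
      _ ≤ _ := by gcongr
  have hb1 := (abs_le.1 hb).2
  have hb2 := (abs_le.1 hb₀).1
  have hd1 := le_abs_self (diagPart n lam s x)
  have hd2 := neg_abs_le (diagPart n lam₀ s x)
  have ho1 := le_abs_self (offDiagPart n lam s x)
  have ho2 := neg_abs_le (offDiagPart n lam₀ s x)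
  set Z := signalRatio θ e (fun j => lam j - lam₀ j)
  set Z' := signalRatio θ e (fun j => (lam j - lam₀ j) ^ 2)
  set A := ∑ j, ((lam j - lam₀ j) * θ j) ^ 2
  set E := coefLoss θ e lam
  set E₀ := coefLoss θ e lam₀
  -- After this replacement the penalty -ρvK cancels the off-diagonal price ρKv of `lam`. For `lam₀`
  -- the penalty and the off-diagonal price add up, giving 2ρK₀v.
  have main : E ≤ E₀ + ρ * A + Z / ρ + 2 * ρ * (K₀ * v) + (4 * b + 2 * |diagPart n lam s x|
      + 2 * |diagPart n lam₀ s x| + (offDiagRatio n lam s x + offDiagRatio n lam₀ s x) / ρ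
          + (2 + ρ) * R * |v - c|) := by
    rw [add_div]
    linarith
  have h1ρ : 0 < 1 - ρ := by linarith
  -- Multiplying by 1 - ρ allows `hS` to be inserted for ρA; moving 2ρE to the left leaves the
  -- factor 1 - 3ρ.
  have m1 := mul_le_mul_of_nonneg_left main h1ρ.le
  have m2 := mul_le_mul_of_nonneg_left hS h0.le
  have e1 : ρ * (2 * E + 2 * E₀ + Z' / ρ) = 2 * ρ * E + 2 * ρ * E₀ + Z' := by field_simp
  have e2 : (1 - ρ) / ρ * Z = (1 - ρ) * (Z / ρ) := by ring
  rw [e1] at m2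
  rw [e2]
  linarith

end

/-! ### Expectations at fixed volatilities, and the variance estimator. -/

section

/-- A row of the kernel is a trigonometric sum with coefficients λ(j)φ_j(x_l), so Parseval applies,
with φ_j² ≤ 2. -/
theorem sum_sq_kernel_le {n : ℕ} (hn : Odd n) (lam : Fin n → ℝ) (l : Fin n) :
    ∑ k, kernel n lam l k ^ 2 ≤ 2 * n * ∑ j, lam j ^ 2 := by
  have h := sum_sq_trigSum hn fun j => lam j * basisValue n j l
  have e : ∀ k, ∑ j, lam j * basisValue n j l * basisValue n j k = kernel n lam l k := fun k =>
    Finset.sum_congr rfl fun j _ => by ring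
  simp only [e] at h
  rw [h, mul_comm 2 (n : ℝ), mul_assoc]
  refine mul_le_mul_of_nonneg_left ?_ (Nat.cast_nonneg n)
  rw [Finset.mul_sum]
  refine Finset.sum_le_sum fun j _ => ?_
  rw [mul_pow, mul_comm]
  gcongr
  exact basisValue_sq_le n j l

theorem sum_signal_mul_noiseCoef {n : ℕ} (θ s x y : Fin n → ℝ) :
    ∑ j, y j * θ j * noiseCoef n s x j
      = ∑ l, ((1 / (n : ℝ)) * s l * ∑ j, y j * θ j * basisValue n j l) * x l := by
  simp only [noiseCoef, empFourier_eq, Finset.mul_sum, Finset.sum_mul]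
  rw [Finset.sum_comm]
  exact Finset.sum_congr rfl fun l _ => Finset.sum_congr rfl fun j _ => by ring

variable {Ω : Type*} [MeasurableSpace Ω] {μ : Measure Ω} [IsProbabilityMeasure μ]
  {n : ℕ} {ξ : Fin n → Ω → ℝ} {ξs v : ℝ} {s : Fin n → ℝ}

namespace StdNoise

theorem memLp_signal (h : StdNoise μ ξ ξs) (s θ y : Fin n → ℝ) :
    MemLp (fun ω => ∑ j, y j * θ j * noiseCoef n s (fun l => ξ l ω) j) 2 μ := by
  simp only [sum_signal_mul_noiseCoef]
  exact h.memLp_linear _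

theorem integral_sq_signal_le (h : StdNoise μ ξ ξs) (hn : Odd n) (hs : ∀ l, s l ^ 2 ≤ v)
    (θ y : Fin n → ℝ) :
    ∫ ω, (∑ j, y j * θ j * noiseCoef n s (fun l => ξ l ω) j) ^ 2 ∂μ
      ≤ v / n * ∑ j, (y j * θ j) ^ 2 := by
  have hn' : (0 : ℝ) < n := by have := hn.pos; positivity
  simp only [sum_signal_mul_noiseCoef]
  rw [h.integral_sq_linear]
  have h1 := sum_sq_trigSum hn fun j => y j * θ j
  calc ∑ l, ((1 / (n : ℝ)) * s l * ∑ j, y j * θ j * basisValue n j l) ^ 2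
      = ∑ l, s l ^ 2 * ((1 / (n : ℝ)) ^ 2 * (∑ j, y j * θ j * basisValue n j l) ^ 2) :=
        Finset.sum_congr rfl fun l _ => by ring
    _ ≤ ∑ l, v * ((1 / (n : ℝ)) ^ 2 * (∑ j, y j * θ j * basisValue n j l) ^ 2) :=
        Finset.sum_le_sum fun l _ => mul_le_mul_of_nonneg_right (hs l) (by positivity)
    _ = v * ((1 / (n : ℝ)) ^ 2 * ∑ l, (∑ j, y j * θ j * basisValue n j l) ^ 2) := by
        simp only [Finset.mul_sum]
    _ = v / n * ∑ j, (y j * θ j) ^ 2 := by rw [h1]; field_simp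

theorem integrable_signalRatio (h : StdNoise μ ξ ξs) (s θ y : Fin n → ℝ) :
    Integrable (fun ω => signalRatio θ (noiseCoef n s fun l => ξ l ω) y) μ :=
  (h.memLp_signal s θ y).integrable_sq.div_const _

theorem integral_signalRatio_le (h : StdNoise μ ξ ξs) (hn : Odd n) (hs : ∀ l, s l ^ 2 ≤ v)
    (hv : 0 ≤ v) (θ y : Fin n → ℝ) :
    ∫ ω, signalRatio θ (noiseCoef n s fun l => ξ l ω) y ∂μ ≤ v / n := by
  simp only [signalRatio]
  rw [integral_div]
  refine div_le_of_le_mul₀ (Finset.sum_nonneg fun j _ => sq_nonneg _) (by positivity) ?_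
  exact h.integral_sq_signal_le hn hs θ y

theorem memLp_diagPart (h : StdNoise μ ξ ξs) (lam s : Fin n → ℝ) :
    MemLp (fun ω => diagPart n lam s fun l => ξ l ω) 2 μ :=
  h.memLp_centredSq _

theorem integral_abs_diagPart_le (h : StdNoise μ ξ ξs) (hn : Odd n) (hs : ∀ l, s l ^ 2 ≤ v)
    {lam : Fin n → ℝ} {κ : ℝ} (hκ : ∀ l, |kernel n lam l l| ≤ κ) :
    ∫ ω, |diagPart n lam s fun l => ξ l ω| ∂μ ≤ √(ξs - 1) * v * κ / (n * √(n : ℝ)) := by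
  have hn0 := hn.pos
  have hn' : (0 : ℝ) < n := by positivity
  have hκ0 : 0 ≤ κ := (abs_nonneg _).trans (hκ ⟨0, hn0⟩)
  have hv : 0 ≤ v := (sq_nonneg _).trans (hs ⟨0, hn0⟩)
  have hξ : 0 ≤ ξs - 1 := by linarith [h.one_le_fourth_moment ⟨0, hn0⟩]
  refine integral_abs_le_of_integral_sq_le (by positivity) (h.memLp_diagPart lam s) ?_
  simp only [diagPart]
  rw [h.integral_sq_centredSq, div_pow, mul_pow, mul_pow, Real.sq_sqrt hξ, mul_pow,
    Real.sq_sqrt hn'.le, mul_assoc, mul_div_assoc]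
  refine mul_le_mul_of_nonneg_left ?_ hξ
  have : ∀ l, ((1 / (n : ℝ) ^ 2) * s l ^ 2 * kernel n lam l l) ^ 2
      ≤ ((1 / (n : ℝ) ^ 2) * v * κ) ^ 2 := by
    intro l
    rw [mul_pow _ (kernel n lam l l), mul_pow _ κ, ← sq_abs (kernel n lam l l)]
    gcongr
    · exact hs l
    · exact hκ l
  refine (Finset.sum_le_sum fun l _ => this l).trans (le_of_eq ?_)
  simp only [Finset.sum_const, Finset.card_univ, Fintype.card_fin, nsmul_eq_mul]
  field_simp

theorem memLp_offDiagPart (h : StdNoise μ ξ ξs) (lam s : Fin n → ℝ) :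
    MemLp (fun ω => offDiagPart n lam s fun l => ξ l ω) 2 μ :=
  h.memLp_offDiag fun l k => (1 / (n : ℝ) ^ 2) * (s l * s k) * kernel n lam l k

/-- Only one of the two squared volatilities is bounded by v; the other is kept and averages to
`meanVol`, reproducing the denominator of `offDiagRatio`. The 4 is 2 from the swap symmetry times 2
from the kernel rows. -/
theorem integral_sq_offDiagPart_le (h : StdNoise μ ξ ξs) (hn : Odd n) (hs : ∀ l, s l ^ 2 ≤ v)
    (lam : Fin n → ℝ) :
    ∫ ω, (offDiagPart n lam s fun l => ξ l ω) ^ 2 ∂μ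
      ≤ 4 * v / n * ((∑ j, lam j ^ 2) * (meanVol n s / n)) := by
  have hn0 := hn.pos
  have hn' : (0 : ℝ) < n := by positivity
  have hv : 0 ≤ v := (sq_nonneg _).trans (hs ⟨0, hn0⟩)
  have h1 := h.integral_sq_offDiag_le
    (a := fun l k => (1 / (n : ℝ) ^ 2) * (s l * s k) * kernel n lam l k) (fun l k => by
      have : kernel n lam l k = kernel n lam k l :=
        Finset.sum_congr rfl fun j _ => by ring
      rw [this]; ring)
  refine le_trans h1 ?_
  have h2 : ∀ l, ∑ k, ((1 / (n : ℝ) ^ 2) * (s l * s k) * kernel n lam l k) ^ 2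
      ≤ (1 / (n : ℝ) ^ 2) ^ 2 * v * (2 * n * ∑ j, lam j ^ 2) * s l ^ 2 := by
    intro l
    calc ∑ k, ((1 / (n : ℝ) ^ 2) * (s l * s k) * kernel n lam l k) ^ 2
        ≤ ∑ k, (1 / (n : ℝ) ^ 2) ^ 2 * v * s l ^ 2 * kernel n lam l k ^ 2 := by
          refine Finset.sum_le_sum fun k _ => ?_
          rw [mul_pow, mul_pow, mul_pow, mul_comm (s l ^ 2), ← mul_assoc]
          gcongr
          exact hs k
      _ = (1 / (n : ℝ) ^ 2) ^ 2 * v * s l ^ 2 * ∑ k, kernel n lam l k ^ 2 := by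
          rw [Finset.mul_sum]
      _ ≤ (1 / (n : ℝ) ^ 2) ^ 2 * v * s l ^ 2 * (2 * n * ∑ j, lam j ^ 2) := by
          gcongr
          exact sum_sq_kernel_le hn lam l
      _ = _ := by ring
  calc 2 * ∑ l, ∑ k, ((1 / (n : ℝ) ^ 2) * (s l * s k) * kernel n lam l k) ^ 2
      ≤ 2 * ∑ l, (1 / (n : ℝ) ^ 2) ^ 2 * v * (2 * n * ∑ j, lam j ^ 2) * s l ^ 2 := by
        gcongr with l; exact h2 l
    _ = _ := by rw [← Finset.mul_sum, meanVol]; field_simp; ring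

theorem integrable_offDiagRatio (h : StdNoise μ ξ ξs) (lam s : Fin n → ℝ) :
    Integrable (fun ω => offDiagRatio n lam s fun l => ξ l ω) μ :=
  (h.memLp_offDiagPart lam s).integrable_sq.div_const _

theorem integral_offDiagRatio_le (h : StdNoise μ ξ ξs) (hn : Odd n) (hs : ∀ l, s l ^ 2 ≤ v)
    (hv : 0 ≤ v) (lam : Fin n → ℝ) :
    ∫ ω, offDiagRatio n lam s (fun l => ξ l ω) ∂μ ≤ 4 * v / n := by
  simp only [offDiagRatio]
  rw [integral_div]
  refine div_le_of_le_mul₀ (mul_nonneg (Finset.sum_nonneg fun j _ => sq_nonneg _)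
    (div_nonneg (meanVol_nonneg s) (Nat.cast_nonneg n))) (by positivity) ?_
  exact h.integral_sq_offDiagPart_le hn hs lam

theorem memLp_noiseCoef (h : StdNoise μ ξ ξs) (s : Fin n → ℝ) (j : Fin n) :
    MemLp (fun ω => noiseCoef n s (fun l => ξ l ω) j) 2 μ := by
  have e : (fun ω => noiseCoef n s (fun l => ξ l ω) j)
      = fun ω => ∑ l, ((1 / (n : ℝ)) * s l * basisValue n j l) * ξ l ω := by
    ext ω
    rw [noiseCoef, empFourier_eq, Finset.mul_sum]
    exact Finset.sum_congr rfl fun l _ => by ring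
  rw [e]
  exact h.memLp_linear _

theorem integral_noiseCoef (h : StdNoise μ ξ ξs) (s : Fin n → ℝ) (j : Fin n) :
    ∫ ω, noiseCoef n s (fun l => ξ l ω) j ∂μ = 0 := by
  have e : (fun ω => noiseCoef n s (fun l => ξ l ω) j)
      = fun ω => ∑ l, ((1 / (n : ℝ)) * s l * basisValue n j l) * ξ l ω := by
    ext ω
    rw [noiseCoef, empFourier_eq, Finset.mul_sum]
    exact Finset.sum_congr rfl fun l _ => by ring
  rw [e]
  exact h.integral_linear _

theorem integral_sq_noiseCoef (h : StdNoise μ ξ ξs) (s : Fin n → ℝ) (j : Fin n) :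
    ∫ ω, noiseCoef n s (fun l => ξ l ω) j ^ 2 ∂μ
      = (1 / (n : ℝ) ^ 2) * ∑ l, s l ^ 2 * basisValue n j l ^ 2 := by
  have e : (fun ω => noiseCoef n s (fun l => ξ l ω) j ^ 2)
      = fun ω => (∑ l, ((1 / (n : ℝ)) * s l * basisValue n j l) * ξ l ω) ^ 2 := by
    ext ω
    rw [noiseCoef, empFourier_eq, Finset.mul_sum]
    congr 1
    exact Finset.sum_congr rfl fun l _ => by ring
  rw [e, h.integral_sq_linear, Finset.mul_sum]
  exact Finset.sum_congr rfl fun l _ => by ring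

theorem integrable_coefLoss (h : StdNoise μ ξ ξs) (s θ lam : Fin n → ℝ) :
    Integrable (fun ω => coefLoss θ (noiseCoef n s fun l => ξ l ω) lam) μ := by
  refine integrable_finsetSum _ fun j _ => MemLp.integrable_sq ?_
  exact (((memLp_const (θ j)).add (h.memLp_noiseCoef s j)).const_mul (lam j)).sub
    (memLp_const (θ j))

/-- The penalty term is dominated by the risk. -/
theorem penalty_le (h : StdNoise μ ξ ξs) (hs : ∀ l, s l ^ 2 ≤ v)
    {θ lam : Fin n → ℝ} {R : ℝ}
    (hR : ∀ l, |∑ j, lam j ^ 2 * (basisValue n j l ^ 2 - 1)| ≤ R) :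
    (∑ j, lam j ^ 2) * (meanVol n s / n)
      ≤ ∫ ω, coefLoss θ (noiseCoef n s fun l => ξ l ω) lam ∂μ + R * v / n := by
  have hb := (abs_le.1 (abs_volBias_le hs hR)).1
  have hi : ∀ j, Integrable (fun ω => noiseCoef n s (fun l => ξ l ω) j) μ := fun j =>
    (h.memLp_noiseCoef s j).integrable (by norm_num)
  have hi2 : ∀ j, Integrable (fun ω => noiseCoef n s (fun l => ξ l ω) j ^ 2) μ := fun j =>
    (h.memLp_noiseCoef s j).integrable_sq
  -- Bias–variance decomposition of each coefficient. Dropping the squared bias below leaves the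
  -- variance, which is the penalty up to a volatility bias.
  have hE : ∀ j, ∫ ω, (lam j * (θ j + noiseCoef n s (fun l => ξ l ω) j) - θ j) ^ 2 ∂μ
      = ((lam j - 1) * θ j) ^ 2
        + lam j ^ 2 * ((1 / (n : ℝ) ^ 2) * ∑ l, s l ^ 2 * basisValue n j l ^ 2) := by
    intro j
    have e : (fun ω => (lam j * (θ j + noiseCoef n s (fun l => ξ l ω) j) - θ j) ^ 2)
        = fun ω => (((lam j - 1) * θ j) ^ 2
          + 2 * ((lam j - 1) * θ j) * lam j * noiseCoef n s (fun l => ξ l ω) j)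
          + lam j ^ 2 * noiseCoef n s (fun l => ξ l ω) j ^ 2 := by ext ω; ring
    have i1 : Integrable (fun ω => ((lam j - 1) * θ j) ^ 2
          + 2 * ((lam j - 1) * θ j) * lam j * noiseCoef n s (fun l => ξ l ω) j) μ :=
      (integrable_const _).add ((hi j).const_mul _)
    rw [e, integral_add i1 ((hi2 j).const_mul _), integral_add (integrable_const _)
      ((hi j).const_mul _), integral_const_mul, integral_const_mul, h.integral_noiseCoef,
      h.integral_sq_noiseCoef]
    simp
  have hI : ∀ j, Integrable (fun ω =>
      (lam j * (θ j + noiseCoef n s (fun l => ξ l ω) j) - θ j) ^ 2) μ := fun j =>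
    MemLp.integrable_sq ((((memLp_const (θ j)).add (h.memLp_noiseCoef s j)).const_mul (lam j)).sub
      (memLp_const (θ j)))
  have hsum : ∫ ω, coefLoss θ (noiseCoef n s fun l => ξ l ω) lam ∂μ
      = ∑ j, ((lam j - 1) * θ j) ^ 2
        + ∑ j, lam j ^ 2 * ((1 / (n : ℝ) ^ 2) * ∑ l, s l ^ 2 * basisValue n j l ^ 2) := by
    unfold coefLoss
    rw [integral_finsetSum _ fun j _ => hI j, ← Finset.sum_add_distrib]
    exact Finset.sum_congr rfl fun j _ => hE j
  have h0 : 0 ≤ ∑ j, ((lam j - 1) * θ j) ^ 2 := Finset.sum_nonneg fun j _ => sq_nonneg _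
  have hv : ∑ j, lam j ^ 2 * ((1 / (n : ℝ) ^ 2) * ∑ l, s l ^ 2 * basisValue n j l ^ 2)
      = (∑ j, lam j ^ 2) * (meanVol n s / n) + volBias n (fun j => lam j ^ 2) s := by
    have e1 : volBias n (fun j => lam j ^ 2) s
        = ∑ j, lam j ^ 2 * ((1 / (n : ℝ) ^ 2) * ∑ l, s l ^ 2 * (basisValue n j l ^ 2 - 1)) := by
      simp only [volBias, Finset.mul_sum]
      rw [Finset.sum_comm]
      exact Finset.sum_congr rfl fun l _ => Finset.sum_congr rfl fun j _ => by ring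
    rw [e1, Finset.sum_mul, ← Finset.sum_add_distrib]
    refine Finset.sum_congr rfl fun j _ => ?_
    simp only [mul_sub, Finset.sum_sub_distrib, meanVol]
    ring_nf
  rw [hsum, hv]
  have hb' : -(R * v / n) ≤ volBias n (fun j => lam j ^ 2) s := hb
  linarith

/-- The accuracy of the variance estimator. -/
theorem integral_abs_meanVol_sub_le (h : StdNoise μ ξ ξs) (hn : Odd n) (hs : ∀ l, s l ^ 2 ≤ v)
    {m : ℕ} (hm : 1 ≤ m) (hmn : m ≤ n) {r : ℝ} {S : ℝ → ℝ} (hS : MemSobolevBall r S) :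
    Integrable (fun ω => |meanVol n s
      - varianceEstimator n m fun l => S (design n l) + s l * ξ l ω|) μ ∧
    ∫ ω, |meanVol n s - varianceEstimator n m fun l => S (design n l) + s l * ξ l ω| ∂μ
      ≤ (sigmaBar v ξs + varsigmaStar n m r v) / √(n : ℝ) := by
  have hn0 := hn.pos
  have hn' : (0 : ℝ) < n := by positivity
  have hm' : (0 : ℝ) < m := by positivity
  have hv : 0 ≤ v := (sq_nonneg _).trans (hs ⟨0, hn0⟩)
  set θ : Fin n → ℝ := empFourier n fun l => S (design n l) with hθ
  -- Indicator weights of the tail turn the variance estimator into the quadratic form already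
  -- decomposed.
  set y : Fin n → ℝ := fun j => if m < (j : ℕ) + 1 then 1 else 0 with hy
  have hT := sum_sq_empFourier_tail_le hS hn hm
  have hTy : ∑ j, (y j * θ j) ^ 2 ≤ r / (4 * m ^ 2) := by
    refine le_trans (le_of_eq ?_) hT
    rw [Finset.sum_filter]
    refine Finset.sum_congr rfl fun j _ => ?_
    simp only [hy, hθ]
    split_ifs <;> simp
  have hr : 0 ≤ r := by
    have h1 : 0 ≤ r / (4 * (m : ℝ) ^ 2) := le_trans (Finset.sum_nonneg fun j _ => sq_nonneg _) hTy
    by_contra hneg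
    exact absurd h1 (not_le.2 (div_neg_of_neg_of_pos (not_le.1 hneg) (by positivity)))
  have hsumy : ∑ j, y j = n - m := by
    have e := Fin.sum_univ_eq_sum_range (fun j : ℕ => if m < j + 1 then (1 : ℝ) else 0) n
    simp only [hy]
    rw [e, ← Finset.sum_filter, Finset.sum_const, nsmul_eq_mul, mul_one]
    have : Finset.filter (fun j => m < j + 1) (Finset.range n) = Finset.Ico m n := by
      ext j; simp; omega
    rw [this, Nat.card_Ico, Nat.cast_sub hmn]
  have hsqy : ∑ j, y j ^ 2 = n - m := by
    rw [← hsumy]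
    refine Finset.sum_congr rfl fun j _ => ?_
    simp only [hy]; split_ifs <;> simp
  -- Signal tail, cross term, three noise parts, and the loss from omitting the first m
  -- coefficients.
  have hdec : ∀ ω, varianceEstimator n m (fun l => S (design n l) + s l * ξ l ω) - meanVol n s
      = ∑ j, (y j * θ j) ^ 2 + 2 * (∑ j, y j * θ j * noiseCoef n s (fun l => ξ l ω) j)
        + volBias n y s + (diagPart n y s fun l => ξ l ω) + (offDiagPart n y s fun l => ξ l ω)
        - m / n * meanVol n s := by
    intro ω
    have e1 := sum_mul_sq_noiseCoef y s fun l => ξ l ω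
    have e2 : ∑ j, y j * (noiseCoef n s (fun l => ξ l ω) j ^ 2 - meanVol n s / n)
        = ∑ j, y j * noiseCoef n s (fun l => ξ l ω) j ^ 2 - (n - m) * (meanVol n s / n) := by
      simp only [mul_sub, Finset.sum_sub_distrib, ← Finset.sum_mul, hsumy]
    have e3 : varianceEstimator n m (fun l => S (design n l) + s l * ξ l ω)
        = ∑ j, (y j * θ j) ^ 2 + 2 * (∑ j, y j * θ j * noiseCoef n s (fun l => ξ l ω) j)
          + ∑ j, y j * noiseCoef n s (fun l => ξ l ω) j ^ 2 := by
      rw [varianceEstimator, Finset.sum_filter, Finset.mul_sum, ← Finset.sum_add_distrib,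
        ← Finset.sum_add_distrib]
      refine Finset.sum_congr rfl fun j _ => ?_
      have e4 : empFourier n (fun l => S (design n l) + s l * ξ l ω) j
          = θ j + noiseCoef n s (fun l => ξ l ω) j := by
        simp only [hθ, noiseCoef, empFourier_eq, add_mul, Finset.sum_add_distrib, mul_add]
      rw [e4]
      simp only [hy]
      split_ifs <;> ring
    rw [e3]
    have e5 : (n - m) * (meanVol n s / n) = meanVol n s - m / n * meanVol n s := by
      field_simp
    linarith
  have hker : ∀ l, |kernel n y l l| ≤ n := by
    intro l
    rw [← sum_basisValue_sq hn l, kernel, abs_of_nonneg (Finset.sum_nonneg fun j _ =>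
      mul_nonneg (by simp only [hy]; split_ifs <;> norm_num) (mul_self_nonneg _))]
    refine Finset.sum_le_sum fun j _ => ?_
    simp only [hy]
    split_ifs
    · exact le_of_eq (by ring)
    · simpa using sq_nonneg (basisValue n j l)
  -- By completeness φ_j² - 1 sums to zero over all j, so the tail sum is minus the sum over j ≤ m.
  -- The latter has nonincreasing weights and hence is at most 1 in modulus.
  have hbias : |volBias n y s| ≤ 1 * v / n := by
    refine abs_volBias_le hs fun l => ?_
    have h1 : ∑ j, y j * (basisValue n j l ^ 2 - 1)
        = - ∑ j ∈ Finset.range n, (if j < m then (1 : ℝ) else 0)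
            * trigBasisBar (j + 1) (design n l) := by
      rw [← Fin.sum_univ_eq_sum_range (fun j => (if j < m then (1 : ℝ) else 0)
            * trigBasisBar (j + 1) (design n l)) n]
      have h2 : ∑ j, (basisValue n j l ^ 2 - 1) = 0 := by
        rw [Finset.sum_sub_distrib, sum_basisValue_sq hn l]; simp
      rw [eq_neg_iff_add_eq_zero, ← Finset.sum_add_distrib]
      refine Eq.trans ?_ h2
      refine Finset.sum_congr rfl fun j _ => ?_
      simp only [hy, basisValue, trigBasisBar]
      by_cases hj : (j : ℕ) < m
      · rw [if_neg (by omega), if_pos hj]; ring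
      · rw [if_pos (by omega), if_neg hj]; ring
    rw [h1, abs_neg]
    refine (abs_sum_antitone_mul_trigBasisBar ?_ ?_ _ n).trans ?_
    · intro i j hij
      by_cases hj : j < m
      · simp [hj, hij.trans_lt hj]
      · simp only [hj, if_false]; split_ifs <;> norm_num
    · intro j; split_ifs <;> norm_num
    · split_ifs <;> norm_num
  have hvol : |(m : ℝ) / n * meanVol n s| ≤ m * v / n := by
    rw [abs_of_nonneg (mul_nonneg (by positivity) (meanVol_nonneg s))]
    calc (m : ℝ) / n * meanVol n s ≤ m / n * v := by gcongr; exact meanVol_le hn0 hs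
      _ = _ := by ring
  have i1 : Integrable (fun ω => |∑ j, y j * θ j * noiseCoef n s (fun l => ξ l ω) j|) μ :=
    ((h.memLp_signal s θ y).integrable (by norm_num)).abs
  have i2 : Integrable (fun ω => |diagPart n y s fun l => ξ l ω|) μ :=
    ((h.memLp_diagPart y s).integrable (by norm_num)).abs
  have i3 : Integrable (fun ω => |offDiagPart n y s fun l => ξ l ω|) μ :=
    ((h.memLp_offDiagPart y s).integrable (by norm_num)).abs
  have i0 : Integrable (fun ω => |meanVol n s
      - varianceEstimator n m fun l => S (design n l) + s l * ξ l ω|) μ := by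
    have : (fun ω => |meanVol n s
      - varianceEstimator n m fun l => S (design n l) + s l * ξ l ω|)
        = fun ω => |∑ j, (y j * θ j) ^ 2
          + 2 * (∑ j, y j * θ j * noiseCoef n s (fun l => ξ l ω) j)
        + volBias n y s + (diagPart n y s fun l => ξ l ω) + (offDiagPart n y s fun l => ξ l ω)
        - m / n * meanVol n s| := by
      ext ω; rw [abs_sub_comm, hdec]
    rw [this]
    refine Integrable.abs ?_
    exact (((((integrable_const _).add (((h.memLp_signal s θ y).integrable
      (by norm_num)).const_mul 2)).add (integrable_const _)).add
      ((h.memLp_diagPart y s).integrable (by norm_num))).add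
      ((h.memLp_offDiagPart y s).integrable (by norm_num))).sub (integrable_const _)
  refine ⟨i0, ?_⟩
  have j1 : ∫ ω, |∑ j, y j * θ j * noiseCoef n s (fun l => ξ l ω) j| ∂μ
      ≤ √(r * v) / (2 * m * √(n : ℝ)) := by
    refine integral_abs_le_of_integral_sq_le (by positivity) (h.memLp_signal s θ y) ?_
    refine (h.integral_sq_signal_le hn hs θ y).trans ?_
    rw [div_pow, Real.sq_sqrt (by positivity), mul_pow, mul_pow, Real.sq_sqrt hn'.le]
    calc v / n * ∑ j, (y j * θ j) ^ 2 ≤ v / n * (r / (4 * m ^ 2)) := by gcongr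
      _ = _ := by field_simp; norm_num
  have j2 := h.integral_abs_diagPart_le hn hs hker
  have j3 : ∫ ω, |offDiagPart n y s fun l => ξ l ω| ∂μ ≤ 2 * v / √(n : ℝ) := by
    refine integral_abs_le_of_integral_sq_le (by positivity) (h.memLp_offDiagPart y s) ?_
    refine (h.integral_sq_offDiagPart_le hn hs y).trans ?_
    rw [div_pow, Real.sq_sqrt hn'.le, hsqy]
    calc 4 * v / n * ((n - m) * (meanVol n s / n)) ≤ 4 * v / n * (n * (v / n)) := by
          have := meanVol_nonneg s
          gcongr
          · linarith
          · exact meanVol_le hn0 hs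
      _ = _ := by field_simp; ring
  have hpt : ∀ ω, |meanVol n s - varianceEstimator n m fun l => S (design n l) + s l * ξ l ω|
      ≤ ((r / (4 * m ^ 2) + 1 * v / n + m * v / n)
        + 2 * |∑ j, y j * θ j * noiseCoef n s (fun l => ξ l ω) j|)
        + (|diagPart n y s fun l => ξ l ω| + |offDiagPart n y s fun l => ξ l ω|) := by
    intro ω
    rw [abs_sub_comm, hdec]
    have h0 : 0 ≤ ∑ j, (y j * θ j) ^ 2 := Finset.sum_nonneg fun j _ => sq_nonneg _
    have a1 := abs_le.1 hbias
    have a2 := abs_le.1 hvol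
    have a3 := le_abs_self (∑ j, y j * θ j * noiseCoef n s (fun l => ξ l ω) j)
    have a4 := neg_abs_le (∑ j, y j * θ j * noiseCoef n s (fun l => ξ l ω) j)
    have a5 := le_abs_self (diagPart n y s fun l => ξ l ω)
    have a6 := neg_abs_le (diagPart n y s fun l => ξ l ω)
    have a7 := le_abs_self (offDiagPart n y s fun l => ξ l ω)
    have a8 := neg_abs_le (offDiagPart n y s fun l => ξ l ω)
    rw [abs_le]
    constructor <;> linarith
  have i4 : Integrable (fun ω => (r / (4 * m ^ 2) + 1 * v / n + m * v / n)
        + 2 * |∑ j, y j * θ j * noiseCoef n s (fun l => ξ l ω) j|) μ :=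
    (integrable_const _).add (i1.const_mul 2)
  have i5 : Integrable (fun ω => |diagPart n y s fun l => ξ l ω|
      + |offDiagPart n y s fun l => ξ l ω|) μ := i2.add i3
  refine (integral_mono i0 (i4.add i5) hpt).trans ?_
  rw [integral_add' i4 i5, integral_add (integrable_const _) (i1.const_mul 2),
    integral_add i2 i3, integral_const_mul, integral_const, probReal_univ, one_smul]
  have hsq : √(n : ℝ) * √(n : ℝ) = n := Real.mul_self_sqrt hn'.le
  have hsp : 0 < √(n : ℝ) := Real.sqrt_pos.2 hn'
  have h2 : 1 ≤ √(2 : ℝ) := Real.one_le_sqrt.2 (by norm_num)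
  have hξ0 := Real.sqrt_nonneg (ξs - 1)
  -- The stated constants are not sharp, so each error is dominated separately: 1/4 by 4, 1 by 4, 1
  -- + m by 2 + m, and so on.
  have t1 : r / (4 * (m : ℝ) ^ 2) ≤ 4 * r * √(n : ℝ) / m ^ 2 / √(n : ℝ) := by
    have : 0 ≤ r / (m : ℝ) ^ 2 := by positivity
    calc r / (4 * (m : ℝ) ^ 2) = 1 / 4 * (r / (m : ℝ) ^ 2) := by field_simp
      _ ≤ 4 * (r / (m : ℝ) ^ 2) := by linarith
      _ = _ := by field_simp
  have t2 : 2 * (√(r * v) / (2 * m * √(n : ℝ))) ≤ 4 * √(r * v) * (1 / m) / √(n : ℝ) := by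
    have : 0 ≤ √(r * v) / (m * √(n : ℝ)) := by positivity
    calc 2 * (√(r * v) / (2 * m * √(n : ℝ))) = √(r * v) / (m * √(n : ℝ)) := by field_simp
      _ ≤ 4 * (√(r * v) / (m * √(n : ℝ))) := by linarith
      _ = _ := by field_simp
  have t3 : 1 * v / n + m * v / n ≤ (2 + m) * v / √(n : ℝ) / √(n : ℝ) := by
    rw [div_div, hsq, ← add_div]
    gcongr
    linarith
  have t4 : √(ξs - 1) * v * n / (n * √(n : ℝ)) + 2 * v / √(n : ℝ) ≤ sigmaBar v ξs / √(n : ℝ) := by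
    have : √(ξs - 1) * v * n / (n * √(n : ℝ)) = √(ξs - 1) * v / √(n : ℝ) := by field_simp
    rw [this, ← add_div, sigmaBar]
    gcongr
    nlinarith [mul_nonneg hξ0 hv, mul_nonneg (sub_nonneg.2 h2) hv]
  unfold varsigmaStar
  rw [add_div (sigmaBar v ξs), add_div, add_div]
  linarith

end StdNoise

end

/-! ### From the estimator to its coefficients, and a majorant free of the selected weights. -/

theorem empFourier_observation {n : ℕ} (S : ℝ → ℝ) (s x : Fin n → ℝ) (j : Fin n) :
    empFourier n (fun l => S (design n l) + s l * x l) j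
      = empFourier n (fun l => S (design n l)) j + noiseCoef n s x j := by
  simp only [noiseCoef, empFourier_eq, add_mul, Finset.sum_add_distrib, mul_add]

/-- By completeness S agrees at the design points with its own trigonometric sum, so Parseval leaves
no truncation error. -/
theorem lossOf_eq {n : ℕ} (hn : Odd n) (S : ℝ → ℝ) (s x lam : Fin n → ℝ) :
    lossOf n S (fun l => S (design n l) + s l * x l) lam
      = coefLoss (empFourier n fun l => S (design n l)) (noiseCoef n s x) lam := by
  have hn' : (n : ℝ) ≠ 0 := by have := hn.pos; positivity
  have h := sum_sq_trigSum hn fun j => lam j * (empFourier n (fun l => S (design n l)) j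
    + noiseCoef n s x j) - empFourier n (fun l => S (design n l)) j
  have e : ∀ l, ∑ j, (lam j * (empFourier n (fun l => S (design n l)) j
      + noiseCoef n s x j) - empFourier n (fun l => S (design n l)) j) * basisValue n j l
      = wlsEstimator n (fun l => S (design n l) + s l * x l) lam (design n l)
        - S (design n l) := by
    intro l
    simp only [sub_mul, Finset.sum_sub_distrib, wlsEstimator, empFourier_observation]
    rw [sum_empFourier_mul hn (fun l => S (design n l))]
    rfl
  simp only [e] at h
  rw [lossOf, empNormSq, h, coefLoss]
  field_simp

theorem cost_eq {n : ℕ} (m : ℕ) (ρ : ℝ) (S : ℝ → ℝ) (s x lam : Fin n → ℝ) :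
    cost n m ρ (fun l => S (design n l) + s l * x l) lam
      = coefCost ρ (varianceEstimator n m (fun l => S (design n l) + s l * x l) / n)
        (empFourier n fun l => S (design n l)) (noiseCoef n s x) lam := by
  simp only [cost, coefCost, empFourier_observation]
  rw [one_div_mul_eq_div]
  ring

section Family

variable {n : ℕ} {Lam : Finset (Fin n → ℝ)} {lam : Fin n → ℝ}

theorem sum_le_rhoSum (h : lam ∈ Lam) : ∑ j, lam j ≤ rhoSum n Lam :=
  le_ciSup (f := fun lam : Lam => ∑ j : Fin n, lam.1 j) (Set.finite_range _).bddAbove ⟨lam, h⟩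

theorem design_mem_Icc (l : Fin n) : design n l ∈ Set.Icc (0 : ℝ) 1 := by
  have hn' : (0 : ℝ) < n := by exact_mod_cast l.pos
  refine ⟨by unfold design; positivity, ?_⟩
  unfold design
  rw [div_le_one hn']
  exact_mod_cast l.2

theorem abs_sum_le_rhoBar (i : ℕ) (h : lam ∈ Lam) (l : Fin n) :
    |∑ j, lam j ^ i * (basisValue n j l ^ 2 - 1)| ≤ rhoBar n i Lam := by
  refine le_trans ?_ (le_ciSup (f := fun lam : Lam => ⨆ x : Set.Icc (0 : ℝ) 1,
    |∑ j : Fin n, lam.1 j ^ i * trigBasisBar ((j : ℕ) + 1) x|)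
    (Set.finite_range _).bddAbove ⟨lam, h⟩)
  refine le_ciSup (f := fun x : Set.Icc (0 : ℝ) 1 =>
    |∑ j : Fin n, lam j ^ i * trigBasisBar ((j : ℕ) + 1) x|) ?_ ⟨design n l, design_mem_Icc l⟩
  -- The supremum over x is over an infinite set and would be 0 by convention if unbounded; this is
  -- an explicit bound.
  refine ⟨∑ j, |lam j ^ i|, ?_⟩
  rintro _ ⟨x, rfl⟩
  refine (Finset.abs_sum_le_sum_abs _ _).trans (Finset.sum_le_sum fun j _ => ?_)
  rw [abs_mul]
  exact mul_le_of_le_one_right (abs_nonneg _) (abs_trigBasisBar_le _ _)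

theorem rhoBar_nonneg (n i : ℕ) (Lam : Finset (Fin n → ℝ)) : 0 ≤ rhoBar n i Lam :=
  Real.iSup_nonneg fun _ => Real.iSup_nonneg fun _ => abs_nonneg _

theorem rhoSum_nonneg (h : ∀ lam ∈ Lam, ∀ j, lam j ∈ Set.Icc (0 : ℝ) 1) : 0 ≤ rhoSum n Lam :=
  Real.iSup_nonneg fun lam => Finset.sum_nonneg fun j _ => (h lam.1 lam.2 j).1

theorem sigmaBar_nonneg {σs : ℝ} (h : 0 ≤ σs) (ξs : ℝ) : 0 ≤ sigmaBar σs ξs := by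
  unfold sigmaBar; positivity

theorem varsigmaStar_nonneg (n m : ℕ) {r σs : ℝ} (hr : 0 ≤ r) (h : 0 ≤ σs) :
    0 ≤ varsigmaStar n m r σs := by
  unfold varsigmaStar; positivity

theorem upsilonStar_nonneg (hL : ∀ lam ∈ Lam, ∀ j, lam j ∈ Set.Icc (0 : ℝ) 1) (ξs : ℝ) {ρ : ℝ}
    (h0 : 0 < ρ) : 0 ≤ upsilonStar n ξs ρ Lam := by
  have := rhoBar_nonneg n 1 Lam
  have := rhoSum_nonneg hL
  unfold upsilonStar; positivity

theorem kappaStar_nonneg {ρ : ℝ} (h0 : 0 < ρ) (h3 : ρ < 1 / 3) : 0 ≤ kappaStar ρ := by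
  have : 0 ≤ 1 - ρ ^ 2 := by nlinarith
  have : 0 ≤ 1 - 3 * ρ := by linarith
  unfold kappaStar; positivity

theorem psi_nonneg (hL : ∀ lam ∈ Lam, ∀ j, lam j ∈ Set.Icc (0 : ℝ) 1) (ξs : ℝ) {ρ σs : ℝ}
    (h0 : 0 < ρ) (h3 : ρ < 1 / 3) (h : 0 ≤ σs) : 0 ≤ psi n σs ξs ρ Lam := by
  have := rhoBar_nonneg n 2 Lam
  have := upsilonStar_nonneg hL ξs h0
  have : 0 ≤ 1 - ρ := by linarith
  have : 0 ≤ 1 - 3 * ρ := by linarith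
  unfold psi; positivity

theorem remainder_nonneg (m : ℕ) (hL : ∀ lam ∈ Lam, ∀ j, lam j ∈ Set.Icc (0 : ℝ) 1) (ξs : ℝ)
    {r ρ σs : ℝ} (hr : 0 ≤ r) (h0 : 0 < ρ) (h3 : ρ < 1 / 3) (h : 0 ≤ σs) :
    0 ≤ remainder n m r σs ξs ρ Lam := by
  have := psi_nonneg hL ξs h0 h3 h
  have := kappaStar_nonneg h0 h3
  have := sigmaBar_nonneg h ξs
  have := varsigmaStar_nonneg n m hr h
  have := rhoSum_nonneg hL
  unfold remainder; positivity

end Family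

/-- An upper bound for `(1 - 3ρ)` times the loss of the selected estimator, in terms of the loss
of the estimator with weights `lam₀`. -/
noncomputable def lossMajorant (n m : ℕ) (ρ v : ℝ) (S : ℝ → ℝ) (Lam : Finset (Fin n → ℝ))
    (lam₀ s x : Fin n → ℝ) : ℝ :=
  (1 + ρ) * coefLoss (empFourier n fun l => S (design n l)) (noiseCoef n s x) lam₀
    + 2 * ρ * (1 - ρ) * ((∑ j, lam₀ j ^ 2) * (meanVol n s / n))
    + (1 - ρ) / ρ * ∑ lam ∈ Lam, signalRatio (empFourier n fun l => S (design n l))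
        (noiseCoef n s x) (fun j => lam j - lam₀ j)
    + ∑ lam ∈ Lam, signalRatio (empFourier n fun l => S (design n l))
        (noiseCoef n s x) (fun j => (lam j - lam₀ j) ^ 2)
    + (1 - ρ) * (4 * (rhoBar n 1 Lam * v / n) + 4 * ∑ lam ∈ Lam, |diagPart n lam s x|
      + 2 / ρ * ∑ lam ∈ Lam, offDiagRatio n lam s x
      + (2 + ρ) * rhoSum n Lam *
        (|meanVol n s - varianceEstimator n m fun l => S (design n l) + s l * x l| / n))

section Majorant

variable {n m : ℕ} {ρ v : ℝ} {S : ℝ → ℝ} {Lam : Finset (Fin n → ℝ)} {lam₀ lam s : Fin n → ℝ}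

theorem offDiagRatio_nonneg (n : ℕ) (lam s x : Fin n → ℝ) : 0 ≤ offDiagRatio n lam s x :=
  div_nonneg (sq_nonneg _) (mul_nonneg (Finset.sum_nonneg fun _ _ => sq_nonneg _)
    (div_nonneg (meanVol_nonneg s) (Nat.cast_nonneg n)))

theorem signalRatio_nonneg {n : ℕ} (θ e y : Fin n → ℝ) : 0 ≤ signalRatio θ e y :=
  div_nonneg (sq_nonneg _) (Finset.sum_nonneg fun _ _ => sq_nonneg _)

theorem coefLoss_nonneg {n : ℕ} (θ e lam : Fin n → ℝ) : 0 ≤ coefLoss θ e lam :=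
  Finset.sum_nonneg fun _ _ => sq_nonneg _

/-- Every error depending on the selected weights is nonnegative or a maximum over the family, so it
is bounded by its sum over Λ or by that maximum. -/
theorem coefLoss_le_lossMajorant (hn : 0 < n) (h0 : 0 < ρ) (h3 : ρ < 1 / 3)
    (hL : ∀ lam ∈ Lam, ∀ j, lam j ∈ Set.Icc (0 : ℝ) 1) (hlam₀ : lam₀ ∈ Lam) (hlam : lam ∈ Lam)
    (hs : ∀ l, s l ^ 2 ≤ v) {x : Fin n → ℝ}
    (hcost : cost n m ρ (fun l => S (design n l) + s l * x l) lam
      ≤ cost n m ρ (fun l => S (design n l) + s l * x l) lam₀) :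
    (1 - 3 * ρ) * coefLoss (empFourier n fun l => S (design n l)) (noiseCoef n s x) lam
      ≤ lossMajorant n m ρ v S Lam lam₀ s x := by
  rw [cost_eq, cost_eq] at hcost
  have hbias : ∀ lam ∈ Lam, |volBias n lam s| ≤ rhoBar n 1 Lam * v / n := fun lam hlam =>
    abs_volBias_le hs fun l => by simpa using abs_sum_le_rhoBar 1 hlam l
  have h := coefLoss_oracle hn h0 h3 (hL lam hlam) (hL lam₀ hlam₀) hcost (hbias lam hlam)
    (hbias lam₀ hlam₀) (sum_le_rhoSum hlam) (sum_le_rhoSum hlam₀)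
  refine h.trans ?_
  unfold lossMajorant
  have hn' : (0 : ℝ) < n := by positivity
  rw [← sub_div, abs_div, abs_of_pos hn']
  have h1ρ : 0 < 1 - ρ := by linarith
  have a1 := Finset.single_le_sum (s := Lam)
    (f := fun lam => signalRatio (empFourier n fun l => S (design n l))
        (noiseCoef n s x) (fun j => lam j - lam₀ j)) (fun _ _ => signalRatio_nonneg _ _ _) hlam
  have a2 := Finset.single_le_sum (s := Lam)
    (f := fun lam => signalRatio (empFourier n fun l => S (design n l))
        (noiseCoef n s x) (fun j => (lam j - lam₀ j) ^ 2))
    (fun _ _ => signalRatio_nonneg _ _ _) hlam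
  have a3 : ∀ lam ∈ Lam, _ := fun lam hlam => Finset.single_le_sum (s := Lam)
    (f := fun lam => |diagPart n lam s x|) (fun _ _ => abs_nonneg _) hlam
  have a4 : ∀ lam ∈ Lam, _ := fun lam hlam => Finset.single_le_sum (s := Lam)
    (f := fun lam => offDiagRatio n lam s x) (fun _ _ => offDiagRatio_nonneg _ _ _ _) hlam
  have b3 := a3 lam hlam
  have b3' := a3 lam₀ hlam₀
  have b4 := a4 lam hlam
  have b4' := a4 lam₀ hlam₀
  have c4 : (offDiagRatio n lam s x + offDiagRatio n lam₀ s x) / ρ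
      ≤ 2 / ρ * ∑ lam ∈ Lam, offDiagRatio n lam s x := by
    rw [div_mul_eq_mul_div]
    gcongr
    linarith
  have c1 := mul_le_mul_of_nonneg_left a1 (div_nonneg h1ρ.le h0.le)
  refine add_le_add (add_le_add (add_le_add_right c1 _) a2)
    (mul_le_mul_of_nonneg_left ?_ h1ρ.le)
  refine add_le_add_left (add_le_add ?_ c4) _
  linarith

/-- Each of the |Λ| summands has a mean of controlled order, and `penalty_le` converts the
deterministic penalty into risk: (1 + ρ) + 2ρ(1 - ρ) = 1 + 3ρ - 2ρ². -/
theorem integral_lossMajorant_le {Ω : Type*} [MeasurableSpace Ω] {μ : Measure Ω}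
    [IsProbabilityMeasure μ] {ξ : Fin n → Ω → ℝ} {ξs r : ℝ} (h : StdNoise μ ξ ξs) (hn : Odd n)
    (h0 : 0 < ρ) (h3 : ρ < 1 / 3) (hL : ∀ lam ∈ Lam, ∀ j, lam j ∈ Set.Icc (0 : ℝ) 1)
    (hlam₀ : lam₀ ∈ Lam) (hs : ∀ l, s l ^ 2 ≤ v) (hm : 1 ≤ m) (hmn : m ≤ n)
    (hS : MemSobolevBall r S) (hr : 0 ≤ r) :
    Integrable (fun ω => lossMajorant n m ρ v S Lam lam₀ s fun l => ξ l ω) μ ∧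
    ∫ ω, lossMajorant n m ρ v S Lam lam₀ s (fun l => ξ l ω) ∂μ
      ≤ (1 + 3 * ρ - 2 * ρ ^ 2) * ∫ ω, coefLoss (empFourier n fun l => S (design n l))
          (noiseCoef n s fun l => ξ l ω) lam₀ ∂μ
        + (1 - 3 * ρ) * ((1 / (n : ℝ)) * remainder n m r v ξs ρ Lam) := by
  have hn0 := hn.pos
  have hn' : (0 : ℝ) < n := by positivity
  have hv : 0 ≤ v := (sq_nonneg _).trans (hs ⟨0, hn0⟩)
  have h1ρ : 0 < 1 - ρ := by linarith
  have h3ρ : 0 < 1 - 3 * ρ := by linarith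
  set θ := empFourier n fun l => S (design n l)
  obtain ⟨i6, j6⟩ := h.integral_abs_meanVol_sub_le hn hs hm hmn hS
  have i1 := h.integrable_coefLoss s θ lam₀
  have i2 : Integrable (fun ω => ∑ lam ∈ Lam, signalRatio θ (noiseCoef n s fun l => ξ l ω)
      (fun j => lam j - lam₀ j)) μ :=
    integrable_finsetSum _ fun lam _ => h.integrable_signalRatio _ _ _
  have i3 : Integrable (fun ω => ∑ lam ∈ Lam, signalRatio θ (noiseCoef n s fun l => ξ l ω)
      (fun j => (lam j - lam₀ j) ^ 2)) μ :=
    integrable_finsetSum _ fun lam _ => h.integrable_signalRatio _ _ _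
  have i4 : Integrable (fun ω => ∑ lam ∈ Lam, |diagPart n lam s fun l => ξ l ω|) μ :=
    integrable_finsetSum _ fun lam _ => ((h.memLp_diagPart lam s).integrable (by norm_num)).abs
  have i5 : Integrable (fun ω => ∑ lam ∈ Lam, offDiagRatio n lam s fun l => ξ l ω) μ :=
    integrable_finsetSum _ fun lam _ => h.integrable_offDiagRatio lam s
  have j2 : ∫ ω, ∑ lam ∈ Lam, signalRatio θ (noiseCoef n s fun l => ξ l ω)
      (fun j => lam j - lam₀ j) ∂μ ≤ Lam.card * (v / n) := by
    rw [integral_finsetSum _ fun lam _ => h.integrable_signalRatio _ _ _, ← nsmul_eq_mul]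
    exact Finset.sum_le_card_nsmul _ _ _ fun lam _ => h.integral_signalRatio_le hn hs hv _ _
  have j3 : ∫ ω, ∑ lam ∈ Lam, signalRatio θ (noiseCoef n s fun l => ξ l ω)
      (fun j => (lam j - lam₀ j) ^ 2) ∂μ ≤ Lam.card * (v / n) := by
    rw [integral_finsetSum _ fun lam _ => h.integrable_signalRatio _ _ _, ← nsmul_eq_mul]
    exact Finset.sum_le_card_nsmul _ _ _ fun lam _ => h.integral_signalRatio_le hn hs hv _ _
  have j4 : ∫ ω, ∑ lam ∈ Lam, |diagPart n lam s fun l => ξ l ω| ∂μ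
      ≤ Lam.card * (√(ξs - 1) * v * (rhoBar n 1 Lam + rhoSum n Lam) / (n * √(n : ℝ))) := by
    rw [integral_finsetSum _ fun lam _ =>
      ((h.memLp_diagPart lam s).integrable (by norm_num)).abs, ← nsmul_eq_mul]
    refine Finset.sum_le_card_nsmul _ _ _ fun lam hlam => ?_
    refine h.integral_abs_diagPart_le hn hs fun l => ?_
    have e : kernel n lam l l = ∑ j, lam j ^ 1 * (basisValue n j l ^ 2 - 1) + ∑ j, lam j := by
      rw [kernel, ← Finset.sum_add_distrib]
      exact Finset.sum_congr rfl fun j _ => by ring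
    rw [e]
    refine (abs_add_le _ _).trans (add_le_add (abs_sum_le_rhoBar 1 hlam l) ?_)
    rw [abs_of_nonneg (Finset.sum_nonneg fun j _ => (hL lam hlam j).1)]
    exact sum_le_rhoSum hlam
  have j5 : ∫ ω, ∑ lam ∈ Lam, offDiagRatio n lam s (fun l => ξ l ω) ∂μ
      ≤ Lam.card * (4 * v / n) := by
    rw [integral_finsetSum _ fun lam _ => h.integrable_offDiagRatio lam s, ← nsmul_eq_mul]
    exact Finset.sum_le_card_nsmul _ _ _ fun lam _ => h.integral_offDiagRatio_le hn hs hv lam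
  have j7 := h.penalty_le (θ := θ) hs fun l => abs_sum_le_rhoBar 2 hlam₀ l
  have k1 := i1.const_mul (1 + ρ)
  have k2 : Integrable (fun _ : Ω =>
    2 * ρ * (1 - ρ) * ((∑ j, lam₀ j ^ 2) * (meanVol n s / n))) μ := integrable_const _
  have k3 := i2.const_mul ((1 - ρ) / ρ)
  have k4 : Integrable (fun _ : Ω => 4 * (rhoBar n 1 Lam * v / n)) μ := integrable_const _
  have k5 := i4.const_mul 4
  have k6 := i5.const_mul (2 / ρ)
  have k7 := (i6.div_const n).const_mul ((2 + ρ) * rhoSum n Lam)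
  have K := ((k4.add k5).add k6).add k7
  refine ⟨(((k1.add k2).add k3).add i3).add (K.const_mul (1 - ρ)), ?_⟩
  unfold lossMajorant
  have eK := integral_add' ((k4.add k5).add k6) k7
  rw [integral_add' (k4.add k5) k6, integral_add' k4 k5, integral_const, probReal_univ, one_smul,
    integral_const_mul, integral_const_mul, integral_const_mul, integral_div] at eK
  have e := integral_add' (((k1.add k2).add k3).add i3) (K.const_mul (1 - ρ))
  rw [integral_add' ((k1.add k2).add k3) i3, integral_add' (k1.add k2) k3, integral_add' k1 k2,
    integral_const, probReal_univ, one_smul, integral_const_mul, integral_const_mul,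
    integral_const_mul (1 - ρ), eK] at e
  refine (le_of_eq e).trans ?_
  set E₀ := ∫ ω, coefLoss θ (noiseCoef n s fun l => ξ l ω) lam₀ ∂μ
  set P := (∑ j, lam₀ j ^ 2) * (meanVol n s / n)
  set R := rhoSum n Lam
  have hR : 0 ≤ R := rhoSum_nonneg hL
  set R1 := rhoBar n 1 Lam
  set R2 := rhoBar n 2 Lam
  have hR2 : 0 ≤ R2 := rhoBar_nonneg _ _ _
  set ν := (Lam.card : ℝ)
  have hν : 0 ≤ ν := Nat.cast_nonneg _
  set B := sigmaBar v ξs + varsigmaStar n m r v with hB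
  have hB0 : 0 ≤ B := add_nonneg (sigmaBar_nonneg hv ξs) (varsigmaStar_nonneg n m hr hv)
  set q := √(n : ℝ) with hq
  have hq0 : 0 < q := Real.sqrt_pos.2 hn'
  set z := √(ξs - 1) with hz
  -- The factor 1 - 3ρ clears the denominators of `psi` and `kappaStar`, so the bounds can be
  -- matched term by term.
  have erem : (1 - 3 * ρ) * ((1 / (n : ℝ)) * remainder n m r v ξs ρ Lam)
      = (1 - ρ) * (16 * ν / ρ + 4 * R1 * (1 + ν * (z / q)) + 4 * ν * R * (z / q)) * v / n
        + 2 * ν / ρ * v / n + 2 * ρ * (1 - ρ) * R2 * v / n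
        + 4 * (1 - ρ ^ 2) * B * (R / q) / n := by
    simp only [remainder, psi, upsilonStar, kappaStar]
    change (1 - 3 * ρ) * ((1 / (n : ℝ)) * ((ρ * (1 - ρ) * (16 * ν / ρ + 4 * R1 * (1 + ν * (z / q))
      + 4 * ν * R * (z / q)) + 2 * ν + 2 * ρ ^ 2 * (1 - ρ) * R2) / (ρ * (1 - 3 * ρ)) * v
      + 4 * ((1 - ρ ^ 2) / (1 - 3 * ρ)) * B * (R / q))) = _
    field_simp
  rw [erem]
  have l1 : 2 * ρ * (1 - ρ) * P ≤ 2 * ρ * (1 - ρ) * (E₀ + R2 * v / n) := by gcongr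
  have l2 := mul_le_mul_of_nonneg_left j2 (div_nonneg h1ρ.le h0.le)
  have l3 := mul_le_mul_of_nonneg_left j4 (by norm_num : (0 : ℝ) ≤ 4)
  have l4 := mul_le_mul_of_nonneg_left j5 (by positivity : 0 ≤ 2 / ρ)
  have l5 := mul_le_mul_of_nonneg_left (div_le_div_of_nonneg_right j6 hn'.le)
    (by positivity : 0 ≤ (2 + ρ) * R)
  -- Enlarged to 4(1 + ρ), so that the outer factor 1 - ρ produces 4(1 - ρ²), the numerator of
  -- `kappaStar`.
  have l6 : (2 + ρ) * R * (B / q / n) ≤ 4 * (1 + ρ) * (R * (B / q / n)) := by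
    rw [mul_assoc]
    gcongr
    linarith
  have l7 : 2 / ρ * (ν * (4 * v / n)) ≤ 16 * ν / ρ * v / n := by
    have : 0 ≤ ν * v / (ρ * n) := by positivity
    calc 2 / ρ * (ν * (4 * v / n)) = 8 * (ν * v / (ρ * n)) := by field_simp; ring
      _ ≤ 16 * (ν * v / (ρ * n)) := by linarith
      _ = _ := by field_simp
  have l8 := mul_le_mul_of_nonneg_left
    (add_le_add (add_le_add (add_le_add_right l3 (4 * (R1 * v / n))) (l4.trans l7))
      (l5.trans l6)) h1ρ.le
  have l9 : (1 - ρ) / ρ * (ν * (v / n)) + ν * (v / n) ≤ 2 * ν / ρ * v / n := by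
    have : 0 ≤ ν * v / (ρ * n) := by positivity
    calc (1 - ρ) / ρ * (ν * (v / n)) + ν * (v / n) = ν * v / (ρ * n) := by field_simp; ring
      _ ≤ 2 * (ν * v / (ρ * n)) := by linarith
      _ = _ := by field_simp
  have e9 : (1 - ρ) * (4 * (R1 * v / n) + 4 * (ν * (z * v * (R1 + R) / (n * q)))
      + 16 * ν / ρ * v / n + 4 * (1 + ρ) * (R * (B / q / n)))
      = (1 - ρ) * (16 * ν / ρ + 4 * R1 * (1 + ν * (z / q)) + 4 * ν * R * (z / q)) * v / n
        + 4 * (1 - ρ ^ 2) * B * (R / q) / n := by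
    field_simp; ring
  rw [e9] at l8
  have e10 : 2 * ρ * (1 - ρ) * (E₀ + R2 * v / n)
      = 2 * ρ * (1 - ρ) * E₀ + 2 * ρ * (1 - ρ) * R2 * v / n := by ring
  rw [e10] at l1
  linarith

end Majorant

/-! ### Random volatilities and the oracle inequality. -/

/-- Freezing lemma: independent variables may be integrated one after the other. -/
theorem lintegral_comp_of_indepFun {Ω α β : Type*} [MeasurableSpace Ω] [MeasurableSpace α]
    [MeasurableSpace β] {μ : Measure Ω} [IsProbabilityMeasure μ] {X : Ω → α} {Y : Ω → β}
    (hX : Measurable X) (hY : Measurable Y) (h : IndepFun X Y μ) {F : α → β → ENNReal}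
    (hF : Measurable (Function.uncurry F)) :
    ∫⁻ ω, F (X ω) (Y ω) ∂μ = ∫⁻ ω, ∫⁻ ω', F (X ω) (Y ω') ∂μ ∂μ := by
  have := Measure.isProbabilityMeasure_map (μ := μ) hX.aemeasurable
  have := Measure.isProbabilityMeasure_map (μ := μ) hY.aemeasurable
  have h1 := (indepFun_iff_map_prod_eq_prod_map_map hX.aemeasurable hY.aemeasurable).1 h
  have h2 : ∫⁻ ω, F (X ω) (Y ω) ∂μ
      = ∫⁻ p, Function.uncurry F p ∂(μ.map fun ω => (X ω, Y ω)) := by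
    rw [lintegral_map hF (hX.prodMk hY)]; rfl
  rw [h2, h1, lintegral_prod _ hF.aemeasurable, lintegral_map ?_ hX]
  · refine lintegral_congr fun ω => ?_
    rw [lintegral_map ?_ hY]
    · rfl
    · exact hF.comp measurable_prodMk_left
  · exact hF.lintegral_prod_right'

theorem measurable_coefLoss {α : Type*} [MeasurableSpace α] {n : ℕ} (θ : Fin n → ℝ)
    {s x lam : α → Fin n → ℝ} (hs : Measurable s) (hx : Measurable x) (hl : Measurable lam) :
    Measurable fun a => coefLoss θ (noiseCoef n (s a) (x a)) (lam a) := by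
  unfold coefLoss noiseCoef empFourier
  fun_prop

theorem measurable_lossMajorant {n : ℕ} (m : ℕ) (ρ v : ℝ) (S : ℝ → ℝ) (Lam : Finset (Fin n → ℝ))
    (lam₀ : Fin n → ℝ) :
    Measurable fun p : (Fin n → ℝ) × (Fin n → ℝ) =>
      lossMajorant n m ρ v S Lam lam₀ p.1 p.2 := by
  unfold lossMajorant coefLoss signalRatio diagPart offDiagRatio offDiagPart meanVol
    varianceEstimator noiseCoef empFourier
  simp only [← Real.norm_eq_abs]
  fun_prop

namespace NoiseModel

variable {Ω : Type*} [MeasurableSpace Ω] {μ : Measure Ω} {n : ℕ}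
  {ξ σ : Fin n → Ω → ℝ} {ξs σs : ℝ}

theorem stdNoise (h : NoiseModel μ n ξ σ ξs σs) : StdNoise μ ξ ξs :=
  ⟨h.measurable_noise, h.indep, h.mean, h.second_moment, h.integrable_fourth, h.fourth_moment⟩

variable [IsProbabilityMeasure μ]

theorem memLp_vol_mul_noise (h : NoiseModel μ n ξ σ ξs σs) (l : Fin n) :
    MemLp (fun ω => σ l ω * ξ l ω) 2 μ := by
  have h1 := h.measurable_noise l
  have h2 := h.measurable_vol l
  refine (h.stdNoise.memLp l).of_le_mul (c := √σs) (by fun_prop) ?_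
  filter_upwards [h.vol_bound l] with ω hω
  rw [norm_mul, Real.norm_eq_abs, ← Real.sqrt_sq_eq_abs]
  gcongr

theorem integrable_coefLoss (h : NoiseModel μ n ξ σ ξs σs) (θ lam : Fin n → ℝ) :
    Integrable (fun ω => coefLoss θ (noiseCoef n (fun l => σ l ω) fun l => ξ l ω) lam) μ := by
  have hc : ∀ j, MemLp (fun ω => noiseCoef n (fun l => σ l ω) (fun l => ξ l ω) j) 2 μ := by
    intro j
    have e : (fun ω => noiseCoef n (fun l => σ l ω) (fun l => ξ l ω) j)
        = fun ω => ∑ l, ((1 / (n : ℝ)) * basisValue n j l) * (σ l ω * ξ l ω) := by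
      ext ω
      rw [noiseCoef, empFourier_eq, Finset.mul_sum]
      exact Finset.sum_congr rfl fun l _ => by ring
    rw [e]
    exact memLp_finsetSum _ fun l _ => (h.memLp_vol_mul_noise l).const_mul _
  refine integrable_finsetSum _ fun j _ => MemLp.integrable_sq ?_
  exact (((memLp_const (θ j)).add (hc j)).const_mul (lam j)).sub (memLp_const (θ j))

/-- The bound at frozen volatilities is affine in the frozen risk, so integrating over σ and
unfreezing by independence recovers the true risk. Working with Lebesgue integrals of nonnegative
functions avoids having to prove joint integrability of the majorant first. -/
theorem lintegral_lossMajorant_le (h : NoiseModel μ n ξ σ ξs σs) (hn : Odd n) {m : ℕ} {ρ r : ℝ}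
    (h0 : 0 < ρ) (h3 : ρ < 1 / 3) {Lam : Finset (Fin n → ℝ)}
    (hL : ∀ lam ∈ Lam, ∀ j, lam j ∈ Set.Icc (0 : ℝ) 1) {lam₀ : Fin n → ℝ}
    (hlam₀ : lam₀ ∈ Lam) (hm : 1 ≤ m) (hmn : m ≤ n) {S : ℝ → ℝ}
    (hS : MemSobolevBall r S) (hr : 0 ≤ r) (hσs : 0 ≤ σs) :
    ∫⁻ ω, ENNReal.ofReal (lossMajorant n m ρ σs S Lam lam₀ (fun l => σ l ω) fun l => ξ l ω) ∂μ
      ≤ ENNReal.ofReal ((1 + 3 * ρ - 2 * ρ ^ 2) *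
          ∫ ω, coefLoss (empFourier n fun l => S (design n l))
            (noiseCoef n (fun l => σ l ω) fun l => ξ l ω) lam₀ ∂μ
        + (1 - 3 * ρ) * ((1 / (n : ℝ)) * remainder n m r σs ξs ρ Lam)) := by
  set θ := empFourier n fun l => S (design n l)
  set C := (1 - 3 * ρ) * ((1 / (n : ℝ)) * remainder n m r σs ξs ρ Lam) with hC
  have hξ := h.stdNoise
  have hσm : Measurable fun ω l => σ l ω := measurable_pi_lambda _ h.measurable_vol
  have hξm : Measurable fun ω l => ξ l ω := measurable_pi_lambda _ h.measurable_noise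
  have hC0 : 0 ≤ C := by
    have := remainder_nonneg m hL ξs hr h0 h3 hσs
    have : 0 ≤ 1 - 3 * ρ := by linarith
    positivity
  have hc0 : 0 ≤ 1 + 3 * ρ - 2 * ρ ^ 2 := by nlinarith
  have hfix : ∀ s : Fin n → ℝ, (∀ l, s l ^ 2 ≤ σs) →
      ∫⁻ ω, ENNReal.ofReal (lossMajorant n m ρ σs S Lam lam₀ s fun l => ξ l ω) ∂μ
        ≤ ENNReal.ofReal (1 + 3 * ρ - 2 * ρ ^ 2) *
          ∫⁻ ω, ENNReal.ofReal (coefLoss θ (noiseCoef n s fun l => ξ l ω) lam₀) ∂μ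
          + ENNReal.ofReal C := by
    intro s hs
    obtain ⟨hi, hle⟩ := integral_lossMajorant_le hξ hn h0 h3 hL hlam₀ hs hm hmn hS hr
    rw [← ofReal_integral_eq_lintegral_ofReal hi, ← ofReal_integral_eq_lintegral_ofReal
      (hξ.integrable_coefLoss s θ lam₀) (Eventually.of_forall fun ω => coefLoss_nonneg _ _ _),
      ← ENNReal.ofReal_mul hc0]
    · exact (ENNReal.ofReal_le_ofReal hle).trans ENNReal.ofReal_add_le
    · refine Eventually.of_forall fun ω => ?_
      -- The majorant is nonnegative because it dominates the loss of `lam₀` itself.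
      refine le_trans ?_ (coefLoss_le_lossMajorant hn.pos h0 h3 hL hlam₀ hlam₀ hs le_rfl)
      exact mul_nonneg (by linarith) (coefLoss_nonneg _ _ _)
  have hm1 : Measurable (Function.uncurry fun s x : Fin n → ℝ =>
      ENNReal.ofReal (lossMajorant n m ρ σs S Lam lam₀ s x)) :=
    (measurable_lossMajorant m ρ σs S Lam lam₀).ennreal_ofReal
  have hm2 : Measurable (Function.uncurry fun s x : Fin n → ℝ =>
      ENNReal.ofReal (coefLoss θ (noiseCoef n s x) lam₀)) :=
    (measurable_coefLoss θ measurable_fst measurable_snd measurable_const).ennreal_ofReal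
  have hbound : ∀ᵐ ω ∂μ, ∀ l, σ l ω ^ 2 ≤ σs := ae_all_iff.2 h.vol_bound
  calc ∫⁻ ω, ENNReal.ofReal (lossMajorant n m ρ σs S Lam lam₀ (fun l => σ l ω) fun l => ξ l ω) ∂μ
      = ∫⁻ ω, ∫⁻ ω', ENNReal.ofReal (lossMajorant n m ρ σs S Lam lam₀ (fun l => σ l ω)
          fun l => ξ l ω') ∂μ ∂μ :=
        lintegral_comp_of_indepFun hσm hξm h.indep_vol_noise hm1
    _ ≤ ∫⁻ ω, (ENNReal.ofReal (1 + 3 * ρ - 2 * ρ ^ 2) *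
          ∫⁻ ω', ENNReal.ofReal (coefLoss θ (noiseCoef n (fun l => σ l ω) fun l => ξ l ω') lam₀) ∂μ
          + ENNReal.ofReal C) ∂μ :=
        lintegral_mono_ae (hbound.mono fun ω hω => hfix _ hω)
    _ = ENNReal.ofReal (1 + 3 * ρ - 2 * ρ ^ 2) *
          ∫⁻ ω, ENNReal.ofReal (coefLoss θ (noiseCoef n (fun l => σ l ω) fun l => ξ l ω) lam₀) ∂μ
          + ENNReal.ofReal C := by
        rw [lintegral_add_right _ measurable_const, lintegral_const, measure_univ, mul_one,
          lintegral_const_mul' _ _ ENNReal.ofReal_ne_top,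
          ← lintegral_comp_of_indepFun hσm hξm h.indep_vol_noise hm2]
    _ = _ := by
        rw [← ofReal_integral_eq_lintegral_ofReal (h.integrable_coefLoss θ lam₀)
          (Eventually.of_forall fun ω => coefLoss_nonneg _ _ _), ← ENNReal.ofReal_mul hc0,
          ← ENNReal.ofReal_add (mul_nonneg hc0 (integral_nonneg fun ω => coefLoss_nonneg _ _ _)) hC0]

/-- The oracle inequality for the model selection procedure, together with the finiteness of all
the risks. -/
theorem oracle_inequality (h : NoiseModel μ n ξ σ ξs σs) (hn : Odd n) {m : ℕ} {ρ r : ℝ}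
    (h0 : 0 < ρ) (h3 : ρ < 1 / 3) {Lam : Finset (Fin n → ℝ)} (hne : Lam.Nonempty)
    (hL : ∀ lam ∈ Lam, ∀ j, lam j ∈ Set.Icc (0 : ℝ) 1) (hm : 1 ≤ m) (hmn : m ≤ n) {S : ℝ → ℝ}
    (hS : MemSobolevBall r S) (hr : 0 ≤ r) (hσs : 0 ≤ σs) {lamHat : Ω → Fin n → ℝ}
    (hmin : IsArgmin n m ρ Lam (observation n S ξ σ) lamHat) :
    Integrable (fun ω => lossOf n S (observation n S ξ σ ω) (lamHat ω)) μ ∧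
    (∀ lam ∈ Lam, Integrable (fun ω => lossOf n S (observation n S ξ σ ω) lam) μ) ∧
    ∫ ω, lossOf n S (observation n S ξ σ ω) (lamHat ω) ∂μ
      ≤ (1 + kappa ρ) *
          (⨅ lam : Lam, ∫ ω, lossOf n S (observation n S ξ σ ω) lam.1 ∂μ)
        + (1 / (n : ℝ)) * remainder n m r σs ξs ρ Lam := by
  set θ := empFourier n fun l => S (design n l)
  have hloss : ∀ ω lam, lossOf n S (observation n S ξ σ ω) lam
      = coefLoss θ (noiseCoef n (fun l => σ l ω) fun l => ξ l ω) lam := fun ω lam =>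
    lossOf_eq hn S (fun l => σ l ω) (fun l => ξ l ω) lam
  simp only [hloss]
  have hi := h.integrable_coefLoss θ
  have hmeas : Measurable fun ω =>
      coefLoss θ (noiseCoef n (fun l => σ l ω) fun l => ξ l ω) (lamHat ω) :=
    measurable_coefLoss θ (measurable_pi_lambda _ h.measurable_vol)
      (measurable_pi_lambda _ h.measurable_noise) hmin.1
  have hi' : Integrable (fun ω =>
      coefLoss θ (noiseCoef n (fun l => σ l ω) fun l => ξ l ω) (lamHat ω)) μ := by
    -- The selected loss is one of finitely many nonnegative integrable losses, hence at most their
    -- sum.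
    refine (integrable_finsetSum Lam fun lam _ => hi lam).mono' hmeas.aestronglyMeasurable
      (Eventually.of_forall fun ω => ?_)
    rw [Real.norm_eq_abs, abs_of_nonneg (coefLoss_nonneg _ _ _)]
    exact Finset.single_le_sum (f := fun lam =>
      coefLoss θ (noiseCoef n (fun l => σ l ω) fun l => ξ l ω) lam)
      (fun _ _ => coefLoss_nonneg _ _ _) (hmin.2 ω).1
  refine ⟨hi', fun lam _ => hi lam, ?_⟩
  have h3ρ : 0 < 1 - 3 * ρ := by linarith
  have hc0 : 0 < 1 + 3 * ρ - 2 * ρ ^ 2 := by nlinarith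
  have hκ : 1 + kappa ρ = (1 + 3 * ρ - 2 * ρ ^ 2) / (1 - 3 * ρ) := by
    rw [kappa, eq_div_iff h3ρ.ne', add_mul, div_mul_cancel₀ _ h3ρ.ne']; ring
  have hκ0 : 0 < 1 + kappa ρ := by rw [hκ]; positivity
  set D := (1 / (n : ℝ)) * remainder n m r σs ξs ρ Lam with hD
  have hD0 : 0 ≤ D := mul_nonneg (by positivity) (remainder_nonneg m hL ξs hr h0 h3 hσs)
  have key : ∀ lam₀ ∈ Lam,
      ∫ ω, coefLoss θ (noiseCoef n (fun l => σ l ω) fun l => ξ l ω) (lamHat ω) ∂μ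
        ≤ (1 + kappa ρ) *
          ∫ ω, coefLoss θ (noiseCoef n (fun l => σ l ω) fun l => ξ l ω) lam₀ ∂μ + D := by
    intro lam₀ hlam₀
    have hle := h.lintegral_lossMajorant_le hn h0 h3 hL hlam₀ hm hmn hS hr hσs
    have hpt : ∀ᵐ ω ∂μ, ENNReal.ofReal ((1 - 3 * ρ) *
        coefLoss θ (noiseCoef n (fun l => σ l ω) fun l => ξ l ω) (lamHat ω))
        ≤ ENNReal.ofReal
          (lossMajorant n m ρ σs S Lam lam₀ (fun l => σ l ω) fun l => ξ l ω) := by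
      filter_upwards [ae_all_iff.2 h.vol_bound] with ω hω
      exact ENNReal.ofReal_le_ofReal (coefLoss_le_lossMajorant hn.pos h0 h3 hL hlam₀
        (hmin.2 ω).1 hω ((hmin.2 ω).2 lam₀ hlam₀))
    have h1 := (lintegral_mono_ae hpt).trans hle
    rw [← ofReal_integral_eq_lintegral_ofReal (hi'.const_mul _) (Eventually.of_forall fun ω =>
      mul_nonneg h3ρ.le (coefLoss_nonneg _ _ _)), integral_const_mul] at h1
    have hE0 : 0 ≤ ∫ ω, coefLoss θ (noiseCoef n (fun l => σ l ω) fun l => ξ l ω) lam₀ ∂μ :=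
      integral_nonneg fun ω => coefLoss_nonneg _ _ _
    rw [ENNReal.ofReal_le_ofReal_iff (add_nonneg (mul_nonneg hc0.le hE0)
      (mul_nonneg h3ρ.le hD0))] at h1
    rw [hκ, div_mul_eq_mul_div, div_add' _ _ _ h3ρ.ne', le_div_iff₀ h3ρ]
    linarith
  have : Nonempty Lam := hne.to_subtype
  rw [← sub_le_iff_le_add, ← div_le_iff₀' hκ0]
  refine le_ciInf fun lam => ?_
  rw [div_le_iff₀' hκ0, sub_le_iff_le_add]
  exact key lam.1 lam.2

end NoiseModel

/-! ### Pinsker weights. -/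

/-- The Pinsker weights as a sequence: the entry `i` is the weight of index `i + 1`. -/
noncomputable def pinskerSeq (n β : ℕ) (t : ℝ) (i : ℕ) : ℝ :=
  if i + 1 ≤ ⌊pinskerOmega n β t / Real.log n⌋₊ then 1
  else if ((i + 1 : ℕ) : ℝ) ≤ pinskerOmega n β t then
    1 - (((i + 1 : ℕ) : ℝ) / pinskerOmega n β t) ^ β
  else 0

theorem pinskerWeight_eq (n β : ℕ) (t : ℝ) (j : Fin n) :
    pinskerWeight n β t j = pinskerSeq n β t j := rfl

theorem pinskerConst_nonneg (β : ℕ) : 0 ≤ pinskerConst β := by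
  unfold pinskerConst; positivity

/-- The numerator is at most 6β², and Bernoulli's inequality gives 6β ≤ 9^β ≤ π^{2β}. -/
theorem pinskerConst_le_one {β : ℕ} (hβ : 1 ≤ β) : pinskerConst β ≤ 1 := by
  have hβ' : (1 : ℝ) ≤ β := by exact_mod_cast hβ
  have h9 : (9 : ℝ) ≤ Real.pi ^ 2 := by nlinarith [Real.pi_gt_three]
  have h1 : 6 * (β : ℝ) ≤ Real.pi ^ (2 * β) := by
    calc 6 * (β : ℝ) ≤ 1 + β * 8 := by linarith
      _ ≤ (1 + 8) ^ β := one_add_mul_le_pow (by norm_num) β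
      _ = 9 ^ β := by norm_num
      _ ≤ (Real.pi ^ 2) ^ β := by gcongr
      _ = _ := (pow_mul _ _ _).symm
  unfold pinskerConst
  refine div_le_one_of_le₀ ?_ (by positivity)
  calc ((β : ℝ) + 1) * (2 * β + 1) ≤ (2 * β) * (3 * β) := by
        gcongr <;> linarith
    _ = 6 * β * β := by ring
    _ ≤ _ := by gcongr

theorem pinskerOmega_nonneg (n β : ℕ) {t : ℝ} (ht : 0 ≤ t) : 0 ≤ pinskerOmega n β t := by
  have := pinskerConst_nonneg β
  unfold pinskerOmega; positivity

/-- Since 2n/ε ≥ 1, the exponent 1/(2β + 1) is worst at β = 1. -/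
theorem pinskerOmega_le {n β : ℕ} (hβ : 1 ≤ β) {t ε : ℝ} (hε : 0 < ε) (hε1 : ε ≤ 1) (hn : 1 ≤ n)
    (ht0 : 0 ≤ t) (ht : t ≤ 2 / ε) : pinskerOmega n β t ≤ (2 * n / ε) ^ (1 / 3 : ℝ) := by
  have h0 := pinskerConst_nonneg β
  have h1 := pinskerConst_le_one hβ
  have hn' : (1 : ℝ) ≤ n := by exact_mod_cast hn
  have hβ' : (1 : ℝ) ≤ β := by exact_mod_cast hβ
  have hle : pinskerConst β * t * n ≤ 2 * n / ε := by
    calc pinskerConst β * t * n ≤ 1 * (2 / ε) * n := by gcongr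
      _ = _ := by ring
  have hone : 1 ≤ 2 * n / ε := by
    rw [one_le_div hε]; linarith
  unfold pinskerOmega
  calc (pinskerConst β * t * n) ^ (1 / (2 * (β : ℝ) + 1))
      ≤ (2 * n / ε) ^ (1 / (2 * (β : ℝ) + 1)) := by gcongr
    _ ≤ (2 * n / ε) ^ (1 / 3 : ℝ) := by
      refine Real.rpow_le_rpow_of_exponent_le hone ?_
      gcongr
      linarith

section Seq

variable {n β : ℕ} {t : ℝ}

theorem pinskerSeq_nonneg (ht : 0 ≤ t) (i : ℕ) : 0 ≤ pinskerSeq n β t i := by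
  have hω := pinskerOmega_nonneg n β ht
  unfold pinskerSeq
  split_ifs with h1 h2
  · norm_num
  · rw [sub_nonneg]
    exact pow_le_one₀ (by positivity) (div_le_one_of_le₀ h2 hω)
  · exact le_rfl

theorem pinskerSeq_le_one (ht : 0 ≤ t) (i : ℕ) : pinskerSeq n β t i ≤ 1 := by
  have hω := pinskerOmega_nonneg n β ht
  unfold pinskerSeq
  split_ifs with h1 h2
  · norm_num
  · rw [sub_le_self_iff]; positivity
  · norm_num

theorem pinskerSeq_antitone (ht : 0 ≤ t) : Antitone (pinskerSeq n β t) := by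
  intro i j hij
  have hω := pinskerOmega_nonneg n β ht
  have h0 := pinskerSeq_nonneg (n := n) (β := β) ht i
  have h1 := pinskerSeq_le_one (n := n) (β := β) ht j
  have hij' : ((i + 1 : ℕ) : ℝ) ≤ ((j + 1 : ℕ) : ℝ) := by exact_mod_cast Nat.succ_le_succ hij
  by_cases hi : i + 1 ≤ ⌊pinskerOmega n β t / Real.log n⌋₊
  · have : pinskerSeq n β t i = 1 := by rw [pinskerSeq, if_pos hi]
    rwa [this]
  · by_cases hj : ((j + 1 : ℕ) : ℝ) ≤ pinskerOmega n β t
    · rw [pinskerSeq, pinskerSeq, if_neg hi, if_neg (by omega), if_pos hj,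
        if_pos (hij'.trans hj)]
      gcongr
    · have : pinskerSeq n β t j = 0 := by rw [pinskerSeq, if_neg (by omega), if_neg hj]
      rwa [this]

/-- With log n ≥ 1 the plateau ends before ω, so at most ⌊ω⌋ weights are nonzero, each at most 1. -/
theorem sum_pinskerSeq_le (ht : 0 ≤ t) (hn : 1 ≤ Real.log n) :
    ∑ i ∈ Finset.range n, pinskerSeq n β t i ≤ pinskerOmega n β t := by
  have hω := pinskerOmega_nonneg n β ht
  have hle : ∀ i, pinskerSeq n β t i ≤ if i < ⌊pinskerOmega n β t⌋₊ then 1 else 0 := by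
    intro i
    split_ifs with hi
    · exact pinskerSeq_le_one ht i
    · have h1 : ¬ ((i + 1 : ℕ) : ℝ) ≤ pinskerOmega n β t := fun h => hi (Nat.le_floor h)
      have h2 : ¬ i + 1 ≤ ⌊pinskerOmega n β t / Real.log n⌋₊ := fun h =>
        hi (h.trans (Nat.floor_mono (div_le_self hω hn)))
      rw [pinskerSeq, if_neg h2, if_neg h1]
  refine (Finset.sum_le_sum fun i _ => hle i).trans ?_
  rw [← Finset.sum_filter, Finset.sum_const, nsmul_eq_mul, mul_one]
  refine le_trans ?_ (Nat.floor_le hω)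
  have : Finset.filter (fun i => i < ⌊pinskerOmega n β t⌋₊) (Finset.range n)
      ⊆ Finset.range ⌊pinskerOmega n β t⌋₊ := fun i hi =>
    Finset.mem_range.2 (Finset.mem_filter.1 hi).2
  exact_mod_cast (Finset.card_le_card this).trans_eq (Finset.card_range _)

end Seq

theorem one_le_log {n : ℕ} (hn : 3 ≤ n) : 1 ≤ Real.log n := by
  have h3 : (3 : ℝ) ≤ n := by exact_mod_cast hn
  rw [Real.le_log_iff_exp_le (by linarith)]
  linarith [Real.exp_one_lt_d9]

section Family

variable {n k : ℕ} {ε : ℝ}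

theorem ceil_le_two_div_sq (hε : 0 < ε) (hε1 : ε ≤ 1) :
    ((⌈1 / ε ^ 2⌉₊ : ℕ) : ℝ) ≤ 2 / ε ^ 2 := by
  have h1 : 1 ≤ 1 / ε ^ 2 := by
    rw [one_le_div (by positivity)]
    exact pow_le_one₀ hε.le hε1
  have h2 := (Nat.ceil_lt_add_one (by positivity : 0 ≤ 1 / ε ^ 2)).le
  have h3 : 2 / ε ^ 2 = 1 / ε ^ 2 + 1 / ε ^ 2 := by ring
  linarith

theorem mem_pinskerFamily (hε : 0 < ε) (hε1 : ε ≤ 1) {lam : Fin n → ℝ}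
    (h : lam ∈ pinskerFamily n k ε) :
    ∃ β t, 1 ≤ β ∧ 0 ≤ t ∧ t ≤ 2 / ε ∧ lam = pinskerWeight n β t := by
  obtain ⟨⟨β, j⟩, ha, rfl⟩ := Finset.mem_image.1 h
  simp only [Finset.mem_product, Finset.mem_Icc] at ha
  refine ⟨β, j * ε, ha.1.1, by positivity, ?_, rfl⟩
  have h1 : (j : ℝ) ≤ ((⌈1 / ε ^ 2⌉₊ : ℕ) : ℝ) := by exact_mod_cast ha.2.2
  calc (j : ℝ) * ε ≤ 2 / ε ^ 2 * ε := by
        gcongr; exact h1.trans (ceil_le_two_div_sq hε hε1)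
    _ = 2 / ε := by field_simp

theorem pinskerFamily_mem_Icc (hε : 0 < ε) (hε1 : ε ≤ 1) :
    ∀ lam ∈ pinskerFamily n k ε, ∀ j, lam j ∈ Set.Icc (0 : ℝ) 1 := by
  intro lam h j
  obtain ⟨β, t, -, ht, -, rfl⟩ := mem_pinskerFamily hε hε1 h
  exact ⟨pinskerSeq_nonneg ht j, pinskerSeq_le_one ht j⟩

theorem rhoSum_pinskerFamily_le (hε : 0 < ε) (hε1 : ε ≤ 1) (hn : 3 ≤ n) :
    rhoSum n (pinskerFamily n k ε) ≤ (2 * n / ε) ^ (1 / 3 : ℝ) := by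
  refine Real.iSup_le (fun lam => ?_) (by positivity)
  obtain ⟨β, t, hβ, ht, ht2, h⟩ := mem_pinskerFamily hε hε1 lam.2
  rw [h]
  simp only [pinskerWeight_eq]
  rw [Fin.sum_univ_eq_sum_range (pinskerSeq n β t) n]
  exact (sum_pinskerSeq_le ht (one_le_log hn)).trans
    (pinskerOmega_le hβ hε hε1 (by omega) ht ht2)

/-- Powers of a nonincreasing sequence in [0, 1] are again nonincreasing, so the pair cancellation
bounds every such sum by the first weight. -/
theorem rhoBar_pinskerFamily_le (i : ℕ) (hε : 0 < ε) (hε1 : ε ≤ 1) :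
    rhoBar n i (pinskerFamily n k ε) ≤ 1 := by
  refine Real.iSup_le (fun lam => Real.iSup_le (fun x => ?_) zero_le_one) zero_le_one
  obtain ⟨β, t, -, ht, -, h⟩ := mem_pinskerFamily hε hε1 lam.2
  rw [h]
  simp only [pinskerWeight_eq]
  rw [Fin.sum_univ_eq_sum_range (fun j => pinskerSeq n β t j ^ i * trigBasisBar (j + 1) x) n]
  refine (abs_sum_antitone_mul_trigBasisBar (a := fun j => pinskerSeq n β t j ^ i) ?_ ?_ x n).trans
    (pow_le_one₀ (pinskerSeq_nonneg ht 0) (pinskerSeq_le_one ht 0))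
  · intro a b hab
    exact pow_le_pow_left₀ (pinskerSeq_nonneg ht b) (pinskerSeq_antitone ht hab) i
  · intro j
    exact pow_nonneg (pinskerSeq_nonneg ht j) i

theorem card_pinskerFamily_le (hε : 0 < ε) (hε1 : ε ≤ 1) :
    ((pinskerFamily n k ε).card : ℝ) ≤ k * (2 / ε ^ 2) := by
  have h : (pinskerFamily n k ε).card ≤ k * ⌈1 / ε ^ 2⌉₊ := by
    refine Finset.card_image_le.trans (le_of_eq ?_)
    simp
  calc ((pinskerFamily n k ε).card : ℝ) ≤ ((k * ⌈1 / ε ^ 2⌉₊ : ℕ) : ℝ) := by exact_mod_cast h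
    _ ≤ _ := by
      push_cast
      gcongr
      exact ceil_le_two_div_sq hε hε1

end Family

/-! ### Growth of the remainder for the Pinsker family. -/

/-- The bound is affine in N with coefficients free of n: the assumption on `rhoSum` cancels the
factor 1/√n in `upsilonStar`. -/
theorem psi_le {n : ℕ} {Lam : Finset (Fin n → ℝ)} {σs ξs ρ N : ℝ} (h0 : 0 < ρ) (h3 : ρ < 1 / 3)
    (hσs : 0 ≤ σs) (hn : 1 ≤ n) (hL : ∀ lam ∈ Lam, ∀ j, lam j ∈ Set.Icc (0 : ℝ) 1)
    (hN : (Lam.card : ℝ) ≤ N) (hB1 : rhoBar n 1 Lam ≤ 1) (hB2 : rhoBar n 2 Lam ≤ 1)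
    (hR : rhoSum n Lam ≤ √(n : ℝ)) :
    psi n σs ξs ρ Lam
      ≤ (ρ * (1 - ρ) * 4 + 2 * ρ ^ 2 * (1 - ρ)) / (ρ * (1 - 3 * ρ)) * σs
        + (ρ * (1 - ρ) * (16 / ρ + 8 * √(ξs - 1)) + 2) / (ρ * (1 - 3 * ρ)) * σs * N := by
  have h1ρ : 0 < 1 - ρ := by linarith
  have h3ρ : 0 < 1 - 3 * ρ := by linarith
  have hq : 1 ≤ √(n : ℝ) := Real.one_le_sqrt.2 (by exact_mod_cast hn)
  have hq0 : 0 < √(n : ℝ) := by linarith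
  have hR0 := rhoSum_nonneg hL
  have hN0 : 0 ≤ N := (Nat.cast_nonneg _).trans hN
  have hU : upsilonStar n ξs ρ Lam ≤ 16 * N / ρ + 4 * 1 * (1 + N * √(ξs - 1))
      + 4 * N * √(ξs - 1) := by
    have hz : √(ξs - 1) / √(n : ℝ) ≤ √(ξs - 1) := div_le_self (Real.sqrt_nonneg _) hq
    have hRz : rhoSum n Lam * (√(ξs - 1) / √(n : ℝ)) ≤ √(ξs - 1) := by
      calc rhoSum n Lam * (√(ξs - 1) / √(n : ℝ)) ≤ √(n : ℝ) * (√(ξs - 1) / √(n : ℝ)) := by gcongr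
        _ = √(ξs - 1) := by field_simp
    unfold upsilonStar
    rw [mul_assoc (4 * (Lam.card : ℝ))]
    gcongr
  unfold psi
  calc _ ≤ (ρ * (1 - ρ) * (16 * N / ρ + 4 * 1 * (1 + N * √(ξs - 1)) + 4 * N * √(ξs - 1))
        + 2 * N + 2 * ρ ^ 2 * (1 - ρ) * 1) / (ρ * (1 - 3 * ρ)) * σs := by gcongr
    _ = _ := by ring

/-- The power n^δ is cut into three factors n^{δ/3}: one beats log n, to which k is compared, and
two beat ε⁻². -/
theorem tendsto_card_bound {k : ℕ → ℕ} {ε : ℕ → ℝ}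
    (hk : Tendsto (fun n : ℕ => (k n : ℝ) / Real.log n) atTop (𝓝 0))
    (hε0 : ∀ n, 3 ≤ n → 0 < ε n)
    (hε : ∀ δ : ℝ, 0 < δ → Tendsto (fun n : ℕ => (n : ℝ) ^ δ * ε n) atTop atTop)
    {δ : ℝ} (hδ : 0 < δ) :
    Tendsto (fun n : ℕ => (k n * (2 / ε n ^ 2)) / (n : ℝ) ^ δ) atTop (𝓝 0) := by
  have h1 : Tendsto (fun n : ℕ => Real.log n / (n : ℝ) ^ (δ / 3)) atTop (𝓝 0) :=
    (isLittleO_log_rpow_atTop (by positivity : 0 < δ / 3)).tendsto_div_nhds_zero.comp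
      tendsto_natCast_atTop_atTop
  have h2 : Tendsto (fun n : ℕ => ((n : ℝ) ^ (δ / 3) * ε n)⁻¹) atTop (𝓝 0) :=
    tendsto_inv_atTop_zero.comp (hε _ (by positivity))
  have h3 := ((hk.mul h1).mul (h2.mul h2)).const_mul 2
  simp only [mul_zero] at h3
  refine h3.congr' ?_
  filter_upwards [eventually_ge_atTop 3] with n hn
  have hn' : (0 : ℝ) < n := by positivity
  have hl : Real.log n ≠ 0 := by linarith [one_le_log hn]
  have he := (hε0 n hn).ne'
  have hp : (n : ℝ) ^ δ = (n : ℝ) ^ (δ / 3) * (n : ℝ) ^ (δ / 3) * (n : ℝ) ^ (δ / 3) := by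
    rw [← Real.rpow_add hn', ← Real.rpow_add hn']; congr 1; ring
  have hp0 : (n : ℝ) ^ (δ / 3) ≠ 0 := (Real.rpow_pos_of_pos hn' _).ne'
  rw [hp]
  field_simp

/-- The hypothesis is exactly 2n/ε ≤ n^{3/2}. -/
theorem rpow_third_le_sqrt {n : ℕ} {ε : ℝ} (hε : 0 < ε) (h : 2 ≤ (n : ℝ) ^ (1 / 2 : ℝ) * ε) :
    (2 * n / ε) ^ (1 / 3 : ℝ) ≤ √(n : ℝ) := by
  rw [← Real.sqrt_eq_rpow] at h
  have hle : 2 * n / ε ≤ √(n : ℝ) ^ 3 := by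
    rw [div_le_iff₀ hε]
    calc 2 * (n : ℝ) = n * 2 := by ring
      _ ≤ n * (√(n : ℝ) * ε) := by gcongr
      _ = √(n : ℝ) ^ 2 * (√(n : ℝ) * ε) := by rw [Real.sq_sqrt (Nat.cast_nonneg n)]
      _ = _ := by ring
  calc (2 * n / ε) ^ (1 / 3 : ℝ) ≤ (√(n : ℝ) ^ 3) ^ (1 / 3 : ℝ) := by gcongr
    _ = √(n : ℝ) := by
      rw [← Real.rpow_natCast, ← Real.rpow_mul (Real.sqrt_nonneg _)]
      norm_num

theorem eventually_varsigmaStar_le {m : ℕ → ℕ} {r σs : ℝ} (hr : 0 ≤ r) (hσs : 0 ≤ σs)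
    (hm : ∀ n, 3 ≤ n → 1 ≤ m n)
    (hm1 : Tendsto (fun n : ℕ => (m n : ℝ) / √(n : ℝ)) atTop (𝓝 0))
    (hm2 : Tendsto (fun n : ℕ => (m n : ℝ) ^ 2 / √(n : ℝ)) atTop atTop) :
    ∀ᶠ n in atTop, varsigmaStar n (m n) r σs ≤ 4 * r + 4 * √(r * σs) + 3 * σs := by
  filter_upwards [eventually_ge_atTop 3, hm1.eventually_le_const zero_lt_one,
    hm2.eventually_ge_atTop 1] with n hn h1 h2
  have hm' : (1 : ℝ) ≤ m n := by exact_mod_cast hm n hn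
  have hq : 1 ≤ √(n : ℝ) := Real.one_le_sqrt.2 (by exact_mod_cast (by omega : 1 ≤ n))
  have hq0 : 0 < √(n : ℝ) := by linarith
  rw [one_le_div hq0] at h2
  have a1 : 4 * r * √(n : ℝ) / (m n : ℝ) ^ 2 ≤ 4 * r := by
    rw [div_le_iff₀ (by positivity)]
    gcongr
  have a2 : 4 * √(r * σs) * (1 / (m n : ℝ)) ≤ 4 * √(r * σs) := by
    refine mul_le_of_le_one_right (by positivity) ?_
    rw [div_le_one (by positivity)]; exact hm'
  have a3 : (2 + (m n : ℝ)) * σs / √(n : ℝ) ≤ 3 * σs := by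
    rw [div_le_one hq0] at h1
    rw [div_le_iff₀ hq0]
    calc (2 + (m n : ℝ)) * σs ≤ (2 * √(n : ℝ) + √(n : ℝ)) * σs := by gcongr; linarith
      _ = _ := by ring
  unfold varsigmaStar
  linarith

/-- For the family of Pinsker weights the remainder grows slower than any power of `n`. -/
theorem tendsto_remainder_pinskerFamily {m k : ℕ → ℕ} {ε : ℕ → ℝ} {r σs : ℝ} (ξs : ℝ)
    (hr : 0 ≤ r) (hσs : 0 ≤ σs) (hm : ∀ n, 3 ≤ n → 1 ≤ m n)
    (hm1 : Tendsto (fun n : ℕ => (m n : ℝ) / √(n : ℝ)) atTop (𝓝 0))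
    (hm2 : Tendsto (fun n : ℕ => (m n : ℝ) ^ 2 / √(n : ℝ)) atTop atTop)
    (hε1 : ∀ n, 3 ≤ n → 0 < ε n ∧ ε n ≤ 1)
    (hk : Tendsto (fun n : ℕ => (k n : ℝ) / Real.log n) atTop (𝓝 0))
    (hε : ∀ δ : ℝ, 0 < δ → Tendsto (fun n : ℕ => (n : ℝ) ^ δ * ε n) atTop atTop)
    {δ ρ : ℝ} (hδ : 0 < δ) (h0 : 0 < ρ) (h3 : ρ < 1 / 3) :
    Tendsto (fun n : ℕ =>
      remainder n (m n) r σs ξs ρ (pinskerFamily n (k n) (ε n)) / (n : ℝ) ^ δ) atTop (𝓝 0) := by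
  -- Everything except the cardinality is eventually bounded, so the remainder is at most affine in
  -- the bound for ν.
  obtain ⟨a, b, hab⟩ : ∃ a b : ℝ, ∀ᶠ n : ℕ in atTop,
      remainder n (m n) r σs ξs ρ (pinskerFamily n (k n) (ε n))
        ≤ a + b * (k n * (2 / ε n ^ 2)) := by
    refine ⟨(ρ * (1 - ρ) * 4 + 2 * ρ ^ 2 * (1 - ρ)) / (ρ * (1 - 3 * ρ)) * σs
      + kappaStar ρ * (sigmaBar σs ξs + (4 * r + 4 * √(r * σs) + 3 * σs)) * 1,
      (ρ * (1 - ρ) * (16 / ρ + 8 * √(ξs - 1)) + 2) / (ρ * (1 - 3 * ρ)) * σs, ?_⟩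
    filter_upwards [eventually_ge_atTop 3, (hε (1 / 2) (by norm_num)).eventually_ge_atTop 2,
      eventually_varsigmaStar_le hr hσs hm hm1 hm2] with n hn h2 hς
    obtain ⟨he0, he1⟩ := hε1 n hn
    have hL := pinskerFamily_mem_Icc (n := n) (k := k n) he0 he1
    have hR := (rhoSum_pinskerFamily_le (k := k n) he0 he1 hn).trans (rpow_third_le_sqrt he0 h2)
    have hpsi := psi_le (ξs := ξs) h0 h3 hσs (by omega : 1 ≤ n) hL
      (card_pinskerFamily_le he0 he1) (rhoBar_pinskerFamily_le 1 he0 he1)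
      (rhoBar_pinskerFamily_le 2 he0 he1) hR
    have hR1 : rhoSum n (pinskerFamily n (k n) (ε n)) / √(n : ℝ) ≤ 1 :=
      div_le_one_of_le₀ hR (Real.sqrt_nonneg _)
    have hR0 : 0 ≤ rhoSum n (pinskerFamily n (k n) (ε n)) / √(n : ℝ) :=
      div_nonneg (rhoSum_nonneg hL) (Real.sqrt_nonneg _)
    have hκ := kappaStar_nonneg h0 h3
    have hσ := sigmaBar_nonneg hσs ξs
    have h4 : kappaStar ρ * (sigmaBar σs ξs + varsigmaStar n (m n) r σs)
          * (rhoSum n (pinskerFamily n (k n) (ε n)) / √(n : ℝ))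
        ≤ kappaStar ρ * (sigmaBar σs ξs + (4 * r + 4 * √(r * σs) + 3 * σs)) * 1 := by
      gcongr
    unfold remainder
    linarith
  have h1 : Tendsto (fun n : ℕ => a * ((n : ℝ) ^ δ)⁻¹
      + b * ((k n * (2 / ε n ^ 2)) / (n : ℝ) ^ δ)) atTop (𝓝 0) := by
    have := ((tendsto_inv_atTop_zero.comp ((tendsto_rpow_atTop hδ).comp
      tendsto_natCast_atTop_atTop)).const_mul a).add
      ((tendsto_card_bound hk (fun n hn => (hε1 n hn).1) hε hδ).const_mul b)
    simpa using this
  refine squeeze_zero' ?_ ?_ h1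
  · filter_upwards [eventually_ge_atTop 3] with n hn
    have := remainder_nonneg (m n) (pinskerFamily_mem_Icc (n := n) (k := k n) (hε1 n hn).1
      (hε1 n hn).2) ξs hr h0 h3 hσs
    positivity
  · filter_upwards [hab] with n hn
    calc remainder n (m n) r σs ξs ρ (pinskerFamily n (k n) (ε n)) / (n : ℝ) ^ δ
        ≤ (a + b * (k n * (2 / ε n ^ 2))) / (n : ℝ) ^ δ := by gcongr
      _ = _ := by ring

end HeteroRegression

theorem theorem3p2 (r σs ξs : ℝ) (hr : 0 < r) (hσs : 1 ≤ σs)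
    (m : ℕ → ℕ) (hm : ∀ n, 3 ≤ n → 1 ≤ m n ∧ m n ≤ n)
    (hm1 : Tendsto (fun n : ℕ => (m n : ℝ) / √(n : ℝ)) atTop (𝓝 0))
    (hm2 : Tendsto (fun n : ℕ => (m n : ℝ) ^ 2 / √(n : ℝ)) atTop atTop) :
    (∀ (n : ℕ), Odd n → 3 ≤ n →
      ∀ (ρ : ℝ), 0 < ρ → ρ < 1 / 3 →
      ∀ (Lam : Finset (Fin n → ℝ)), Lam.Nonempty →
        (∀ lam ∈ Lam, ∀ j, lam j ∈ Set.Icc (0 : ℝ) 1) →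
      ∀ (S : ℝ → ℝ), MemSobolevBall r S →
      ∀ (Ω : Type*) [MeasurableSpace Ω] (μ : Measure Ω) [IsProbabilityMeasure μ]
        (ξ σ : Fin n → Ω → ℝ), NoiseModel μ n ξ σ ξs σs →
      ∀ (lamHat : Ω → Fin n → ℝ),
        IsArgmin n (m n) ρ Lam (observation n S ξ σ) lamHat →
        Integrable (fun ω => lossOf n S (observation n S ξ σ ω) (lamHat ω)) μ ∧
        (∀ lam ∈ Lam, Integrable (fun ω => lossOf n S (observation n S ξ σ ω) lam) μ) ∧
        ∫ ω, lossOf n S (observation n S ξ σ ω) (lamHat ω) ∂μ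
          ≤ (1 + kappa ρ) *
              (⨅ lam : Lam, ∫ ω, lossOf n S (observation n S ξ σ ω) lam.1 ∂μ)
            + (1 / (n : ℝ)) * remainder n (m n) r σs ξs ρ Lam) ∧
    (∀ (k : ℕ → ℕ) (ε : ℕ → ℝ),
      (∀ n, 3 ≤ n → 1 ≤ k n) → (∀ n, 3 ≤ n → 0 < ε n ∧ ε n ≤ 1) →
      Tendsto k atTop atTop →
      Tendsto (fun n : ℕ => (k n : ℝ) / Real.log n) atTop (𝓝 0) →
      Tendsto ε atTop (𝓝 0) →
      (∀ δ : ℝ, 0 < δ → Tendsto (fun n : ℕ => (n : ℝ) ^ δ * ε n) atTop atTop) →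
      ∀ (δ ρ : ℝ), 0 < δ → 0 < ρ → ρ < 1 / 3 →
        Tendsto (fun n : ℕ =>
          remainder n (m n) r σs ξs ρ (pinskerFamily n (k n) (ε n)) / (n : ℝ) ^ δ)
          atTop (𝓝 0)) := by
  have hσ0 : 0 ≤ σs := by linarith
  refine ⟨?_, ?_⟩
  · intro n hodd hn ρ h0 h3 Lam hne hL S hS Ω _ μ _ ξ σ hN lamHat hmin
    exact hN.oracle_inequality hodd h0 h3 hne hL (hm n hn).1 (hm n hn).2 hS hr.le hσ0 hmin
  · intro k ε _ hε1 _ hk _ hε δ ρ hδ h0 h3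
    exact tendsto_remainder_pinskerFamily ξs hr.le hσ0 (fun n hn => (hm n hn).1) hm1 hm2 hε1 hk
      hε hδ h0 h3
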